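/- Let $k=\mathbb F_q$ be a finite field and let $F$ be the function field of a smooth connected projective curve $C$ over $k$. Fix a closed point $\infty\in C$, and let $A\subset F$ be the ring of functions that are regular outside $\infty$. For $0\ne a\in A$ put $\deg_A(a)=\dim_k(A/Aa)$. Let $R$ be a noetherian integral domain that is a $k$-algebra, and let $R[\tau]$ be the twisted polynomial ring with $\tau\xi=\xi^q\tau$ for $\xi\in R$. Let $\varphi\colon A\to R[\tau]$ be a Drinfeld $A$-module of rank $r\ge1$ over $R$. This means that $\varphi$ is a $k$-algebra homomorphism such that for every $0\ne a\in A$ the element $\varphi_a$ has degree $r\deg_A(a)$ in $\tau$ with leading coefficient a unit of $R$. Let $\wp\subset A$ be the kernel of the characteristic $c^*\colon A\to R$, which sends $a$ to the constant coefficient of $\varphi_a$, and assume that $\wp$ is a maximal ideal. **Notation.** Let $A_\wp$ be the $\wp$-adic completion of $A$, let $F_\wp$ be its fraction field, let $z$ be a uniformizer of $A_\wp$, and let $d=\dim_k(A/\wp)$. For a $k$-algebra $R'$, let $\mathcal E_{A_\wp,R'}=A_\wp\hat\otimes_k R'=\varprojlim_n (A/\wp^n)\otimes_k R'$ and $\mathcal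 E_{F_\wp,R'}=F_\wp\hat\otimes_kR'=\mathcal E_{A_\wp,R'}[z^{-1}]$, both with the endomorphism $\sigma$ induced by $a\otimes\xi\mapsto a\otimes\xi^q$. An *$F_\wp$-isocrystal over $R'$* is a finitely generated projective $\mathcal E_{F_\wp,R'}$-module $M$ with a $\sigma$-semilinear map $\tau\colon M\to M$ whose linearization $\sigma^*M\to M$ is an isomorphism. It is *pure of slope $\alpha\in\mathbb Q$* if there exist an integer $n>0$ with $n\alpha\in\mathbb Z$ and a finitely generated projective $\mathcal E_{A_\wp,R'}$-submodule $L\subset M$ with $L[z^{-1}]=M$ such that $\tau^{nd}L$ generates $z^{n\alpha}L$. A *slope filtration* of $M$ is a separated, exhaustive, right continuous, ascending filtration by $\tau$-stable submodules $M_{\le\alpha}$ ($\alpha\in\mathbb Q$) that are isocrystals, such that each $M_\alpha=M_{\le\alpha}/\bigcup_{\beta<\alpha}M_{\le\beta}$ is an isocrystal that is pure of slope $\alpha$. The *multiplicity* of $\alpha$ is the rank of $M_\alpha$. Let $\mathcal M=R[\tau]$, viewed as an $A\otimes_kR$-module by $(a\otimes\xi)m=\xi\,m\,\varphi_a$, with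 $\tau$ acting by left multiplication. For an $R$-algebra $R'$ let $\mathcal M_{F,\wp}=\mathcal E_{F_\wp,R'}\otimes_{A\otimes_kR}\mathcal M$, with $\tau(e\otimes m)=\sigma(e)\otimes\tau m$. **Proposition.** There is an integer $1\le h\le r$ (the height of $\varphi$) such that for every non-zero $a_\wp\in A$ with $(a_\wp)=\wp^n$ for some $n\ge1$, we have $$\varphi_{a_\wp}=\epsilon_\wp\,\tau^{h\deg_A(a_\wp)}+(\text{higher terms in }\tau),\qquad 0\ne\epsilon_\wp\in R,$$ and the module $\mathcal M_{F,\wp}$ over $R'=R[\epsilon_\wp^{-1}]$ is an $F_\wp$-isocrystal over $R[\epsilon_\wp^{-1}]$. It possesses a slope filtration in which the slope $0$ has multiplicity $r-h$, the slope $1/h$ has multiplicity $h$, and every other slope has multiplicity $0$. -/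

import Mathlib

open scoped TensorProduct

noncomputable section

/-! ## Function fields and their rings of functions regular outside a point -/

/-- `F` is the function field of a (smooth connected projective) curve over `k`: it is a finite
extension of a rational function field `k(x)`. -/
def IsCurveFunctionField (k F : Type*) [Field k] [Field F] [Algebra k F] : Prop :=
  ∃ x : F, Transcendental k x ∧ FiniteDimensional (IntermediateField.adjoin k {x}) F

/-- Elements of a finite subfield lie in every valuation ring. -/
theorem algebraMap_mem_valuationSubring {k F : Type*} [Field k] [Finite k] [Field F] [Algebra k F]
    (V : ValuationSubring F) (c : k) : algebraMap k F c ∈ V := by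
  have := Fintype.ofFinite k
  by_cases hc : c = 0
  · simp [hc, V.zero_mem]
  · rw [← V.valuation_le_one_iff]
    have h1 : c ^ (Fintype.card k - 1) = 1 := FiniteField.pow_card_sub_one_eq_one c hc
    have h2 : (V.valuation (algebraMap k F c)) ^ (Fintype.card k - 1) = 1 := by
      rw [← map_pow, ← map_pow, h1]; simp
    have h3 : Fintype.card k - 1 ≠ 0 := by have := Fintype.one_lt_card (α := k); omega
    exact le_of_not_gt fun h => (one_lt_pow₀ h h3).ne' h2

/-- The closed points of the smooth projective curve with function field `F` over the finite field
`k` are the nontrivial valuation rings of `F` (these automatically contain `k`).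
For a closed point `pt` this is the ring `A ⊆ F` of all functions that are regular outside `pt`. -/
def regularOutside (k : Type*) {F : Type*} [Field k] [Finite k] [Field F] [Algebra k F]
    (pt : ValuationSubring F) : Subalgebra k F where
  carrier := {x | ∀ V : ValuationSubring F, V ≠ ⊤ → V ≠ pt → x ∈ V}
  mul_mem' hx hy V h1 h2 := V.mul_mem _ _ (hx V h1 h2) (hy V h1 h2)
  add_mem' hx hy V h1 h2 := V.add_mem _ _ (hx V h1 h2) (hy V h1 h2)
  algebraMap_mem' c V _ _ := algebraMap_mem_valuationSubring V c

/-! ## Twisted polynomial rings -/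

/-- The twisted polynomial ring `E[τ]` of all finite expressions `∑ eᵢ τⁱ` with `τ e = σ(e) τ`. -/
def TwistedPolynomial {k E : Type*} [CommRing k] [CommRing E] [Algebra k E]
    (_σ : E →ₐ[k] E) : Type _ :=
  SkewPolynomial E

namespace TwistedPolynomial

variable {k E : Type*} [CommRing k] [CommRing E] [Algebra k E] (σ : E →ₐ[k] E)

/-- The action of `ℕ` on `E` through the iterates of `σ`. -/
abbrev iterateAction : MulSemiringAction (Multiplicative ℕ) E where
  smul n e := (σ ^ n.toAdd) e
  one_smul _ := rfl
  mul_smul m n e := by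
    change (σ ^ (m.toAdd + n.toAdd)) e = (σ ^ m.toAdd) ((σ ^ n.toAdd) e)
    rw [pow_add]; rfl
  smul_zero n := map_zero (σ ^ n.toAdd)
  smul_add n := map_add (σ ^ n.toAdd)
  smul_one n := map_one (σ ^ n.toAdd)
  smul_mul n := map_mul (σ ^ n.toAdd)

instance : Ring (TwistedPolynomial σ) :=
  letI := iterateAction σ
  inferInstanceAs (Ring (SkewMonoidAlgebra E (Multiplicative ℕ)))

instance : Module k (TwistedPolynomial σ) :=
  letI := iterateAction σ
  inferInstanceAs (Module k (SkewMonoidAlgebra E (Multiplicative ℕ)))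

variable {σ}

/-- The coefficient of `τⁱ`. -/
def coeff (f : TwistedPolynomial σ) (i : ℕ) : E := SkewPolynomial.coeff f i

variable (σ) in
/-- The monomial `e τⁱ`. -/
def monomial (i : ℕ) (e : E) : TwistedPolynomial σ := SkewPolynomial.monomial i e

theorem monomial_mul_monomial (i j : ℕ) (x y : E) :
    monomial σ i x * monomial σ j y = monomial σ (i + j) (x * (σ ^ i) y) :=
  letI := iterateAction σ
  show (SkewPolynomial.monomial i x * SkewPolynomial.monomial j y : SkewPolynomial E) =
      SkewPolynomial.monomial (i + j) (x * (Multiplicative.ofAdd i • y)) from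
    SkewMonoidAlgebra.single_mul_single

theorem induction_on {p : TwistedPolynomial σ → Prop} (f : TwistedPolynomial σ)
    (zero : p 0) (mono : ∀ i e, p (monomial σ i e)) (add : ∀ f g, p f → p g → p (f + g)) : p f :=
  SkewPolynomial.induction (motive := p) f zero
    (fun n r q _ _ hq => add (monomial σ n r) q (mono n r) hq)

variable (σ) in
theorem monomial_add (i : ℕ) (x y : E) :
    monomial σ i (x + y) = monomial σ i x + monomial σ i y :=
  SkewPolynomial.monomial_add i x y

theorem smul_monomial (c : k) (i : ℕ) (x : E) : c • monomial σ i x = monomial σ i (c • x) :=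
  SkewPolynomial.smul_monomial i c x

theorem coeff_monomial (i j : ℕ) (x : E) : coeff (monomial σ i x) j = if i = j then x else 0 :=
  SkewPolynomial.coeff_monomial

theorem coeff_add (f g : TwistedPolynomial σ) (i : ℕ) : coeff (f + g) i = coeff f i + coeff g i :=
  SkewPolynomial.coeff_add f g i

theorem coeff_zero (i : ℕ) : coeff (0 : TwistedPolynomial σ) i = 0 := rfl

instance : Algebra k (TwistedPolynomial σ) :=
  Algebra.ofModule
    (fun c f g => by
      induction f using induction_on with
      | zero => simp
      | add f f' h h' => simp only [smul_add, add_mul, h, h']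
      | mono i x =>
        induction g using induction_on with
        | zero => simp
        | add f f' h h' => simp only [smul_add, mul_add, h, h']
        | mono j y => simp only [smul_monomial, monomial_mul_monomial, smul_mul_assoc])
    (fun c f g => by
      induction f using induction_on with
      | zero => simp
      | add f f' h h' => simp only [smul_add, add_mul, h, h']
      | mono i x =>
        induction g using induction_on with
        | zero => simp
        | add f f' h h' => simp only [smul_add, mul_add, h, h']
        | mono j y => simp only [smul_monomial, monomial_mul_monomial, map_smul, mul_smul_comm])

variable (σ) in
/-- The embedding `E → E[τ]` as constants. -/
def C : E →ₐ[k] TwistedPolynomial σ :=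
  AlgHom.ofLinearMap
    { toFun := monomial σ 0
      map_add' := monomial_add σ 0
      map_smul' := fun c x => (smul_monomial c 0 x).symm }
    rfl (fun x y => by
      change monomial σ 0 (x * y) = monomial σ 0 x * monomial σ 0 y
      rw [monomial_mul_monomial]; simp)

variable (σ) in
/-- The variable `τ`. -/
def tau : TwistedPolynomial σ := monomial σ 1 1

theorem tau_mul_C (e : E) : tau σ * C σ e = C σ (σ e) * tau σ := by
  change monomial σ 1 1 * monomial σ 0 e = monomial σ 0 (σ e) * monomial σ 1 1
  rw [monomial_mul_monomial, monomial_mul_monomial]; simp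

variable (σ) in
/-- The derivative at zero `d : E[τ] → E`, `∑ eᵢ τⁱ ↦ e₀`. -/
def constantCoeff : TwistedPolynomial σ →ₐ[k] E :=
  AlgHom.ofLinearMap
    { toFun := fun f => coeff f 0
      map_add' := fun f g => coeff_add f g 0
      map_smul' := fun c f => by
        induction f using induction_on with
        | zero => simp [coeff_zero]
        | add f f' h h' => simp_all [smul_add, coeff_add]
        | mono i x => rw [smul_monomial, coeff_monomial, coeff_monomial]; split_ifs <;> simp }
    ((coeff_monomial (σ := σ) 0 0 (1 : E)).trans (if_pos rfl)) (fun f g => by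
      change coeff (f * g) 0 = coeff f 0 * coeff g 0
      induction f using induction_on with
      | zero => simp [coeff_zero]
      | add f f' h h' => simp only [coeff_add, add_mul, h, h']
      | mono i x =>
        induction g using induction_on with
        | zero => simp [coeff_zero]
        | add f f' h h' => simp only [coeff_add, mul_add, h, h']
        | mono j y =>
          rw [monomial_mul_monomial, coeff_monomial, coeff_monomial, coeff_monomial]
          rcases i with _ | i <;> rcases j with _ | j <;> simp)

/-- `f = e τᵈ + (higher terms)`. -/
def HasLowestTerm (f : TwistedPolynomial σ) (d : ℕ) (e : E) : Prop :=
  (∀ i < d, coeff f i = 0) ∧ coeff f d = e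

/-- `f` is elliptic of degree `d`: it has degree `d` and its highest coefficient is a unit. -/
def IsElliptic (f : TwistedPolynomial σ) (d : ℕ) : Prop :=
  IsUnit (coeff f d) ∧ ∀ i, d < i → coeff f i = 0

end TwistedPolynomial

/-! ## Modules over a difference ring

A left `E[τ]`-module over a difference ring `(E, σ)` is given by an `E`-module `M` together with a
`σ`-semilinear map `τ : M → M`. -/

/-- The ring `E'`, viewed as an `E`-algebra through the ring homomorphism `f : E → E'`. -/
def ScalarsVia {E E' : Type*} [CommRing E] [CommRing E'] (_f : E →+* E') : Type _ := E'

namespace ScalarsVia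

variable {E E' : Type*} [CommRing E] [CommRing E'] (f : E →+* E')

instance : CommRing (ScalarsVia f) := inferInstanceAs (CommRing E')
instance : Algebra E (ScalarsVia f) := f.toAlgebra

end ScalarsVia

/-- The base change `f^*M = E' ⊗_{E,f} M` of an `E`-module along a ring homomorphism
`f : E → E'`, as an `E'`-module. -/
def BaseChange {E E' : Type*} [CommRing E] [CommRing E'] (f : E →+* E') (M : Type*)
    [AddCommGroup M] [Module E M] : Type _ :=
  ScalarsVia f ⊗[E] M

namespace BaseChange

variable {E E' : Type*} [CommRing E] [CommRing E'] (f : E →+* E') (M : Type*)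
  [AddCommGroup M] [Module E M]

instance : AddCommGroup (BaseChange f M) := inferInstanceAs (AddCommGroup (ScalarsVia f ⊗[E] M))
instance : Module E' (BaseChange f M) := inferInstanceAs (Module (ScalarsVia f) (ScalarsVia f ⊗[E] M))

variable {M}

/-- The pure tensor `e ⊗ m` in `E' ⊗_{E,f} M`. -/
def tmul (e : E') (m : M) : BaseChange f M := TensorProduct.tmul E (show ScalarsVia f from e) m

variable {f} in
theorem induction_on {p : BaseChange f M → Prop} (x : BaseChange f M) (zero : p 0)
    (tmul : ∀ e m, p (tmul f e m)) (add : ∀ x y, p x → p y → p (x + y)) : p x :=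
  TensorProduct.induction_on (motive := p) x zero tmul add

variable {f} in
/-- The additive map `E' ⊗_{E,f} M → N` induced by a balanced biadditive map. -/
def lift {N : Type*} [AddCommGroup N] (g : E' →+ M →+ N)
    (hg : ∀ (e : E) (e' : E') (m : M), g (f e * e') m = g e' (e • m)) : BaseChange f M →+ N :=
  TensorProduct.liftAddHom (M := ScalarsVia f) (R := E) (N := M) g hg

end BaseChange

section DifferenceModules

variable {E : Type*} [CommRing E] {σ : E →+* E} {M : Type*} [AddCommGroup M] [Module E M]

/-- The structure morphism `τ^lin : σ^*M = E ⊗_{E,σ} M → M`, `e ⊗ m ↦ e τ(m)`. -/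
def linearization (τ : M →ₛₗ[σ] M) : BaseChange σ M →ₗ[E] M :=
  { BaseChange.lift (f := σ)
      (AddMonoidHom.mk' (fun e => (AddMonoidHom.mk' (fun m => e • τ m) (by simp)))
        (by intro a b; ext m; simp [add_smul]))
      (by
        intro e e' m
        change (σ e * e') • τ m = e' • τ (e • m)
        rw [map_smulₛₗ, mul_comm, mul_smul]) with
    map_smul' := by
      intro e x
      induction x using BaseChange.induction_on with
      | zero => simp
      | add x y hx hy => simp_all [smul_add]
      | tmul e' m => exact mul_smul e e' (τ m) }

/-- The left `E[τ]`-module `(M, τ)` is dualizable: `M` is finitely generated projective over `E`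
and the structure morphism is an isomorphism. -/
structure IsDualizable (τ : M →ₛₗ[σ] M) : Prop where
  finite : Module.Finite E M
  projective : Module.Projective E M
  bijective : Function.Bijective (linearization τ)

/-- The base change `f^*(M, τ)` along a morphism `f` of difference rings, with
`τ(e' ⊗ m) = σ'(e') ⊗ τ(m)`. -/
def baseChangeTau {E' : Type*} [CommRing E'] {σ' : E' →+* E'} (f : E →+* E')
    (hf : ∀ e, f (σ e) = σ' (f e)) (τ : M →ₛₗ[σ] M) : BaseChange f M →ₛₗ[σ'] BaseChange f M :=
  { BaseChange.lift (f := f)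
      (AddMonoidHom.mk' (fun e => (AddMonoidHom.mk' (fun m => BaseChange.tmul f (σ' e) (τ m))
          (by intro a b; simp only [map_add]; exact TensorProduct.tmul_add _ _ _)))
        (by intro a b; ext m; simp only [map_add]; exact TensorProduct.add_tmul _ _ _))
      (by
        intro e e' m
        change BaseChange.tmul f (σ' (f e * e')) (τ m) = BaseChange.tmul f (σ' e') (τ (e • m))
        rw [map_mul, ← hf, map_smulₛₗ]
        exact TensorProduct.smul_tmul (σ e) (show ScalarsVia f from σ' e') (τ m)) with
    map_smul' := by
      intro e x
      induction x using BaseChange.induction_on with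
      | zero => simp
      | add x y hx hy => simp_all [smul_add]
      | tmul e' m =>
        change BaseChange.tmul f (σ' (e * e')) (τ m) = σ' e • BaseChange.tmul f (σ' e') (τ m)
        rw [map_mul]; rfl }

/-- The restriction of `τ` to a `τ`-stable submodule. -/
def subTau (τ : M →ₛₗ[σ] M) (N : Submodule E M) (hN : N ≤ N.comap τ) : N →ₛₗ[σ] N :=
  (τ.domRestrict N).codRestrict N fun x => hN x.2

end DifferenceModules

/-! ## Local isocrystals over a ring -/

section LocalIsocrystals

variable (k : Type*) [Field k] [Fintype k] {B : Type*} [CommRing B] [Algebra k B]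
  (P : Ideal B) (R : Type*) [CommRing R] [Algebra k R]

/-- The partial Frobenius `a ⊗ ξ ↦ a ⊗ ξ^q` on `B ⊗_k R`, where `q = |k|`. -/
def partialFrobenius (B : Type*) [CommRing B] [Algebra k B] : B ⊗[k] R →ₐ[B] B ⊗[k] R :=
  Algebra.TensorProduct.map (AlgHom.id B B) (FiniteField.frobeniusAlgHom k R)

/-- For a Dedekind domain `B` over `k` with a maximal ideal `P`, let `B_P` denote the `P`-adic
completion of `B` and `F_P` its quotient field. This is the ring `B_P ⊗̂_k R`, where `R` is discrete.
Since `B_P / P^n B_P = B / P^n`, it is the inverse limit of the rings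
`(B / P^n) ⊗_k R = (B ⊗_k R) / P^n (B ⊗_k R)`. -/
abbrev IntegralCoeffRing : Type _ :=
  AdicCompletion (P.map (algebraMap B (B ⊗[k] R))) (B ⊗[k] R)

/-- The ring `F_P ⊗̂_k R`, obtained from `B_P ⊗̂_k R` by inverting a uniformizer of `B_P`, or
equivalently all non-zero elements of `B`. -/
abbrev CoeffRing : Type _ :=
  Localization (Algebra.algebraMapSubmonoid (IntegralCoeffRing k P R) (nonZeroDivisors B))

theorem partialFrobenius_le (n : ℕ) :
    (P.map (algebraMap B (B ⊗[k] R))) ^ n ≤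
      ((P.map (algebraMap B (B ⊗[k] R))) ^ n).comap (partialFrobenius k R B) := by
  rw [← Ideal.map_pow, Ideal.map_le_iff_le_comap]
  intro x hx
  rw [Ideal.mem_comap, Ideal.mem_comap, AlgHom.commutes]
  exact Ideal.mem_map_of_mem _ hx

theorem integralSigma_compat {m n : ℕ} (hle : m ≤ n) :
    (Ideal.Quotient.factorPow (P.map (algebraMap B (B ⊗[k] R))) hle).comp
      ((Ideal.quotientMap _ (partialFrobenius k R B : B ⊗[k] R →+* B ⊗[k] R)
        (partialFrobenius_le k P R n)).comp
        (AdicCompletion.evalₐ (P.map (algebraMap B (B ⊗[k] R))) n).toRingHom) =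
      (Ideal.quotientMap _ (partialFrobenius k R B : B ⊗[k] R →+* B ⊗[k] R)
        (partialFrobenius_le k P R m)).comp
        (AdicCompletion.evalₐ (P.map (algebraMap B (B ⊗[k] R))) m).toRingHom := by
  ext x
  obtain ⟨x, rfl⟩ := AdicCompletion.mk_surjective _ _ x
  have h := congrArg (Ideal.quotientMap _ (partialFrobenius k R B : B ⊗[k] R →+* B ⊗[k] R)
    (partialFrobenius_le k P R m)) (AdicCompletion.Ideal.mk_eq_mk _ hle x)
  simp only [AlgHom.toRingHom_eq_coe, RingHom.coe_comp, RingHom.coe_coe, Function.comp_apply,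
    AdicCompletion.evalₐ_mk]
  refine Eq.trans ?_ h
  rfl

/-- The partial Frobenius `σ` on `B_P ⊗̂_k R`. -/
def integralSigma : IntegralCoeffRing k P R →+* IntegralCoeffRing k P R :=
  AdicCompletion.liftRingHom (P.map (algebraMap B (B ⊗[k] R)))
    (fun n => (Ideal.quotientMap _ (partialFrobenius k R B : B ⊗[k] R →+* B ⊗[k] R)
      (partialFrobenius_le k P R n)).comp
      (AdicCompletion.evalₐ (P.map (algebraMap B (B ⊗[k] R))) n).toRingHom)
    (fun hle => integralSigma_compat k P R hle)

theorem integralSigma_algebraMap (x : B ⊗[k] R) :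
    integralSigma k P R (algebraMap _ _ x) = algebraMap _ _ (partialFrobenius k R B x) := by
  refine AdicCompletion.ext_evalₐ (I := P.map (algebraMap B (B ⊗[k] R))) fun n => ?_
  refine (AdicCompletion.evalₐ_liftRingHom (P.map (algebraMap B (B ⊗[k] R))) _
    (fun hle => integralSigma_compat k P R hle) n _).trans ?_
  simp
  rfl

theorem integralSigma_algebraMap_base (b : B) :
    integralSigma k P R (algebraMap _ _ b) = algebraMap _ _ b := by
  rw [IsScalarTower.algebraMap_apply B (B ⊗[k] R) (IntegralCoeffRing k P R),
    integralSigma_algebraMap, AlgHom.commutes]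

/-- The partial Frobenius `σ` on `F_P ⊗̂_k R`. -/
def coeffSigma : CoeffRing k P R →+* CoeffRing k P R :=
  IsLocalization.map (M := Algebra.algebraMapSubmonoid (IntegralCoeffRing k P R) (nonZeroDivisors B))
    (T := Algebra.algebraMapSubmonoid (IntegralCoeffRing k P R) (nonZeroDivisors B))
    (CoeffRing k P R) (integralSigma k P R) (by
      rintro _ ⟨b, hb, rfl⟩
      exact ⟨b, hb, (integralSigma_algebraMap_base k P R b).symm⟩)

variable {k P R} {M : Type*} [AddCommGroup M] [Module (CoeffRing k P R) M]

/-- `(M, τ)` is an `F_P`-isocrystal over `R`. -/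
abbrev IsIsocrystal (τ : M →ₛₗ[coeffSigma k P R] M) : Prop := IsDualizable τ

/-- The isocrystal `(M, τ)` is pure of slope `α`: there are an integer `n > 0` with `m := nα ∈ ℤ` and
a lattice `L` in `M` (a finitely generated projective `B_P ⊗̂_k R`-submodule that becomes `M` after
inverting a uniformizer `z`) such that `τ^{n d} L` generates the lattice `z^m L`, where `d` is the
degree over `k` of the residue field of `P`. Since `z` and `P` generate the same ideal of
`B_P ⊗̂_k R`, the last condition is written as an equality between multiples of lattices by powers
of `P` with non-negative exponents. -/
def IsPure (τ : M →ₛₗ[coeffSigma k P R] M) (α : ℚ) : Prop :=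
  letI : Module (IntegralCoeffRing k P R) M :=
    Module.compHom M (algebraMap (IntegralCoeffRing k P R) (CoeffRing k P R))
  ∃ n : ℕ, 0 < n ∧ ∃ m : ℤ, (m : ℚ) = n * α ∧
    ∃ L : Submodule (IntegralCoeffRing k P R) M,
      Module.Finite (IntegralCoeffRing k P R) L ∧
      Module.Projective (IntegralCoeffRing k P R) L ∧
      Submodule.span (CoeffRing k P R) (L : Set M) = ⊤ ∧
      (P.map (algebraMap B (IntegralCoeffRing k P R))) ^ (-m).toNat •
          Submodule.span (IntegralCoeffRing k P R)
            ((τ^[n * Module.finrank k (B ⧸ P)]) '' (L : Set M)) =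
        (P.map (algebraMap B (IntegralCoeffRing k P R))) ^ m.toNat • L

section Filtration

variable (fil : ℚ → Submodule (CoeffRing k P R) M)

/-- `M_{<α} = ⋃_{β<α} M_{≤β}` for an ascending filtration `fil α = M_{≤α}`. -/
def filLT (α : ℚ) : Submodule (CoeffRing k P R) M := ⨆ β : {β : ℚ // β < α}, fil β

/-- The subquotient `M_α = M_{≤α} / M_{<α}`. -/
abbrev Gr (α : ℚ) : Type _ := fil α ⧸ (filLT fil α).submoduleOf (fil α)

theorem filLT_stable (τ : M →ₛₗ[coeffSigma k P R] M) (h : ∀ α, fil α ≤ (fil α).comap τ) (α : ℚ) :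
    filLT fil α ≤ (filLT fil α).comap τ :=
  iSup_le fun β => (h β).trans (Submodule.comap_mono (le_iSup (fun β : {β : ℚ // β < α} => fil β) β))

/-- The map induced by `τ` on the subquotient `M_α`. -/
def grTau (τ : M →ₛₗ[coeffSigma k P R] M) (h : ∀ α, fil α ≤ (fil α).comap τ) (α : ℚ) :
    Gr fil α →ₛₗ[coeffSigma k P R] Gr fil α :=
  Submodule.mapQ _ _ (subTau τ (fil α) (h α)) fun _ hx => filLT_stable fil τ h α hx

/-- `fil` is a slope filtration of the isocrystal `(M, τ)`: a separated exhaustive right continuous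
ascending filtration by isocrystals `M_{≤α}` indexed by all `α ∈ ℚ`, such that every subquotient
`M_α` is an isocrystal that is pure of slope `α`. -/
structure IsSlopeFiltration (τ : M →ₛₗ[coeffSigma k P R] M) : Prop where
  stable : ∀ α, fil α ≤ (fil α).comap τ
  mono : Monotone fil
  separated : ⨅ α, fil α = ⊥
  exhaustive : ⨆ α, fil α = ⊤
  right_continuous : ∀ α, ⨅ β : {β : ℚ // α < β}, fil β = fil α
  isocrystal : ∀ α, IsIsocrystal (subTau τ (fil α) (stable α))
  gr_isocrystal : ∀ α, IsIsocrystal (grTau fil τ stable α)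
  gr_pure : ∀ α, IsPure (grTau fil τ stable α) α

/-- The slope `α` has multiplicity `n`: the subquotient `M_α` has rank `n` at every point. -/
def HasMultiplicity (α : ℚ) (n : ℕ) : Prop :=
  ∀ x : PrimeSpectrum (CoeffRing k P R), Module.rankAtStalk (R := CoeffRing k P R) (Gr fil α) x = n

end Filtration

end LocalIsocrystals

/-! ## Drinfeld modules -/

/-- `deg_A(a) = dim_k(A / Aa)`. -/
def degA (k : Type*) {A : Type*} [Field k] [CommRing A] [Algebra k A] (a : A) : ℕ :=
  Module.finrank k (A ⧸ Ideal.span {a})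

/-- A (standard) Drinfeld `A`-module of rank `r` over `R`: a `k`-algebra homomorphism
`φ : A → R[τ]`, where `τ ξ = ξ^q τ` with `q = |k|`, such that `φ_a` is elliptic of degree
`r deg_A(a)` for every non-zero `a`. -/
structure DrinfeldModule (k A R : Type*) [Field k] [Fintype k] [CommRing A] [Algebra k A]
    [CommRing R] [Algebra k R] (r : ℕ) where
  toAlgHom : A →ₐ[k] TwistedPolynomial (FiniteField.frobeniusAlgHom k R)
  elliptic : ∀ a : A, a ≠ 0 → (toAlgHom a).IsElliptic (r * degA k a)

namespace DrinfeldModule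

variable {k A R : Type*} [Field k] [Fintype k] [CommRing A] [Algebra k A]
    [CommRing R] [Algebra k R] {r : ℕ} (φ : DrinfeldModule k A R r)

/-- The characteristic `c^* : A → R`, `a ↦ dφ_a`, of `φ`. -/
def characteristic : A →ₐ[k] R := (TwistedPolynomial.constantCoeff _).comp φ.toAlgHom

/-- The kernel of the characteristic of `φ`. -/
def characteristicIdeal : Ideal A := RingHom.ker φ.characteristic

/-- Right multiplication by `φ_a` on `R[τ]`. -/
def rightAction : A →ₐ[k] Module.End k (TwistedPolynomial (FiniteField.frobeniusAlgHom k R)) :=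
  AlgHom.ofLinearMap ((LinearMap.mul k _).flip.comp φ.toAlgHom.toLinearMap)
    (by ext m; simp) (by
      intro a b; ext m
      rw [mul_comm a b]
      simp [mul_assoc])

variable (k R) in
/-- Left multiplication by constants on `R[τ]`. -/
def leftAction : R →ₐ[k] Module.End k (TwistedPolynomial (FiniteField.frobeniusAlgHom k R)) :=
  (Algebra.lmul k _).comp (TwistedPolynomial.C (FiniteField.frobeniusAlgHom k R))

theorem commute_actions (a : A) (ξ : R) : Commute (φ.rightAction a) (leftAction k R ξ) := by
  ext m; simp [rightAction, leftAction, mul_assoc]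

/-- The action of `A ⊗ R` on `R[τ]` given by `(a ⊗ ξ) m = ξ m φ_a`. -/
def motiveAction :
    A ⊗[k] R →ₐ[k] Module.End k (TwistedPolynomial (FiniteField.frobeniusAlgHom k R)) :=
  Algebra.TensorProduct.lift φ.rightAction (leftAction k R) φ.commute_actions

theorem motiveAction_tmul (a : A) (ξ : R) (m : TwistedPolynomial (FiniteField.frobeniusAlgHom k R)) :
    φ.motiveAction (a ⊗ₜ ξ) m = TwistedPolynomial.C _ ξ * m * φ.toAlgHom a := by
  rw [motiveAction, Algebra.TensorProduct.lift_tmul]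
  simp [rightAction, leftAction]

/-- The `A`-motive `R[τ]` of `φ`. -/
def Motive (_φ : DrinfeldModule k A R r) : Type _ :=
  TwistedPolynomial (FiniteField.frobeniusAlgHom k R)

instance : AddCommGroup φ.Motive :=
  inferInstanceAs (AddCommGroup (TwistedPolynomial (FiniteField.frobeniusAlgHom k R)))

instance : Module (A ⊗[k] R) φ.Motive :=
  Module.compHom (TwistedPolynomial (FiniteField.frobeniusAlgHom k R))
    φ.motiveAction.toRingHom

theorem tau_mul_motiveAction (e : A ⊗[k] R)
    (m : TwistedPolynomial (FiniteField.frobeniusAlgHom k R)) :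
    TwistedPolynomial.tau (FiniteField.frobeniusAlgHom k R) * φ.motiveAction e m =
      φ.motiveAction (partialFrobenius k R A e) (TwistedPolynomial.tau _ * m) := by
  induction e using TensorProduct.induction_on with
  | zero => simp
  | add x y hx hy => simp only [map_add, LinearMap.add_apply, mul_add, hx, hy]
  | tmul a ξ =>
    rw [motiveAction_tmul, partialFrobenius, Algebra.TensorProduct.map_tmul, motiveAction_tmul,
      ← mul_assoc, ← mul_assoc, TwistedPolynomial.tau_mul_C, mul_assoc (TwistedPolynomial.C _ _)]
    rfl

/-- The action of `τ` on the `A`-motive by left multiplication. -/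
def motiveTau : φ.Motive →ₛₗ[(partialFrobenius k R A : A ⊗[k] R →+* A ⊗[k] R)] φ.Motive where
  toFun := fun m : TwistedPolynomial (FiniteField.frobeniusAlgHom k R) =>
    TwistedPolynomial.tau (FiniteField.frobeniusAlgHom k R) * m
  map_add' := mul_add (TwistedPolynomial.tau (FiniteField.frobeniusAlgHom k R))
  map_smul' e m := φ.tau_mul_motiveAction e m

section BaseChange

variable (P : Ideal A) (R' : Type*) [CommRing R'] [Algebra k R'] [Algebra R R']
  [IsScalarTower k R R']

/-- The natural homomorphism `A ⊗_k R → F_P ⊗̂_k R'`. -/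
def toCoeffRing : A ⊗[k] R →+* CoeffRing k P R' :=
  (algebraMap (IntegralCoeffRing k P R') (CoeffRing k P R')).comp
    ((algebraMap (A ⊗[k] R') (IntegralCoeffRing k P R')).comp
      (Algebra.TensorProduct.map (AlgHom.id k A) (IsScalarTower.toAlgHom k R R')).toRingHom)

theorem toCoeffRing_partialFrobenius (x : A ⊗[k] R) :
    toCoeffRing P R' (partialFrobenius k R A x) = coeffSigma k P R' (toCoeffRing P R' x) := by
  have h : Algebra.TensorProduct.map (AlgHom.id k A) (IsScalarTower.toAlgHom k R R')
        (partialFrobenius k R A x) = partialFrobenius k R' A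
        (Algebra.TensorProduct.map (AlgHom.id k A) (IsScalarTower.toAlgHom k R R') x) := by
    induction x using TensorProduct.induction_on with
    | zero => simp
    | add x y hx hy => simp only [map_add, hx, hy]
    | tmul a ξ => simp [partialFrobenius]
  change algebraMap (IntegralCoeffRing k P R') (CoeffRing k P R')
    (algebraMap (A ⊗[k] R') (IntegralCoeffRing k P R') (Algebra.TensorProduct.map (AlgHom.id k A)
    (IsScalarTower.toAlgHom k R R') (partialFrobenius k R A x))) =
      coeffSigma k P R' (algebraMap (IntegralCoeffRing k P R') (CoeffRing k P R')
        (algebraMap (A ⊗[k] R') (IntegralCoeffRing k P R')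
          (Algebra.TensorProduct.map (AlgHom.id k A) (IsScalarTower.toAlgHom k R R') x)))
  rw [h, coeffSigma, IsLocalization.map_eq, integralSigma_algebraMap]

/-- The module `M_{F,P} = (F_P ⊗̂_k R') ⊗_{A ⊗ R} M` over an `R`-algebra `R'` obtained by base change
from the `A`-motive `M` of `φ`. -/
abbrev LocalIsocrystal : Type _ :=
  BaseChange (toCoeffRing P R' : A ⊗[k] R →+* CoeffRing k P R') φ.Motive

/-- The action of `τ` on `M_{F,P}`. -/
def localTau : φ.LocalIsocrystal P R' →ₛₗ[coeffSigma k P R'] φ.LocalIsocrystal P R' :=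
  baseChangeTau (toCoeffRing P R') (toCoeffRing_partialFrobenius P R') φ.motiveTau

end BaseChange

end DrinfeldModule

end

open scoped TensorProduct
open scoped Pointwise

set_option linter.unusedSectionVars false

noncomputable section

/-! ### Semilinear maps, base change and ranks -/

section DifferenceModules

variable {E : Type*} [CommRing E] {σ : E →+* E} {M : Type*} [AddCommGroup M] [Module E M]

/-! The proof is a connected-étale decomposition. Let `R'` be a domain over `R` in which the lowest
coefficient `ε` of `φ_a` is invertible, let `E = A_℘ ⊗̂ R'`, let `W = E ⊗ R[τ]` be the natural
lattice and let `S` be the group of twisted power series over `R'`. For `b ∈ ℘` the polynomial `φ_b`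
has no constant term, so right multiplication by it raises the order in `τ`, and the action of `A ⊗
R'` on `S` extends to `E`. Regarding polynomials as power series gives a `τ`-equivariant map `W → S`
with kernel `N`.

Choose `z ∈ ℘` outside `℘ ^ 2`. Because some power of `℘` is principal, `z` is a uniformizer at `℘`,
and the lowest coefficient of `φ_z`, in degree `j` say, is also a unit of `R'`. Triangular
elimination shows that `zS` consists of all series of order at least `j`. Hence `S / zS` is free
over `R'` of rank `j`, the module `S` is finite projective over `E`, and `τ ^ j S` generates `zS`
(`finite_series`, `projective_series`, `span_range_iterate_seriesFrob`). By Nakayama `W → S` is onto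
(`latticeToSeries_surjective`) and `τ N` generates `N` (`span_latticeTau_ker`). So `N` has slope
`0`, and `S` has slope `1 / h` once `j = h d`.

The ranks come from counting over `R'`. Division with remainder by `φ_a` shows that `W / aW` is free
of rank `r deg(a)`, so `W` has rank `r` (`exists_finiteSupport_quotient_equiv`,
`exists_lattice_quotient_equiv`). If `S` has rank `h`, the quotients `S / zS` and `S / aS` give `j =
h d` and lowest degree `h deg(a)` for `φ_a` (`exists_height`). Since `z` is fixed in advance, `h = j
/ d` does not depend on `a`.

This presupposes that ranks are constant on `Spec E` (`exists_rankAtStalk_eq`). Every maximal ideal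
of `E` contains the kernel of one of `d` characters `E → R'`, which `σ` permutes cyclically.
Generation by `τ` up to `z` makes the rank monotone along this cycle, hence constant. -/

instance BaseChange.finite {E' : Type*} [CommRing E'] (f : E →+* E') [Module.Finite E M] :
    Module.Finite E' (BaseChange f M) :=
  inferInstanceAs (Module.Finite (ScalarsVia f) (ScalarsVia f ⊗[E] M))

instance BaseChange.projective {E' : Type*} [CommRing E'] (f : E →+* E') [Module.Projective E M] :
    Module.Projective E' (BaseChange f M) :=
  inferInstanceAs (Module.Projective (ScalarsVia f) (ScalarsVia f ⊗[E] M))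

theorem BaseChange.rankAtStalk_eq {E' : Type*} [CommRing E'] (f : E →+* E') [Module.Finite E M]
    [Module.Projective E M] (x : PrimeSpectrum E') :
    Module.rankAtStalk (R := E') (BaseChange f M) x = Module.rankAtStalk M (x.comap f) := by
  have h := Module.rankAtStalk_baseChange (R := E) (M := M)
    (show PrimeSpectrum (ScalarsVia f) from x)
  exact h

theorem BaseChange.smul_tmul' {E' : Type*} [CommRing E'] (f : E →+* E') (a e : E') (m : M) :
    a • BaseChange.tmul f e m = BaseChange.tmul f (a * e) m := rfl

theorem BaseChange.tmul_eq_smul {E' : Type*} [CommRing E'] (f : E →+* E') (e : E') (m : M) :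
    BaseChange.tmul f e m = e • BaseChange.tmul f 1 m := by
  rw [BaseChange.smul_tmul', mul_one]

theorem BaseChange.tmul_smul {E' : Type*} [CommRing E'] (f : E →+* E') (a : E) (e : E') (m : M) :
    BaseChange.tmul f e (a • m) = BaseChange.tmul f (f a * e) m :=
  (TensorProduct.smul_tmul (R := E) a (show ScalarsVia f from e) m).symm

theorem BaseChange.tmul_add {E' : Type*} [CommRing E'] (f : E →+* E') (e : E') (m n : M) :
    BaseChange.tmul f e (m + n) = BaseChange.tmul f e m + BaseChange.tmul f e n :=
  TensorProduct.tmul_add (R := E) (show ScalarsVia f from e) m n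

theorem BaseChange.add_tmul {E' : Type*} [CommRing E'] (f : E →+* E') (e e' : E') (m : M) :
    BaseChange.tmul f (e + e') m = BaseChange.tmul f e m + BaseChange.tmul f e' m :=
  TensorProduct.add_tmul (R := E) (show ScalarsVia f from e) (show ScalarsVia f from e') m

theorem linearization_tmul (τ : M →ₛₗ[σ] M) (e : E) (m : M) :
    linearization τ (BaseChange.tmul σ e m) = e • τ m := rfl

theorem baseChangeTau_tmul {E' : Type*} [CommRing E'] {σ' : E' →+* E'} (f : E →+* E')
    (hf : ∀ e, f (σ e) = σ' (f e)) (τ : M →ₛₗ[σ] M) (e : E') (m : M) :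
    baseChangeTau f hf τ (BaseChange.tmul f e m) = BaseChange.tmul f (σ' e) (τ m) := rfl

theorem linearization_surjective (τ : M →ₛₗ[σ] M)
    (h : Submodule.span E (Set.range τ) = ⊤) : Function.Surjective (linearization τ) := by
  rw [← LinearMap.range_eq_top, eq_top_iff, ← h, Submodule.span_le]
  rintro _ ⟨m, rfl⟩
  exact ⟨BaseChange.tmul σ 1 m, by rw [linearization_tmul, one_smul]⟩

/-- Pullback along `σ` preserves a constant rank, and a surjection between finite projective modules
of equal rank is bijective. So only generation by the image of `τ` has to be checked. -/
theorem isDualizable_of_rankAtStalk_eq (τ : M →ₛₗ[σ] M) [Module.Finite E M]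
    [Module.Projective E M] (c : ℕ)
    (hc : ∀ x : PrimeSpectrum E, Module.rankAtStalk (R := E) M x = c)
    (h : Submodule.span E (Set.range τ) = ⊤) : IsDualizable τ where
  finite := inferInstance
  projective := inferInstance
  bijective := Module.bijective_of_surjective_of_rankAtStalk_eq (linearization_surjective τ h)
    fun m _ => by rw [BaseChange.rankAtStalk_eq, hc, hc]

/-- A surjection of finite projective modules does not increase ranks. -/
theorem rankAtStalk_le_of_surjective {M N : Type*} [AddCommGroup M] [Module E M]
    [AddCommGroup N] [Module E N] [Module.Finite E M] [Module.Projective E M] [Module.Finite E N]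
    [Module.Projective E N] (f : M →ₗ[E] N) (hf : Function.Surjective f) (x : PrimeSpectrum E) :
    Module.rankAtStalk (R := E) N x ≤ Module.rankAtStalk (R := E) M x := by
  have := Module.free_of_flat_of_isLocalRing (R := Localization.AtPrime x.asIdeal)
    (P := LocalizedModule x.asIdeal.primeCompl M)
  have hs := LocalizedModule.map_surjective x.asIdeal.primeCompl f hf
  exact LinearMap.finrank_le_finrank_of_surjective hs

/-- The rank of `σ^*M` at `x` is the rank of `M` at the preimage of `x` under `σ`, and `σ^*M → M` is
onto. This compares ranks at different points of the spectrum. -/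
theorem rankAtStalk_le_comap (τ : M →ₛₗ[σ] M) [Module.Finite E M] [Module.Projective E M]
    (h : Submodule.span E (Set.range τ) = ⊤) (x : PrimeSpectrum E) :
    Module.rankAtStalk (R := E) M x ≤ Module.rankAtStalk (R := E) M (x.comap σ) := by
  rw [← BaseChange.rankAtStalk_eq]
  exact rankAtStalk_le_of_surjective _ (linearization_surjective τ h) x

end DifferenceModules

/-! ### Lifting projectivity from the quotient by `z` -/

section Projective

/-- Let `E` be separated for the `z`-adic topology, and let `B → E` be a section of `E → E / zE`.
A finite `E`-module `W` that embeds modulo `z` into a `z`-torsion free module is projective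
as soon as `W / zW` is projective over `B`. -/
theorem projective_of_projective_quotient {B E W V : Type*} [CommRing B] [CommRing E] [Algebra B E]
    (z : E) (hz : z ∈ (⊥ : Ideal E).jacobson)
    (hB : ∀ e : E, ∃ (b : B) (e' : E), e = algebraMap B E b + z * e')
    (haus : ∀ e : E, (∀ m : ℕ, z ^ m ∣ e) → e = 0)
    [AddCommGroup W] [Module E W] [Module.Finite E W] [Module B W] [IsScalarTower B E W]
    [AddCommGroup V] [Module E V]
    (hproj : Module.Projective B (W ⧸ (z • ⊤ : Submodule E W))) (u : W →ₗ[E] V)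
    (hu : ∀ v : V, z • v = 0 → v = 0) (huz : ∀ w v, u w = z • v → ∃ w', w = z • w') :
    Module.Projective E W ∧ Function.Injective u := by
  set Y := W ⧸ (z • ⊤ : Submodule E W) with hY
  let p : W →ₗ[E] Y := (z • ⊤ : Submodule E W).mkQ
  have hp : Function.Surjective p := Submodule.mkQ_surjective _
  have hpz : ∀ w, p (z • w) = 0 := fun w =>
    (Submodule.Quotient.mk_eq_zero _).2 (Submodule.smul_mem_pointwise_smul _ _ _ trivial)
  -- The `E`-linear extension `f : E ⊗ Y → W` of this `B`-linear splitting will be an isomorphism,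
  -- and its source is projective.
  obtain ⟨s, hs⟩ := Module.projective_lifting_property (p.restrictScalars B)
    (LinearMap.id : Y →ₗ[B] Y) hp
  have hs' : ∀ y, p (s y) = y := fun y => LinearMap.congr_fun hs y
  let f : E ⊗[B] Y →ₗ[E] W := TensorProduct.AlgebraTensorModule.lift
    ((LinearMap.lsmul E (Y →ₗ[B] W)).flip s)
  have hf : ∀ e y, f (e ⊗ₜ y) = e • s y := fun e y => rfl
  have hdec : ∀ x : E ⊗[B] Y, ∃ y x', x = 1 ⊗ₜ y + z • x' := by
    intro x
    induction x using TensorProduct.induction_on with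
    | zero => exact ⟨0, 0, by simp⟩
    | add x x' hx hx' =>
      obtain ⟨y, w, rfl⟩ := hx
      obtain ⟨y', w', rfl⟩ := hx'
      exact ⟨y + y', w + w', by rw [TensorProduct.tmul_add, smul_add]; abel⟩
    | tmul e y =>
      obtain ⟨b, e', rfl⟩ := hB e
      refine ⟨b • y, e' ⊗ₜ y, ?_⟩
      rw [TensorProduct.add_tmul, TensorProduct.smul_tmul', Algebra.algebraMap_eq_smul_one,
        TensorProduct.smul_tmul, smul_eq_mul]
  -- Write `x = 1 ⊗ y + z x'`. Then `u (s y)` is a multiple of `z`, so `s y ∈ zW` and `y = 0`;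
  -- torsion-freeness of `V` puts `x'` in the kernel again. Thus kernel elements are infinitely
  -- `z`-divisible.
  have hker : ∀ x, u (f x) = 0 → ∃ x', x = z • x' ∧ u (f x') = 0 := by
    intro x hx
    obtain ⟨y, x', rfl⟩ := hdec x
    rw [map_add, hf, one_smul, map_smul, map_add, map_smul] at hx
    obtain ⟨w', hw'⟩ := huz (s y) (-(u (f x'))) (by rw [smul_neg, ← add_eq_zero_iff_eq_neg, hx])
    have hy : y = 0 := by rw [← hs' y, hw', hpz]
    refine ⟨x', by simp [hy], hu _ ?_⟩
    simpa [hy] using hx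
  have hpow : ∀ (m : ℕ) x, u (f x) = 0 → ∃ x', x = z ^ m • x' ∧ u (f x') = 0 := by
    intro m
    induction m with
    | zero => exact fun x hx => ⟨x, by simp, hx⟩
    | succ m ih =>
      intro x hx
      obtain ⟨x', rfl, hx'⟩ := ih x hx
      obtain ⟨x'', rfl, hx''⟩ := hker x' hx'
      exact ⟨x'', by rw [pow_succ, mul_smul], hx''⟩
  have hinj : Function.Injective (u ∘ₗ f) := by
    rw [← LinearMap.ker_eq_bot, LinearMap.ker_eq_bot']
    intro x hx
    -- Functionals separate the points of a projective module, so separatedness is needed only for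
    -- `E` itself.
    rw [← Module.forall_dual_apply_eq_zero_iff E]
    refine fun ℓ => haus _ fun m => ?_
    obtain ⟨x', rfl, -⟩ := hpow m x hx
    exact ⟨ℓ x', by rw [map_smul, smul_eq_mul]⟩
  have hsurj : Function.Surjective f := by
    rw [← LinearMap.range_eq_top, eq_top_iff]
    refine Submodule.le_of_le_smul_of_le_jacobson_bot (I := Ideal.span {z}) Module.Finite.fg_top
      ((Ideal.span_singleton_le_iff_mem _).2 hz) ?_
    intro w _
    have : p (w - s (p w)) = 0 := by rw [map_sub, hs', sub_self]
    rw [← LinearMap.mem_ker, Submodule.ker_mkQ] at this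
    rw [← sub_add_cancel w (s (p w))]
    refine Submodule.add_mem _ (Submodule.mem_sup_right ?_)
      (Submodule.mem_sup_left ⟨1 ⊗ₜ p w, by rw [hf, one_smul]⟩)
    rwa [Submodule.ideal_span_singleton_smul]
  have hfb : Function.Bijective f := ⟨Function.Injective.of_comp hinj, hsurj⟩
  refine ⟨Module.Projective.of_equiv (LinearEquiv.ofBijective f hfb), ?_⟩
  intro w w' hw
  obtain ⟨x, rfl⟩ := hsurj w
  obtain ⟨x', rfl⟩ := hsurj w'
  rw [hinj hw]

end Projective

/-! ### Ranks over a finite free extension -/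

section Count

/-- A finite projective module of constant rank `c` over a finite free algebra `C` over a domain
`R` has rank `c · [C : R]` over `R`. -/
theorem finrank_eq_mul_finrank {R C V : Type*} [CommRing R] [IsDomain R] [CommRing C] [Algebra R C]
    [Module.Free R C] [Module.Finite R C] [AddCommGroup V] [Module C V] [Module R V]
    [IsScalarTower R C V] [Module.Finite C V] [Module.Projective C V] (c : ℕ)
    (hc : ∀ x : PrimeSpectrum C, Module.rankAtStalk (R := C) V x = c) :
    Module.finrank R V = c * Module.finrank R C := by
  have : Module.Finite R V := Module.Finite.trans C V
  let K := FractionRing R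
  -- Over the fraction field `C` becomes Artinian, where a finite projective module of constant rank
  -- is free; the claim becomes a dimension count over `K`.
  let CK := C ⊗[R] K
  let eK : C ⊗[R] K ≃ₗ[R] K ⊗[R] C := TensorProduct.comm R C K
  have : IsArtinianRing CK :=
    have : IsArtinianRing (K ⊗[R] C) := IsArtinianRing.of_finite K (K ⊗[R] C)
    (Algebra.TensorProduct.comm R K C).toRingEquiv.isArtinianRing
  obtain ⟨b⟩ := Module.nonempty_basis_of_flat_of_finrank_eq CK (CK ⊗[C] V) c fun P => by
    let F := CK ⧸ P.asIdeal
    let _ : Field F := Ideal.Quotient.field P.asIdeal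
    have h1 := Module.rankAtStalk_eq_finrank_of_free (R := F) (M := F ⊗[CK] (CK ⊗[C] V))
    have h2 := congrFun h1 (⊥ : PrimeSpectrum F)
    have h3 := Module.rankAtStalk_baseChange (R := CK) (M := CK ⊗[C] V) (⊥ : PrimeSpectrum F)
    rw [Module.rankAtStalk_baseChange, hc] at h3
    exact h2.symm.trans h3
  let e : K ⊗[R] V ≃ₗ[R] Fin c → K ⊗[R] C :=
    TensorProduct.comm R K V ≪≫ₗ
    (TensorProduct.AlgebraTensorModule.cancelBaseChange R C C V K).symm.restrictScalars R ≪≫ₗ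
    (TensorProduct.comm C V CK).restrictScalars R ≪≫ₗ
    b.equivFun.restrictScalars R ≪≫ₗ LinearEquiv.piCongrRight fun _ => eK
  have h := (e.extendScalarsOfIsLocalization (nonZeroDivisors R) K).finrank_eq
  rw [Module.finrank_pi_fintype, (TensorProduct.isBaseChange R V K).finrank_eq,
    (TensorProduct.isBaseChange R C K).finrank_eq] at h
  simpa using h

end Count

end

noncomputable section

/-! ### Dualizable modules of constant rank -/

section ConstantRank

variable {E : Type*} [CommRing E] {σ : E →+* E}

/-- A finite projective module of constant rank `c` that is generated by the image of `τ`. -/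
structure IsDualizableOfRank {M : Type*} [AddCommGroup M] [Module E M] (τ : M →ₛₗ[σ] M) (c : ℕ) :
    Prop where
  finite : Module.Finite E M
  projective : Module.Projective E M
  rank : ∀ x : PrimeSpectrum E, Module.rankAtStalk (R := E) M x = c
  span_range : Submodule.span E (Set.range τ) = ⊤

variable {M N : Type*} [AddCommGroup M] [Module E M] [AddCommGroup N] [Module E N]
  {τ : M →ₛₗ[σ] M} {τ' : N →ₛₗ[σ] N} {c : ℕ}

theorem IsDualizableOfRank.isDualizable (h : IsDualizableOfRank τ c) : IsDualizable τ :=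
  have := h.finite
  have := h.projective
  isDualizable_of_rankAtStalk_eq τ c h.rank h.span_range

theorem span_range_eq_top_of_surjective (f : M →ₗ[E] N) (hf : Function.Surjective f)
    (hτ : ∀ x, f (τ x) = τ' (f x)) (h : Submodule.span E (Set.range τ) = ⊤) :
    Submodule.span E (Set.range τ') = ⊤ := by
  rw [eq_top_iff, ← LinearMap.range_eq_top.2 hf, ← Submodule.map_top, ← h, Submodule.map_span,
    Submodule.span_le]
  rintro _ ⟨_, ⟨x, rfl⟩, rfl⟩
  exact Submodule.subset_span ⟨f x, (hτ x).symm⟩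

theorem IsDualizableOfRank.of_equiv (e : M ≃ₗ[E] N) (hτ : ∀ x, e (τ x) = τ' (e x))
    (h : IsDualizableOfRank τ c) : IsDualizableOfRank τ' c :=
  have := h.finite
  have := h.projective
  { finite := Module.Finite.equiv e
    projective := Module.Projective.of_equiv e
    rank := fun x => by rw [← Module.rankAtStalk_eq_of_equiv e, h.rank]
    span_range := span_range_eq_top_of_surjective e.toLinearMap e.surjective hτ h.span_range }

theorem IsDualizableOfRank.of_subsingleton [Subsingleton M] (τ : M →ₛₗ[σ] M) :
    IsDualizableOfRank τ 0 where
  finite := inferInstance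
  projective := inferInstance
  rank x := by rw [Module.rankAtStalk_eq_zero_of_subsingleton, Pi.zero_apply]
  span_range := Subsingleton.elim _ _

end ConstantRank

/-! ### Purity and graded pieces -/

section Slopes

variable {k : Type*} [Field k] [Fintype k] {B : Type*} [CommRing B] [Algebra k B]
  {P : Ideal B} {R : Type*} [CommRing R] [Algebra k R]
  {M N : Type*} [AddCommGroup M] [Module (CoeffRing k P R) M]
  [AddCommGroup N] [Module (CoeffRing k P R) N]

/-- Needed because a slope filtration asks for purity of every graded piece, including the zero
pieces away from the jumps. -/
theorem IsPure.of_subsingleton [Subsingleton M] (τ : M →ₛₗ[coeffSigma k P R] M) (α : ℚ) :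
    IsPure τ α := by
  let _ : Module (IntegralCoeffRing k P R) M :=
    Module.compHom M (algebraMap (IntegralCoeffRing k P R) (CoeffRing k P R))
  refine ⟨α.den, α.den_pos, α.num, ?_, ⊥, inferInstance, inferInstance, Subsingleton.elim _ _,
    Subsingleton.elim _ _⟩
  rw [mul_comm]
  exact (Rat.mul_den_eq_num α).symm

theorem IsPure.of_equiv {τ : M →ₛₗ[coeffSigma k P R] M} {τ' : N →ₛₗ[coeffSigma k P R] N}
    (e : M ≃ₗ[CoeffRing k P R] N) (hτ : ∀ x, e (τ x) = τ' (e x)) {α : ℚ} (h : IsPure τ α) :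
    IsPure τ' α := by
  let _ : Module (IntegralCoeffRing k P R) M :=
    Module.compHom M (algebraMap (IntegralCoeffRing k P R) (CoeffRing k P R))
  let _ : Module (IntegralCoeffRing k P R) N :=
    Module.compHom N (algebraMap (IntegralCoeffRing k P R) (CoeffRing k P R))
  let e' : M ≃ₗ[IntegralCoeffRing k P R] N :=
    { e with map_smul' := fun a x => e.map_smul (algebraMap _ (CoeffRing k P R) a) x }
  obtain ⟨n, hn, m, hm, L, hfin, hproj, hspan, hL⟩ := h
  have hit : ∀ (i : ℕ) x, e (τ^[i] x) = τ'^[i] (e x) := fun i => by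
    induction i with
    | zero => exact fun _ => rfl
    | succ i ih => exact fun x => by rw [Function.iterate_succ_apply, ih, hτ]; rfl
  refine ⟨n, hn, m, hm, L.map e'.toLinearMap, Module.Finite.equiv (e'.submoduleMap L),
    Module.Projective.of_equiv (e'.submoduleMap L), ?_, ?_⟩
  · have : ((L.map e'.toLinearMap : Submodule _ N) : Set N) = e.toLinearMap '' (L : Set M) := rfl
    rw [this, ← Submodule.map_span, hspan, Submodule.map_top, LinearMap.range_eq_top]
    exact e.surjective
  · have h1 := congrArg (Submodule.map e'.toLinearMap) hL
    rw [Submodule.map_smul'', Submodule.map_smul'', Submodule.map_span] at h1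
    rw [← h1]
    congr 2
    ext y
    constructor
    · rintro ⟨_, ⟨x, hx, rfl⟩, rfl⟩
      exact ⟨_, ⟨x, hx, rfl⟩, hit _ x⟩
    · rintro ⟨_, ⟨x, hx, rfl⟩, rfl⟩
      exact ⟨_, ⟨x, hx, rfl⟩, (hit _ x).symm⟩

/-- Purity from a lattice given as an embedded integral module. -/
theorem isPure_of_lattice (τ : M →ₛₗ[coeffSigma k P R] M) {V : Type*} [AddCommGroup V]
    [Module (IntegralCoeffRing k P R) V] [Module.Finite (IntegralCoeffRing k P R) V]
    [Module.Projective (IntegralCoeffRing k P R) V] (ι : V →+ M)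
    (hι : ∀ (e : IntegralCoeffRing k P R) v, ι (e • v) = algebraMap _ (CoeffRing k P R) e • ι v)
    (hinj : Function.Injective ι) (hspan : Submodule.span (CoeffRing k P R) (Set.range ι) = ⊤)
    (n : ℕ) (hn : 0 < n) (m : ℕ) (α : ℚ) (hm : (m : ℚ) = n * α) (t : V → V)
    (ht : ∀ v, ι (t v) = τ^[n * Module.finrank k (B ⧸ P)] (ι v))
    (hL : Submodule.span (IntegralCoeffRing k P R) (Set.range t) =
      (P.map (algebraMap B (IntegralCoeffRing k P R))) ^ m • ⊤) : IsPure τ α := by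
  let _ : Module (IntegralCoeffRing k P R) M :=
    Module.compHom M (algebraMap (IntegralCoeffRing k P R) (CoeffRing k P R))
  let ι' : V →ₗ[IntegralCoeffRing k P R] M := { ι with map_smul' := hι }
  have e : V ≃ₗ[IntegralCoeffRing k P R] LinearMap.range ι' := LinearEquiv.ofInjective ι' hinj
  refine ⟨n, hn, m, by exact_mod_cast hm, LinearMap.range ι', Module.Finite.equiv e,
    Module.Projective.of_equiv e, hspan, ?_⟩
  have h1 := congrArg (Submodule.map ι') hL
  rw [Submodule.map_smul'', Submodule.map_span, Submodule.map_top] at h1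
  -- As `m` is natural, the factor that clears negative powers of `P` in the definition of purity is
  -- trivial.
  rw [show (-(m : ℤ)).toNat = 0 by simp, pow_zero, Ideal.one_eq_top, Submodule.top_smul,
    Int.toNat_natCast, ← h1]
  congr 1
  ext y
  constructor
  · rintro ⟨_, ⟨v, rfl⟩, rfl⟩
    exact ⟨_, ⟨v, rfl⟩, ht v⟩
  · rintro ⟨_, ⟨v, rfl⟩, rfl⟩
    exact ⟨_, ⟨v, rfl⟩, (ht v).symm ▸ rfl⟩

/-- The first isomorphism theorem identifies the graded piece with `N` compatibly with `τ`, so rank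
and purity are transported from `N`. -/
theorem IsDualizableOfRank.of_gr {fil : ℚ → Submodule (CoeffRing k P R) M}
    {τ : M →ₛₗ[coeffSigma k P R] M} (stable : ∀ α, fil α ≤ (fil α).comap τ) (α : ℚ)
    {τ' : N →ₛₗ[coeffSigma k P R] N} (f : fil α →ₗ[CoeffRing k P R] N)
    (hf : Function.Surjective f) (hker : LinearMap.ker f = (filLT fil α).submoduleOf (fil α))
    (hτ : ∀ x, f (subTau τ (fil α) (stable α) x) = τ' (f x)) {c : ℕ}
    (h : IsDualizableOfRank τ' c) (hp : IsPure τ' α) :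
    IsDualizableOfRank (grTau fil τ stable α) c ∧ IsPure (grTau fil τ stable α) α := by
  let e : Gr fil α ≃ₗ[CoeffRing k P R] N :=
    Submodule.quotEquivOfEq _ _ hker.symm ≪≫ₗ f.quotKerEquivOfSurjective hf
  have he : ∀ y, e.symm (τ' y) = grTau fil τ stable α (e.symm y) := by
    intro y
    obtain ⟨x, rfl⟩ := hf y
    have h1 : ∀ x, e.symm (f x) = Submodule.Quotient.mk x := fun x => by
      rw [LinearEquiv.symm_apply_eq]; rfl
    rw [← hτ, h1, h1]
    rfl
  exact ⟨h.of_equiv e.symm he, hp.of_equiv e.symm he⟩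

end Slopes
end

noncomputable section

/-! ### Filtrations with two jumps -/

section TwoStep

variable {E X : Type*} [Ring E] [AddCommGroup X] [Module E X]

/-- The ascending filtration jumping from `0` to `N` at `0` and from `N` to everything at `s`. -/
def twoStepFiltration (N : Submodule E X) (s α : ℚ) :
    Submodule E X :=
  if α < 0 then ⊥ else if α < s then N else ⊤

variable {N : Submodule E X} {s α : ℚ}

theorem twoStepFiltration_of_neg (h : α < 0) : twoStepFiltration N s α = ⊥ := if_pos h

theorem twoStepFiltration_of_lt (h₀ : 0 ≤ α) (h : α < s) : twoStepFiltration N s α = N := by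
  rw [twoStepFiltration, if_neg h₀.not_gt, if_pos h]

theorem twoStepFiltration_of_le (h₀ : 0 < s) (h : s ≤ α) : twoStepFiltration N s α = ⊤ := by
  rw [twoStepFiltration, if_neg (h₀.le.trans h).not_gt, if_neg h.not_gt]

theorem monotone_twoStepFiltration : Monotone (twoStepFiltration N s) := by
  intro α β hαβ
  unfold twoStepFiltration
  split_ifs <;> first | exact le_rfl | exact bot_le | exact le_top | (exfalso; linarith)

/-- The steps are closed on the left, so some `β > α`, namely `α / 2` or `(α + s) / 2`, still lies
in the step of `α`; on the last step there is nothing to show. -/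
theorem iInf_twoStepFiltration (α : ℚ) :
    ⨅ β : {β : ℚ // α < β}, twoStepFiltration N s β = twoStepFiltration N s α := by
  refine le_antisymm ?_ (le_iInf fun β => monotone_twoStepFiltration β.2.le)
  by_cases h₀ : α < 0
  · refine (iInf_le _ ⟨α / 2, by linarith⟩).trans ?_
    rw [twoStepFiltration_of_neg h₀, twoStepFiltration_of_neg (by simp; linarith)]
  by_cases h : α < s
  · refine (iInf_le _ ⟨(α + s) / 2, by linarith⟩).trans ?_
    rw [twoStepFiltration_of_lt (not_lt.1 h₀) h, twoStepFiltration_of_lt] <;> simp <;> linarith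
  · rw [show twoStepFiltration N s α = ⊤ by rw [twoStepFiltration, if_neg h₀, if_neg h]]
    exact le_top

end TwoStep

/-! ### Slope filtration of an extension of pure isocrystals -/

section TwoStepSlopes

variable {k : Type*} [Field k] {B : Type*} [CommRing B] [Algebra k B]
  {P : Ideal B} {R : Type*} [CommRing R] [Algebra k R]
  {X Q : Type*} [AddCommGroup X] [Module (CoeffRing k P R) X]
  [AddCommGroup Q] [Module (CoeffRing k P R) Q]

variable {N : Submodule (CoeffRing k P R) X} {s α : ℚ}

theorem filLT_twoStepFiltration_zero : filLT (twoStepFiltration N s) 0 = ⊥ :=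
  eq_bot_iff.2 <| iSup_le fun β => (twoStepFiltration_of_neg β.2).le

theorem filLT_twoStepFiltration_self (hs : 0 < s) : filLT (twoStepFiltration N s) s = N := by
  refine le_antisymm (iSup_le fun β => ?_) ?_
  · by_cases h : (β : ℚ) < 0
    · rw [twoStepFiltration_of_neg h]; exact bot_le
    · exact (twoStepFiltration_of_lt (not_lt.1 h) β.2).le
  · rw [filLT]
    refine le_trans ?_ (le_iSup (fun β : {β : ℚ // β < s} => twoStepFiltration N s β) ⟨0, hs⟩)
    exact (twoStepFiltration_of_lt le_rfl hs).ge

theorem twoStepFiltration_le_filLT (hs : 0 < s) (h₀ : α ≠ 0) (h : α ≠ s) :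
    twoStepFiltration N s α ≤ filLT (twoStepFiltration N s) α := by
  rcases h₀.lt_or_gt with h₀ | h₀
  · rw [twoStepFiltration_of_neg h₀]; exact bot_le
  rcases h.lt_or_gt with h | h
  · rw [filLT]
    refine le_trans ?_ (le_iSup (fun β : {β : ℚ // β < α} => twoStepFiltration N s β) ⟨0, h₀⟩)
    rw [twoStepFiltration_of_lt h₀.le h, twoStepFiltration_of_lt le_rfl hs]
  · rw [filLT]
    refine le_trans ?_ (le_iSup (fun β : {β : ℚ // β < α} => twoStepFiltration N s β) ⟨s, h⟩)
    rw [twoStepFiltration_of_le hs le_rfl]; exact le_top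

/-- An isocrystal with an isoclinic quotient of positive slope `s` and an isoclinic kernel of
slope `0` has a slope filtration with these two slopes. -/
theorem exists_isSlopeFiltration [Fintype k] (τ : X →ₛₗ[coeffSigma k P R] X) (τ' : Q →ₛₗ[coeffSigma k P R] Q)
    (π : X →ₗ[CoeffRing k P R] Q) (hπ : Function.Surjective π) (hτ : ∀ x, π (τ x) = τ' (π x))
    (hker : LinearMap.ker π ≤ (LinearMap.ker π).comap τ) {s : ℚ} (hs : 0 < s) {a b c : ℕ}
    (hX : IsDualizableOfRank τ a) (hN : IsDualizableOfRank (subTau τ (LinearMap.ker π) hker) b)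
    (hQ : IsDualizableOfRank τ' c) (hN' : IsPure (subTau τ (LinearMap.ker π) hker) 0)
    (hQ' : IsPure τ' s) :
    ∃ fil : ℚ → Submodule (CoeffRing k P R) X, IsSlopeFiltration fil τ ∧
      HasMultiplicity fil 0 b ∧ HasMultiplicity fil s c ∧
      ∀ α : ℚ, α ≠ 0 → α ≠ s → HasMultiplicity fil α 0 := by
  set N := LinearMap.ker π with hNdef
  let fil := twoStepFiltration N s
  have stable : ∀ α, fil α ≤ (fil α).comap τ := by
    intro α
    by_cases h₀ : α < 0
    · rw [show fil α = ⊥ from twoStepFiltration_of_neg h₀]; exact bot_le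
    by_cases h : α < s
    · rw [show fil α = N from twoStepFiltration_of_lt (not_lt.1 h₀) h]; exact hker
    · rw [show fil α = ⊤ from twoStepFiltration_of_le hs (not_lt.1 h)]; exact fun _ _ => trivial
  -- The type of `subTau` depends on `fil α`, so the equality `fil α = N'` is eliminated here for a
  -- variable `N'` instead of being rewritten in each case.
  have hsub : ∀ (α : ℚ) (N' : Submodule (CoeffRing k P R) X) (hN' : N' ≤ N'.comap τ) (c : ℕ),
      fil α = N' → IsDualizableOfRank (subTau τ N' hN') c →
      IsDualizableOfRank (subTau τ (fil α) (stable α)) c := by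
    rintro α _ hN' c rfl h
    exact h
  have hfil : ∀ α, IsIsocrystal (subTau τ (fil α) (stable α)) := by
    intro α
    by_cases h₀ : α < 0
    · have : Subsingleton (fil α) := by
        rw [show fil α = ⊥ from twoStepFiltration_of_neg h₀]; infer_instance
      exact (IsDualizableOfRank.of_subsingleton _).isDualizable
    by_cases h : α < s
    · exact (hsub α N hker b (twoStepFiltration_of_lt (not_lt.1 h₀) h) hN).isDualizable
    · refine (hsub α ⊤ (fun _ _ => trivial) a
        (twoStepFiltration_of_le hs (not_lt.1 h)) ?_).isDualizable
      exact hX.of_equiv Submodule.topEquiv.symm fun x => rfl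
  have hgr0 : IsDualizableOfRank (grTau fil τ stable 0) b ∧ IsPure (grTau fil τ stable 0) 0 := by
    have h0 : fil 0 = N := twoStepFiltration_of_lt le_rfl hs
    refine IsDualizableOfRank.of_gr stable 0 (LinearEquiv.ofEq _ _ h0).toLinearMap
      (LinearEquiv.surjective _) ?_ (fun x => rfl) hN hN'
    rw [show filLT fil 0 = ⊥ from filLT_twoStepFiltration_zero, LinearEquiv.ker,
      Submodule.submoduleOf, Submodule.comap_bot, Submodule.ker_subtype]
  have hgrs : IsDualizableOfRank (grTau fil τ stable s) c ∧ IsPure (grTau fil τ stable s) s := by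
    have h0 : fil s = ⊤ := twoStepFiltration_of_le hs le_rfl
    refine IsDualizableOfRank.of_gr stable s (π ∘ₗ (fil s).subtype) ?_ ?_ (fun x => hτ x) hQ hQ'
    · intro y
      obtain ⟨x, rfl⟩ := hπ y
      exact ⟨⟨x, by rw [h0]; trivial⟩, rfl⟩
    · rw [show filLT fil s = N from filLT_twoStepFiltration_self hs, LinearMap.ker_comp]
      rfl
  have hgr : ∀ α, α ≠ 0 → α ≠ s → Subsingleton (Gr fil α) := by
    intro α h₀ h
    rw [Submodule.Quotient.subsingleton_iff, Submodule.submoduleOf_eq_top]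
    exact twoStepFiltration_le_filLT hs h₀ h
  refine ⟨fil, ⟨stable, monotone_twoStepFiltration, ?_, ?_, iInf_twoStepFiltration, hfil, ?_, ?_⟩,
    hgr0.1.rank, hgrs.1.rank, ?_⟩
  · exact eq_bot_iff.2 ((iInf_le _ (-1)).trans (twoStepFiltration_of_neg (by norm_num)).le)
  · exact eq_top_iff.2 ((twoStepFiltration_of_le hs le_rfl).ge.trans (le_iSup fil s))
  · intro α
    by_cases h₀ : α = 0
    · subst h₀; exact hgr0.1.isDualizable
    by_cases h : α = s
    · subst h; exact hgrs.1.isDualizable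
    have := hgr α h₀ h
    exact (IsDualizableOfRank.of_subsingleton _).isDualizable
  · intro α
    by_cases h₀ : α = 0
    · subst h₀; exact hgr0.2
    by_cases h : α = s
    · subst h; exact hgrs.2
    have := hgr α h₀ h
    exact IsPure.of_subsingleton _ _
  · intro α h₀ h x
    have := hgr α h₀ h
    rw [Module.rankAtStalk_eq_zero_of_subsingleton, Pi.zero_apply]

end TwoStepSlopes
end

open Finset.HasAntidiagonal (antidiagonal mem_antidiagonal)

noncomputable section

/-! ### Coefficients of twisted polynomials -/

namespace TwistedPolynomial

section Coefficients

variable {k E : Type*} [CommRing k] [CommRing E] [Algebra k E] {σ : E →ₐ[k] E}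

theorem coeff_sum {ι : Type*} (s : Finset ι) (f : ι → TwistedPolynomial σ) (i : ℕ) :
    coeff (∑ j ∈ s, f j) i = ∑ j ∈ s, coeff (f j) i := by
  classical
  induction s using Finset.induction_on with
  | empty => exact coeff_zero i
  | insert j s hj ih => rw [Finset.sum_insert hj, Finset.sum_insert hj, coeff_add, ih]

theorem exists_coeff_eq_zero (f : TwistedPolynomial σ) : ∃ N, ∀ i, N ≤ i → coeff f i = 0 := by
  induction f using induction_on with
  | zero => exact ⟨0, fun i _ => coeff_zero i⟩
  | mono j e => exact ⟨j + 1, fun i hi => by rw [coeff_monomial, if_neg (by omega)]⟩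
  | add f g hf hg =>
    obtain ⟨N, hN⟩ := hf
    obtain ⟨N', hN'⟩ := hg
    exact ⟨max N N', fun i hi => by
      rw [coeff_add, hN i (le_trans (le_max_left _ _) hi), hN' i (le_trans (le_max_right _ _) hi),
        add_zero]⟩

theorem eq_sum_monomial (f : TwistedPolynomial σ) (N : ℕ) (hN : ∀ i, N ≤ i → coeff f i = 0) :
    f = ∑ i ∈ Finset.range N, monomial σ i (coeff f i) := by
  refine SkewPolynomial.ext fun i => ?_
  change coeff f i = coeff _ i
  rw [coeff_sum]
  simp only [coeff_monomial]
  rw [Finset.sum_ite_eq' (Finset.range N)]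
  split_ifs with h
  · rfl
  · exact hN i (by simpa using h)

theorem coeff_mul (f g : TwistedPolynomial σ) (n : ℕ) :
    coeff (f * g) n = ∑ x ∈ antidiagonal n, coeff f x.1 * (σ ^ x.1) (coeff g x.2) := by
  induction f using induction_on with
  | zero => simp [coeff_zero]
  | add f f' h h' => simp only [add_mul, coeff_add, h, h', Finset.sum_add_distrib]
  | mono i a =>
    induction g using induction_on with
    | zero => simp [coeff_zero]
    | add f f' h h' =>
      simp only [mul_add, coeff_add, h, h', Finset.sum_add_distrib, map_add]
    | mono j b =>
      rw [monomial_mul_monomial, coeff_monomial]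
      simp only [coeff_monomial]
      split_ifs with h
      · subst h
        rw [Finset.sum_eq_single (i, j)]
        · simp
        · rintro ⟨x, y⟩ hxy hne
          rw [mem_antidiagonal] at hxy
          by_cases hx : i = x
          · have hy : j ≠ y := fun hy => hne (by rw [hx, hy])
            rw [if_neg hy, map_zero, mul_zero]
          · rw [if_neg hx, zero_mul]
        · simp
      · symm
        refine Finset.sum_eq_zero ?_
        rintro ⟨x, y⟩ hxy
        rw [mem_antidiagonal] at hxy
        by_cases hx : i = x
        · have hy : j ≠ y := fun hy => h (by rw [hx, hy, hxy])
          rw [if_neg hy, map_zero, mul_zero]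
        · rw [if_neg hx, zero_mul]

end Coefficients

end TwistedPolynomial

/-! ### Twisted power series -/

section TwistedSeries

variable {k R R' : Type*} [Field k] [Fintype k] [CommRing R] [Algebra k R] [CommRing R']
  [Algebra k R'] [Algebra R R']

theorem algebraMap_frobenius_pow (i : ℕ) (c : R) :
    algebraMap R R' ((FiniteField.frobeniusAlgHom k R ^ i) c) =
      (FiniteField.frobeniusAlgHom k R' ^ i) (algebraMap R R' c) := by
  induction i generalizing c with
  | zero => rfl
  | succ i ih =>
    rw [pow_succ, pow_succ, AlgHom.mul_apply, AlgHom.mul_apply, ih]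
    simp [FiniteField.frobeniusAlgHom_apply]

/-- Right multiplication of a twisted power series by a twisted polynomial. -/
def seriesMul (s : ℕ → R') (f : TwistedPolynomial (FiniteField.frobeniusAlgHom k R)) : ℕ → R' :=
  fun n => ∑ x ∈ antidiagonal n,
    s x.1 * (FiniteField.frobeniusAlgHom k R' ^ x.1) (algebraMap R R' (f.coeff x.2))

variable (s t : ℕ → R') (f g : TwistedPolynomial (FiniteField.frobeniusAlgHom k R))

theorem seriesMul_apply (n : ℕ) : seriesMul s f n = ∑ x ∈ antidiagonal n,
    s x.1 * (FiniteField.frobeniusAlgHom k R' ^ x.1) (algebraMap R R' (f.coeff x.2)) := rfl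

theorem add_seriesMul : seriesMul (s + t) f = seriesMul s f + seriesMul t f := by
  ext n
  simp only [seriesMul_apply, Pi.add_apply, add_mul, Finset.sum_add_distrib]

theorem seriesMul_add : seriesMul s (f + g) = seriesMul s f + seriesMul s g := by
  ext n
  simp only [seriesMul_apply, Pi.add_apply, TwistedPolynomial.coeff_add, map_add, mul_add,
    Finset.sum_add_distrib]

theorem smul_seriesMul (c : R') : seriesMul (c • s) f = c • seriesMul s f := by
  ext n
  simp only [seriesMul_apply, Pi.smul_apply, smul_eq_mul, Finset.mul_sum, mul_assoc]

theorem seriesMul_smul [IsScalarTower k R R'] (c : k) : seriesMul s (c • f) = c • seriesMul s f := by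
  have h : ∀ i, TwistedPolynomial.coeff (c • f) i = c • TwistedPolynomial.coeff f i := fun i => by
    induction f using TwistedPolynomial.induction_on with
    | zero => simp [TwistedPolynomial.coeff_zero]
    | add f f' h h' => simp only [smul_add, TwistedPolynomial.coeff_add, h, h']
    | mono j e =>
      rw [TwistedPolynomial.smul_monomial, TwistedPolynomial.coeff_monomial,
        TwistedPolynomial.coeff_monomial]
      split_ifs <;> simp
  ext n
  simp only [seriesMul_apply, Pi.smul_apply, h, Finset.smul_sum, map_smul,
    mul_smul_comm, ← IsScalarTower.toAlgHom_apply k R R']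

theorem seriesMul_one : seriesMul s (1 : TwistedPolynomial (FiniteField.frobeniusAlgHom k R)) = s := by
  have h : ∀ i, TwistedPolynomial.coeff
      (1 : TwistedPolynomial (FiniteField.frobeniusAlgHom k R)) i = if 0 = i then 1 else 0 :=
    fun i => TwistedPolynomial.coeff_monomial 0 i 1
  ext n
  rw [seriesMul_apply, Finset.sum_eq_single (n, 0)]
  · simp [h]
  · rintro ⟨x, y⟩ hxy hne
    rw [mem_antidiagonal] at hxy
    have hy : (0 : ℕ) ≠ y := by
      rintro rfl
      exact hne (by rw [← hxy]; rfl)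
    simp only [h, if_neg hy, map_zero, mul_zero]
  · simp

/-- Both sides are sums over triples of exponents with total `n`, and the twists agree because
powers of Frobenius compose. This associativity makes right multiplication by `φ` an action. -/
theorem seriesMul_mul : seriesMul s (f * g) = seriesMul (seriesMul s f) g := by
  ext n
  simp only [seriesMul_apply, TwistedPolynomial.coeff_mul, map_sum, map_mul, Finset.mul_sum,
    Finset.sum_mul, algebraMap_frobenius_pow (k := k) (R := R) (R' := R')]
  rw [Finset.sum_sigma', Finset.sum_sigma']
  refine Finset.sum_nbij' (fun x => ⟨(x.1.1 + x.2.1, x.2.2), (x.1.1, x.2.1)⟩)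
    (fun x => ⟨(x.2.1, x.2.2 + x.1.2), (x.2.2, x.1.2)⟩) ?_ ?_ ?_ ?_ ?_
  · rintro ⟨⟨a, b⟩, ⟨c, d⟩⟩ h
    simp only [Finset.mem_sigma, mem_antidiagonal] at h ⊢
    exact ⟨by omega, trivial⟩
  · rintro ⟨⟨a, b⟩, ⟨c, d⟩⟩ h
    simp only [Finset.mem_sigma, mem_antidiagonal] at h ⊢
    exact ⟨by omega, trivial⟩
  · rintro ⟨⟨a, b⟩, ⟨c, d⟩⟩ h
    simp only [Finset.mem_sigma, mem_antidiagonal] at h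
    obtain ⟨h, rfl⟩ := h
    rfl
  · rintro ⟨⟨a, b⟩, ⟨c, d⟩⟩ h
    simp only [Finset.mem_sigma, mem_antidiagonal] at h
    obtain ⟨h, rfl⟩ := h
    rfl
  · rintro ⟨⟨a, b⟩, ⟨c, d⟩⟩ h
    rw [pow_add, AlgHom.mul_apply, mul_assoc]

/-- The coefficients of a twisted polynomial, viewed as a power series over `R'`. -/
def toSeries (R' : Type*) [CommRing R'] [Algebra R R']
    (f : TwistedPolynomial (FiniteField.frobeniusAlgHom k R)) : ℕ → R' :=
  fun i => algebraMap R R' (f.coeff i)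

theorem toSeries_add : toSeries R' (f + g) = toSeries R' f + toSeries R' g := by
  ext i
  simp only [toSeries, Pi.add_apply, TwistedPolynomial.coeff_add, map_add]

theorem toSeries_mul : toSeries R' (f * g) = seriesMul (toSeries R' f) g := by
  ext n
  simp only [toSeries, seriesMul_apply, TwistedPolynomial.coeff_mul, map_sum, map_mul,
    algebraMap_frobenius_pow (k := k) (R := R) (R' := R')]

variable (k) in
/-- Left multiplication by `τ` on twisted power series. -/
def seriesTau (s : ℕ → R') : ℕ → R'
  | 0 => 0
  | n + 1 => s n ^ Fintype.card k

theorem seriesTau_seriesMul : seriesTau k (seriesMul s f) = seriesMul (seriesTau k s) f := by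
  have hF : ∀ x : R', x ^ Fintype.card k = FiniteField.frobeniusAlgHom k R' x := fun x => by
    simp [FiniteField.frobeniusAlgHom_apply]
  ext n
  cases n with
  | zero => simp [seriesTau, seriesMul_apply]
  | succ n =>
    rw [seriesMul_apply, Finset.Nat.sum_antidiagonal_succ]
    simp only [seriesTau, seriesMul_apply, hF, map_sum, map_mul, zero_mul, zero_add]
    refine Finset.sum_congr rfl fun x _ => ?_
    rw [pow_succ', AlgHom.mul_apply]

theorem seriesTau_add : seriesTau k (s + t) = seriesTau k s + seriesTau k t := by
  have hF : ∀ x : R', x ^ Fintype.card k = FiniteField.frobeniusAlgHom k R' x := fun x => by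
    simp [FiniteField.frobeniusAlgHom_apply]
  ext n
  cases n with
  | zero => simp [seriesTau]
  | succ n => simp only [seriesTau, Pi.add_apply, hF, map_add]

theorem seriesTau_smul (c : R') : seriesTau k (c • s) = c ^ Fintype.card k • seriesTau k s := by
  ext n
  cases n with
  | zero => simp [seriesTau]
  | succ n => simp only [seriesTau, Pi.smul_apply, smul_eq_mul, mul_pow]

theorem toSeries_tau_mul :
    toSeries R' (TwistedPolynomial.tau (FiniteField.frobeniusAlgHom k R) * f) =
      seriesTau k (toSeries R' f) := by
  have h : ∀ i, TwistedPolynomial.coeff (TwistedPolynomial.tau (FiniteField.frobeniusAlgHom k R)) i =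
    if 1 = i then 1 else 0 := fun i => TwistedPolynomial.coeff_monomial 1 i 1
  ext n
  cases n with
  | zero => simp [toSeries, seriesTau, TwistedPolynomial.coeff_mul, h]
  | succ n =>
    simp only [toSeries, seriesTau, TwistedPolynomial.coeff_mul, h]
    rw [Finset.sum_eq_single (1, n)]
    · simp [FiniteField.frobeniusAlgHom_apply]
    · rintro ⟨x, y⟩ hxy hne
      rw [mem_antidiagonal] at hxy
      have hx : 1 ≠ x := by
        rintro rfl
        exact hne (by rw [Prod.mk.injEq]; exact ⟨rfl, by simp only at hxy; omega⟩)
      rw [if_neg hx, zero_mul]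
    · intro hn
      exact absurd (mem_antidiagonal.2 (by simp [add_comm])) hn

end TwistedSeries
end

open Finset.HasAntidiagonal (antidiagonal mem_antidiagonal)

noncomputable section

/-- Used to determine the coefficients of a quotient of series one after the other, each from all
earlier ones. -/
theorem exists_strongRec {X : Type*} (F : ∀ n : ℕ, (∀ i < n, X) → X) :
    ∃ s : ℕ → X, ∀ n, s n = F n fun i _ => s i :=
  ⟨fun n => Nat.lt_wfRel.wf.fix F n, fun n => Nat.lt_wfRel.wf.fix_eq F n⟩

/-! ### Division by lowest and by highest terms -/

section Division

variable {k R R' : Type*} [Field k] [Fintype k] [CommRing R] [Algebra k R] [CommRing R']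
  [Algebra k R'] [Algebra R R'] (s : ℕ → R') (f : TwistedPolynomial (FiniteField.frobeniusAlgHom k R))

theorem seriesMul_apply_range (n : ℕ) : seriesMul s f n = ∑ i ∈ Finset.range (n + 1),
    s i * (FiniteField.frobeniusAlgHom k R' ^ i) (algebraMap R R' (f.coeff (n - i))) :=
  Finset.Nat.sum_antidiagonal_eq_sum_range_succ_mk _ n

variable {f}

theorem seriesMul_apply_eq_zero {m j : ℕ} (hs : ∀ i < m, s i = 0)
    (hf : ∀ i < j, algebraMap R R' (f.coeff i) = 0) {n : ℕ} (hn : n < m + j) :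
    seriesMul s f n = 0 := by
  rw [seriesMul_apply_range]
  refine Finset.sum_eq_zero fun i hi => ?_
  rw [Finset.mem_range] at hi
  by_cases him : i < m
  · rw [hs i him, zero_mul]
  · rw [hf _ (by omega), map_zero, mul_zero]

theorem seriesMul_apply_add {j : ℕ} (hf : ∀ i < j, algebraMap R R' (f.coeff i) = 0) (n : ℕ) :
    seriesMul s f (n + j) = ∑ i ∈ Finset.range n,
      s i * (FiniteField.frobeniusAlgHom k R' ^ i) (algebraMap R R' (f.coeff (n + j - i))) +
      s n * (FiniteField.frobeniusAlgHom k R' ^ n) (algebraMap R R' (f.coeff j)) := by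
  rw [seriesMul_apply_range, show n + j + 1 = (n + 1) + j by ring, Finset.sum_range_add,
    Finset.sum_range_succ, show n + j - n = j by omega]
  refine add_eq_left.2 (Finset.sum_eq_zero fun i hi => ?_)
  rw [Finset.mem_range] at hi
  rw [hf _ (by omega), map_zero, mul_zero]

/-- Coefficient `n + j` of `s f` is a unit times `s n` plus terms in `s i` with `i < n`: a
triangular system with invertible diagonal. -/
theorem eq_zero_of_seriesMul {j m : ℕ} (hf : ∀ i < j, algebraMap R R' (f.coeff i) = 0)
    (hu : IsUnit (algebraMap R R' (f.coeff j))) (h : ∀ i < m + j, seriesMul s f i = 0) :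
    ∀ i < m, s i = 0 := by
  intro n
  induction n using Nat.strong_induction_on with
  | _ n ih =>
    intro hn
    have h1 := seriesMul_apply_add s hf n
    rw [h (n + j) (by omega), Finset.sum_eq_zero, zero_add] at h1
    · exact ((hu.map (FiniteField.frobeniusAlgHom k R' ^ n)).mul_left_eq_zero).1 h1.symm
    · intro i hi
      rw [Finset.mem_range] at hi
      rw [ih i hi (by omega), zero_mul]

theorem seriesMul_injective {j : ℕ} (hf : ∀ i < j, algebraMap R R' (f.coeff i) = 0)
    (hu : IsUnit (algebraMap R R' (f.coeff j))) (h : seriesMul s f = 0) : s = 0 := by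
  ext i
  exact eq_zero_of_seriesMul (m := i + 1) s hf hu (fun i _ => congrFun h i) i (Nat.lt_succ_self i)

/-- The same triangular system is solved recursively, starting from degree `j`; below `j` both sides
vanish. So multiples of `f` are detected by their order alone. -/
theorem exists_seriesMul_eq {j : ℕ} (hf : ∀ i < j, algebraMap R R' (f.coeff i) = 0)
    (hu : IsUnit (algebraMap R R' (f.coeff j))) (t : ℕ → R') (ht : ∀ i < j, t i = 0) :
    ∃ s, seriesMul s f = t := by
  have hv : ∀ n, ∃ v, v * (FiniteField.frobeniusAlgHom k R' ^ n) (algebraMap R R' (f.coeff j)) = 1 :=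
    fun n => (hu.map (FiniteField.frobeniusAlgHom k R' ^ n)).exists_left_inv
  choose v hv using hv
  obtain ⟨s, hs⟩ := exists_strongRec (X := R') fun n s => (t (n + j) -
    ∑ i : Finset.range n, s i (Finset.mem_range.1 i.2) *
      (FiniteField.frobeniusAlgHom k R' ^ (i : ℕ)) (algebraMap R R' (f.coeff (n + j - i)))) * v n
  refine ⟨s, funext fun n => ?_⟩
  by_cases hn : n < j
  · rw [ht n hn]
    exact seriesMul_apply_eq_zero (m := 0) s (by simp) hf (by omega)
  · obtain ⟨n, rfl⟩ := Nat.exists_eq_add_of_le' (not_lt.1 hn)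
    rw [seriesMul_apply_add s hf, hs n, mul_assoc, hv, mul_one,
      ← Finset.sum_coe_sort (Finset.range n)]
    ring

theorem seriesMul_apply_of_le {D N : ℕ} (hf : ∀ i, D < i → algebraMap R R' (f.coeff i) = 0)
    (hs : ∀ i, N < i → s i = 0) {n : ℕ} (hn : N + D ≤ n) : seriesMul s f n =
    if n = N + D then s N * (FiniteField.frobeniusAlgHom k R' ^ N) (algebraMap R R' (f.coeff D))
    else 0 := by
  rw [seriesMul_apply]
  split_ifs with h
  · rw [Finset.sum_eq_single (N, D)]
    · rintro ⟨x, y⟩ hxy hne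
      rw [mem_antidiagonal] at hxy
      simp only at hxy
      by_cases hx : N < x
      · rw [hs x hx, zero_mul]
      · have : D < y := by
          by_contra hy
          exact hne (by rw [Prod.mk.injEq]; omega)
        rw [hf y this, map_zero, mul_zero]
    · intro hn
      exact absurd (mem_antidiagonal.2 h.symm) hn
  · refine Finset.sum_eq_zero ?_
    rintro ⟨x, y⟩ hxy
    rw [mem_antidiagonal] at hxy
    simp only at hxy
    by_cases hx : N < x
    · rw [hs x hx, zero_mul]
    · rw [hf y (by omega), map_zero, mul_zero]

theorem eq_zero_of_seriesMul_of_le {D N : ℕ} (hf : ∀ i, D < i → algebraMap R R' (f.coeff i) = 0)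
    (hu : IsUnit (algebraMap R R' (f.coeff D))) (hs : ∀ i, N ≤ i → s i = 0)
    (h : ∀ i, D ≤ i → seriesMul s f i = 0) : s = 0 := by
  induction N with
  | zero => ext i; exact hs i (Nat.zero_le i)
  | succ N ih =>
    refine ih fun i hi => ?_
    rcases hi.eq_or_lt with rfl | hi
    · have h1 := seriesMul_apply_of_le (N := N) s hf (fun i hi => hs i hi) le_rfl
      rw [h _ (by omega), if_pos rfl] at h1
      exact ((hu.map (FiniteField.frobeniusAlgHom k R' ^ N)).mul_left_eq_zero).1 h1.symm
    · exact hs i hi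

/-- Division with remainder by a twisted polynomial with invertible leading coefficient. -/
theorem exists_eq_seriesMul_add {D N : ℕ} (hf : ∀ i, D < i → algebraMap R R' (f.coeff i) = 0)
    (hu : IsUnit (algebraMap R R' (f.coeff D))) (hs : ∀ i, N ≤ i → s i = 0) :
    ∃ q t : ℕ → R', (∀ i, N ≤ i → q i = 0) ∧ (∀ i, D ≤ i → t i = 0) ∧ s = seriesMul q f + t := by
  induction N generalizing s with
  | zero =>
    refine ⟨0, 0, fun _ _ => rfl, fun _ _ => rfl, ?_⟩
    ext i
    simp [hs i, seriesMul_apply]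
  | succ N ih =>
    by_cases hN : N < D
    · refine ⟨0, s, fun _ _ => rfl, fun i hi => hs i (by omega), ?_⟩
      ext i
      simp [seriesMul_apply]
    · obtain ⟨n, rfl⟩ := Nat.exists_eq_add_of_le' (not_lt.1 hN)
      obtain ⟨v, hv⟩ := (hu.map (FiniteField.frobeniusAlgHom k R' ^ n)).exists_left_inv
      -- The monomial whose product with `f` cancels the coefficient of `s` in degree `n + D`; `v`
      -- inverts the twisted leading coefficient of `f`.
      let c : ℕ → R' := Pi.single n (s (n + D) * v)
      have hc : ∀ i, n < i → c i = 0 := fun i hi => Pi.single_eq_of_ne (by omega) _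
      obtain ⟨q, t, hq, ht, h⟩ := ih (s - seriesMul c f) fun i hi => by
        rw [Pi.sub_apply, seriesMul_apply_of_le c hf hc hi]
        split_ifs with h
        · rw [h, show c n = s (n + D) * v from Pi.single_eq_same _ _, mul_assoc, hv, mul_one, sub_self]
        · rw [hs i (by omega), sub_zero]
      refine ⟨q + c, t, fun i hi => ?_, ht, ?_⟩
      · rw [Pi.add_apply, hq i (by omega), hc i (by omega), add_zero]
      · rw [add_seriesMul, add_right_comm, ← h, sub_add_cancel]

end Division

/-! ### Twisted power series as a module over `A ⊗ R'` -/

namespace DrinfeldModule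

variable {k A R : Type*} [Field k] [Fintype k] [CommRing A] [Algebra k A]
    [CommRing R] [Algebra k R] {r : ℕ} (φ : DrinfeldModule k A R r)
    (R' : Type*) [CommRing R'] [Algebra k R'] [Algebra R R'] [IsScalarTower k R R']

/-- Twisted power series over `R'`, as a module over `A ⊗ R'` through `φ`. -/
def Series (_φ : DrinfeldModule k A R r) (R' : Type*) : Type _ := ℕ → R'

instance : AddCommGroup (φ.Series R') := inferInstanceAs (AddCommGroup (ℕ → R'))
instance : Module R' (φ.Series R') := inferInstanceAs (Module R' (ℕ → R'))

/-- Right multiplication by `φ_a` on twisted power series. -/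
def seriesRightAction : A →ₐ[k] Module.End k (ℕ → R') :=
  AlgHom.ofLinearMap
    { toFun := fun a =>
        { toFun := fun s => seriesMul s (φ.toAlgHom a)
          map_add' := fun s t => add_seriesMul s t _
          map_smul' := fun c s => by
            rw [← algebraMap_smul R' c s, smul_seriesMul, algebraMap_smul, RingHom.id_apply] }
      map_add' := fun a b => by ext1 s; simp [seriesMul_add]
      map_smul' := fun c a => by ext1 s; simp [seriesMul_smul] }
    (by ext1 s; simp [seriesMul_one])
    -- Right multiplication reverses products; commutativity of `A` turns it into a homomorphism.
    (fun a b => by ext1 s; rw [mul_comm a b]; simp [seriesMul_mul])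

theorem seriesRightAction_apply (a : A) (s : ℕ → R') :
    φ.seriesRightAction R' a s = seriesMul s (φ.toAlgHom a) := rfl

theorem commute_seriesRightAction (a : A) (ξ : R') :
    Commute (φ.seriesRightAction R' a) (Algebra.lsmul k k (ℕ → R') ξ) := by
  ext1 s
  simp only [Module.End.mul_apply, seriesRightAction_apply, Algebra.lsmul_coe, smul_seriesMul]

/-- The action of `A ⊗ R'` on twisted power series. -/
def seriesAction : A ⊗[k] R' →ₐ[k] Module.End k (ℕ → R') :=
  Algebra.TensorProduct.lift (φ.seriesRightAction R') (Algebra.lsmul k k (ℕ → R'))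
    (φ.commute_seriesRightAction R')

theorem seriesAction_tmul (a : A) (ξ : R') (s : ℕ → R') :
    φ.seriesAction R' (a ⊗ₜ ξ) s = ξ • seriesMul s (φ.toAlgHom a) := by
  rw [seriesAction, Algebra.TensorProduct.lift_tmul, Module.End.mul_apply, seriesRightAction_apply,
    Algebra.lsmul_coe, smul_seriesMul]

instance : Module (A ⊗[k] R') (φ.Series R') :=
  Module.compHom (ℕ → R') (φ.seriesAction R').toRingHom

variable {φ R'}

/-- The coefficients of a twisted power series. -/
def Series.coeff : φ.Series R' →ₗ[R'] ℕ → R' where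
  toFun s := s
  map_add' _ _ := rfl
  map_smul' _ _ := rfl

variable (φ) in
/-- The twisted power series with given coefficients. -/
def Series.mk : (ℕ → R') →ₗ[R'] φ.Series R' where
  toFun s := s
  map_add' _ _ := rfl
  map_smul' _ _ := rfl

theorem Series.coeff_mk (s : ℕ → R') : (Series.mk φ s).coeff = s := rfl

theorem Series.ext {s t : φ.Series R'} (h : ∀ i, s.coeff i = t.coeff i) : s = t := funext h

theorem Series.coeff_injective : Function.Injective (Series.coeff (φ := φ) (R' := R')) :=
  fun _ _ h => h

theorem Series.coeff_tmul_smul (a : A) (ξ : R') (s : φ.Series R') :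
    ((a ⊗ₜ[k] ξ) • s).coeff = ξ • seriesMul s.coeff (φ.toAlgHom a) :=
  φ.seriesAction_tmul R' a ξ s.coeff

theorem Series.coeff_algebraMap_smul (a : A) (s : φ.Series R') :
    (algebraMap A (A ⊗[k] R') a • s).coeff = seriesMul s.coeff (φ.toAlgHom a) := by
  rw [Algebra.TensorProduct.algebraMap_apply, Series.coeff_tmul_smul, one_smul]
  rfl

theorem Series.one_tmul_smul (ξ : R') (s : φ.Series R') : ((1 : A) ⊗ₜ[k] ξ) • s = ξ • s := by
  apply Series.coeff_injective
  rw [Series.coeff_tmul_smul, map_one, seriesMul_one, map_smul]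

variable (φ R') in
/-- The power series divisible by `τ ^ m` on the right. -/
def vanishing (m : ℕ) : Submodule (A ⊗[k] R') (φ.Series R') where
  carrier := {s | ∀ i < m, s.coeff i = 0}
  add_mem' {s t} hs ht i hi := by
    rw [map_add, Pi.add_apply, hs i hi, ht i hi, add_zero]
  zero_mem' _ _ := rfl
  smul_mem' e s hs := by
    induction e using TensorProduct.induction_on with
    | zero => rw [zero_smul]; exact fun _ _ => rfl
    | add x y hx hy =>
      intro i hi
      rw [add_smul, map_add, Pi.add_apply, hx i hi, hy i hi, add_zero]
    | tmul a ξ =>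
      intro i hi
      rw [Series.coeff_tmul_smul, Pi.smul_apply,
        seriesMul_apply_eq_zero (j := 0) s.coeff hs (by simp) hi, smul_zero]

theorem mem_vanishing {m : ℕ} {s : φ.Series R'} :
    s ∈ φ.vanishing R' m ↔ ∀ i < m, s.coeff i = 0 := Iff.rfl

variable (φ R') in
/-- The twisted polynomials inside the twisted power series. -/
def finiteSupport : Submodule (A ⊗[k] R') (φ.Series R') where
  carrier := {s | ∃ N, ∀ i, N ≤ i → s.coeff i = 0}
  add_mem' {s t} hs ht := by
    obtain ⟨N, hs⟩ := hs
    obtain ⟨N', ht⟩ := ht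
    refine ⟨max N N', fun i hi => ?_⟩
    rw [map_add, Pi.add_apply, hs i (le_trans (le_max_left _ _) hi),
      ht i (le_trans (le_max_right _ _) hi), add_zero]
  zero_mem' := ⟨0, fun _ _ => rfl⟩
  smul_mem' e s hs := by
    obtain ⟨N, hs⟩ := hs
    induction e using TensorProduct.induction_on with
    | zero => rw [zero_smul]; exact ⟨0, fun _ _ => rfl⟩
    | add x y hx hy =>
      obtain ⟨M, hx⟩ := hx
      obtain ⟨M', hy⟩ := hy
      refine ⟨max M M', fun i hi => ?_⟩
      rw [add_smul, map_add, Pi.add_apply, hx i (le_trans (le_max_left _ _) hi),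
        hy i (le_trans (le_max_right _ _) hi), add_zero]
    | tmul a ξ =>
      obtain ⟨D, hD⟩ := (φ.toAlgHom a).exists_coeff_eq_zero
      refine ⟨N + D + 1, fun i hi => ?_⟩
      rw [Series.coeff_tmul_smul, Pi.smul_apply, seriesMul_apply_of_le (N := N) (D := D) s.coeff
        (fun i hi => by rw [hD i hi.le, map_zero]) (fun i hi => hs i hi.le) (by omega),
        if_neg (by omega), smul_zero]

theorem coeff_zero_eq_zero {a : A} (ha : a ∈ φ.characteristicIdeal) :
    (φ.toAlgHom a).coeff 0 = 0 := ha

/-- For `a ∈ ℘` the constant coefficient of `φ_a` vanishes, so each factor from `℘` raises the order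
in `τ`. This continuity allows the action to be extended to the completion. -/
theorem map_characteristicIdeal_smul_vanishing_le (n : ℕ) :
    φ.characteristicIdeal.map (algebraMap A (A ⊗[k] R')) • φ.vanishing R' n ≤
      φ.vanishing R' (n + 1) := by
  rw [Ideal.map, Submodule.span_smul_eq, Submodule.set_smul_le_iff]
  rintro _ s ⟨a, ha, rfl⟩ hs i hi
  rw [Series.coeff_algebraMap_smul]
  exact seriesMul_apply_eq_zero (j := 1) s.coeff hs
    (fun i hi => by rw [Nat.lt_one_iff.1 hi, coeff_zero_eq_zero ha, map_zero]) hi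

theorem pow_smul_top_le_vanishing (m : ℕ) :
    (φ.characteristicIdeal.map (algebraMap A (A ⊗[k] R'))) ^ m • ⊤ ≤ φ.vanishing R' m := by
  induction m with
  | zero => exact fun s _ i hi => absurd hi (Nat.not_lt_zero i)
  | succ m ih =>
    rw [pow_succ', ← smul_smul]
    exact (Submodule.smul_mono le_rfl ih).trans (map_characteristicIdeal_smul_vanishing_le m)

theorem pow_smul_mem_vanishing {m : ℕ} {e : A ⊗[k] R'}
    (he : e ∈ (φ.characteristicIdeal.map (algebraMap A (A ⊗[k] R'))) ^ m) (s : φ.Series R') :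
    e • s ∈ φ.vanishing R' m :=
  pow_smul_top_le_vanishing m (Submodule.smul_mem_smul he trivial)

variable (φ R') in
/-- `τ` acting on twisted power series. -/
def seriesTauMap :
    φ.Series R' →ₛₗ[(partialFrobenius k R' A : A ⊗[k] R' →+* A ⊗[k] R')] φ.Series R' where
  toFun s := Series.mk φ (seriesTau k s.coeff)
  map_add' s t := by rw [map_add, seriesTau_add, map_add]
  map_smul' e s := by
    apply Series.coeff_injective
    rw [Series.coeff_mk]
    induction e using TensorProduct.induction_on with
    | zero =>
      simp only [zero_smul, map_zero]
      ext i
      cases i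
      · rfl
      · exact zero_pow Fintype.card_ne_zero
    | add x y hx hy => rw [add_smul, map_add, map_add, add_smul, map_add, ← hx, ← hy, seriesTau_add]
    | tmul a ξ =>
      rw [Series.coeff_tmul_smul, seriesTau_smul, seriesTau_seriesMul]
      exact (Series.coeff_tmul_smul a _ _).symm

theorem Series.coeff_seriesTauMap (s : φ.Series R') :
    (φ.seriesTauMap R' s).coeff = seriesTau k s.coeff := rfl

end DrinfeldModule
end

/-! ### Local generators and the ring `B_P ⊗̂ R` -/

noncomputable section

/-- `z` generates the finitely generated ideal `P` locally at `P`. -/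
structure IsLocalGenerator {B : Type*} [CommRing B] (P : Ideal B) (z : B) : Prop where
  fg : P.FG
  mem : z ∈ P
  exists_dvd : ∃ x ∉ P, ∀ w ∈ P, z ∣ x * w

/-- The `m`-th power of the inclusion `xP ⊆ (z)`; since `P` is prime, `x ^ m` stays outside `P`. -/
theorem IsLocalGenerator.exists_dvd_pow {B : Type*} [CommRing B] {P : Ideal B} [P.IsPrime] {z : B}
    (h : IsLocalGenerator P z) (m : ℕ) : ∃ x ∉ P, ∀ w ∈ P ^ m, z ^ m ∣ x * w := by
  obtain ⟨x, hx, hxz⟩ := h.exists_dvd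
  refine ⟨x ^ m, fun h => hx (Ideal.IsPrime.mem_of_pow_mem inferInstance m h), fun w hw => ?_⟩
  have h1 : Ideal.span {x} * P ≤ Ideal.span {z} := by
    rw [Ideal.span_singleton_mul_le_iff]
    exact fun w hw => Ideal.mem_span_singleton.2 (hxz w hw)
  have h2 := Ideal.pow_right_mono h1 m
  rw [mul_pow, Ideal.span_singleton_pow, Ideal.span_singleton_pow] at h2
  exact Ideal.mem_span_singleton.1 (h2 (Ideal.mul_mem_mul (Ideal.mem_span_singleton_self _) hw))

/-- An element invertible modulo `P` is invertible modulo `P ^ m`: if `1 - yx ∈ P`, then `(1 - yx) ^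
m` lies in `P ^ m` and is congruent to `1` modulo `x`. -/
theorem Ideal.mem_pow_of_mul_mem {B : Type*} [CommRing B] {P : Ideal B} [P.IsMaximal] {m : ℕ}
    {x w : B} (hx : x ∉ P) (h : x * w ∈ P ^ m) : w ∈ P ^ m := by
  obtain ⟨y, hy⟩ := Ideal.IsMaximal.exists_inv (I := P) inferInstance hx
  obtain ⟨i, hi, hyi⟩ := hy
  have h1 : (1 - y * x) ^ m ∈ P ^ m := Ideal.pow_mem_pow (by rwa [← hyi, add_sub_cancel_left]) m
  obtain ⟨t, ht⟩ : y * x ∣ 1 - (1 - y * x) ^ m := by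
    have := sub_dvd_pow_sub_pow (1 : B) (1 - y * x) m
    rwa [one_pow, sub_sub_cancel] at this
  have : w = (1 - y * x) ^ m * w + y * t * (x * w) := by
    linear_combination w * ht
  rw [this]
  exact add_mem (Ideal.mul_mem_right _ _ h1) (Ideal.mul_mem_left _ _ h)

section CoefficientRing

variable (k : Type*) [Field k] [Fintype k] {B : Type*} [CommRing B] [Algebra k B]
  {P : Ideal B} (R : Type*) [CommRing R] [Algebra k R]

theorem fg_map_tensor (hP : P.FG) : (P.map (algebraMap B (B ⊗[k] R))).FG := hP.map _

theorem map_map_coeff :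
    (P.map (algebraMap B (B ⊗[k] R))).map (algebraMap (B ⊗[k] R) (IntegralCoeffRing k P R)) =
      P.map (algebraMap B (IntegralCoeffRing k P R)) := by
  rw [Ideal.map_map, ← IsScalarTower.algebraMap_eq]

theorem isAdicComplete_map (hP : P.FG) :
    IsAdicComplete (P.map (algebraMap B (IntegralCoeffRing k P R))) (IntegralCoeffRing k P R) := by
  rw [← map_map_coeff]
  exact AdicCompletion.isAdicComplete_self _ (fg_map_tensor k R hP)

/-- By completeness `P` lands in the Jacobson radical, so an inverse of `x` modulo `P` makes `x` a
unit. Thus passing to `B_P ⊗̂ R` already localizes at `P`. -/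
theorem isUnit_algebraMap_coeff [P.IsMaximal] (hP : P.FG) {x : B} (hx : x ∉ P) :
    IsUnit (algebraMap B (IntegralCoeffRing k P R) x) := by
  have := isAdicComplete_map k R hP
  obtain ⟨y, i, hi, hyi⟩ := Ideal.IsMaximal.exists_inv (I := P) inferInstance hx
  have h1 := IsAdicComplete.le_jacobson_bot (P.map (algebraMap B (IntegralCoeffRing k P R)))
    (Ideal.mem_map_of_mem _ hi)
  have h2 := Ideal.mem_jacobson_bot.1 h1 (-1)
  refine isUnit_of_mul_isUnit_right (x := algebraMap B (IntegralCoeffRing k P R) y) ?_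
  rw [← map_mul]
  convert h2 using 1
  rw [← eq_sub_iff_add_eq] at hyi
  rw [hyi]
  simp only [map_sub, map_one]
  ring

variable {z : B} (hz : IsLocalGenerator P z)
include hz

/-- The auxiliary factor `x ∉ P` in the definition of a local generator becomes a unit, so `z` plays
the role of the uniformizer. -/
theorem map_eq_span_coeff [P.IsMaximal] :
    P.map (algebraMap B (IntegralCoeffRing k P R)) =
      Ideal.span {algebraMap B (IntegralCoeffRing k P R) z} := by
  apply le_antisymm
  · rw [Ideal.map_le_iff_le_comap]
    intro w hw
    obtain ⟨x, hx, h⟩ := hz.exists_dvd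
    obtain ⟨c, hc⟩ := h w hw
    rw [Ideal.mem_comap, Ideal.mem_span_singleton]
    obtain ⟨u, hu⟩ := isUnit_algebraMap_coeff k R hz.fg hx
    refine (Units.dvd_mul_left (u := u)).1 ?_
    rw [hu, ← map_mul, hc, map_mul]
    exact dvd_mul_right _ _
  · rw [Ideal.span_singleton_le_iff_mem]
    exact Ideal.mem_map_of_mem _ hz.mem

theorem isAdicComplete_span_coeff [P.IsMaximal] :
    IsAdicComplete (Ideal.span {algebraMap B (IntegralCoeffRing k P R) z})
      (IntegralCoeffRing k P R) := by
  rw [← map_eq_span_coeff k R hz]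
  exact isAdicComplete_map k R hz.fg

theorem mem_jacobson_coeff [P.IsMaximal] :
    algebraMap B (IntegralCoeffRing k P R) z ∈
      (⊥ : Ideal (IntegralCoeffRing k P R)).jacobson := by
  have := isAdicComplete_span_coeff k R hz
  exact IsAdicComplete.le_jacobson_bot _ (Ideal.mem_span_singleton_self _)

/-- As `P` is finitely generated, the kernel of the projection to level `m` is the extension of `P ^
m`, which `z ^ m` generates. -/
theorem evalₐ_eq_zero_iff [P.IsMaximal] (m : ℕ) (e : IntegralCoeffRing k P R) :
    AdicCompletion.evalₐ (P.map (algebraMap B (B ⊗[k] R))) m e = 0 ↔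
      algebraMap B (IntegralCoeffRing k P R) z ^ m ∣ e := by
  have h0 : Ideal.span {algebraMap B (IntegralCoeffRing k P R) z ^ m} =
      ((P.map (algebraMap B (B ⊗[k] R))) ^ m).map
        (algebraMap (B ⊗[k] R) (IntegralCoeffRing k P R)) := by
    rw [Ideal.map_pow, map_map_coeff, map_eq_span_coeff k R hz, Ideal.span_singleton_pow]
  have h := AdicCompletion.pow_smul_top_eq_ker_eval (M := B ⊗[k] R) (n := m)
    (fg_map_tensor k R hz.fg)
  have h2 := Ideal.smul_top_eq_map (S := IntegralCoeffRing k P R)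
    ((P.map (algebraMap B (B ⊗[k] R))) ^ m)
  rw [← Ideal.mem_span_singleton, h0, ← Submodule.restrictScalars_mem (B ⊗[k] R), ← h2, h,
    LinearMap.mem_ker, ← AdicCompletion.factor_eval_eq_evalₐ _ _ (by simp)]
  -- The two evaluation maps use `I ^ m • ⊤` and `I ^ m`, which are the same ideal; the comparison
  -- of the quotients loses nothing.
  have hinj : Function.Injective (Ideal.Quotient.factor
      (show (P.map (algebraMap B (B ⊗[k] R))) ^ m • ⊤ ≤
        (P.map (algebraMap B (B ⊗[k] R))) ^ m by simp)) := by
    rw [injective_iff_map_eq_zero]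
    intro a ha
    obtain ⟨a, rfl⟩ := Ideal.Quotient.mk_surjective a
    rw [Ideal.Quotient.factor_mk, Ideal.Quotient.eq_zero_iff_mem] at ha
    rw [Ideal.Quotient.eq_zero_iff_mem]
    simpa using ha
  exact map_eq_zero_iff _ hinj

theorem eq_zero_of_forall_pow_dvd [P.IsMaximal] (e : IntegralCoeffRing k P R)
    (h : ∀ m, algebraMap B (IntegralCoeffRing k P R) z ^ m ∣ e) : e = 0 := by
  refine AdicCompletion.ext_evalₐ (I := P.map (algebraMap B (B ⊗[k] R))) fun m => ?_
  rw [(evalₐ_eq_zero_iff k R hz m e).2 (h m), map_zero]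

theorem exists_eq_algebraMap_add [P.IsMaximal] (m : ℕ) (e : IntegralCoeffRing k P R) :
    ∃ (b : B ⊗[k] R) (e' : IntegralCoeffRing k P R),
      e = algebraMap _ _ b + algebraMap B (IntegralCoeffRing k P R) z ^ m * e' := by
  obtain ⟨b, hb⟩ := Ideal.Quotient.mk_surjective
    (AdicCompletion.evalₐ (P.map (algebraMap B (B ⊗[k] R))) m e)
  have h : AdicCompletion.evalₐ (P.map (algebraMap B (B ⊗[k] R))) m
      (e - algebraMap (B ⊗[k] R) (IntegralCoeffRing k P R) b) = 0 := by
    rw [map_sub, AlgHom.commutes, ← hb]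
    exact sub_self _
  obtain ⟨e', he'⟩ := (evalₐ_eq_zero_iff k R hz m _).1 h
  exact ⟨b, e', by rw [← he', add_sub_cancel]⟩

theorem pow_dvd_algebraMap_iff [P.IsMaximal] (m : ℕ) (b : B ⊗[k] R) :
    algebraMap B (IntegralCoeffRing k P R) z ^ m ∣ algebraMap (B ⊗[k] R) (IntegralCoeffRing k P R) b ↔
      b ∈ (P.map (algebraMap B (B ⊗[k] R))) ^ m := by
  rw [← evalₐ_eq_zero_iff k R hz, AlgHom.commutes]
  exact Ideal.Quotient.eq_zero_iff_mem

/-- Take for `m` the exact order of `b` along `P`. Then `x b = z ^ m c` with `x` and `c` outside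
`P`, and both become units. Hence inverting such `b` amounts to inverting `z`. -/
theorem exists_pow_mul_unit [P.IsMaximal] {b : B} (hb : ∃ m, b ∉ P ^ m) :
    ∃ (m : ℕ) (u : IntegralCoeffRing k P R), IsUnit u ∧
      algebraMap B (IntegralCoeffRing k P R) b =
        algebraMap B (IntegralCoeffRing k P R) z ^ m * u := by
  classical
  obtain ⟨m, hm⟩ : ∃ m, Nat.find hb = m + 1 :=
    Nat.exists_eq_succ_of_ne_zero fun h => by
      have := Nat.find_spec hb
      rw [h, pow_zero, Ideal.one_eq_top] at this
      exact this trivial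
  have h1 : b ∈ P ^ m := not_not.1 (Nat.find_min hb (by omega))
  have h2 : b ∉ P ^ (m + 1) := by rw [← hm]; exact Nat.find_spec hb
  obtain ⟨x, hx, h⟩ := hz.exists_dvd_pow m
  obtain ⟨c, hc⟩ := h b h1
  have hcP : c ∉ P := fun hcP => h2 (Ideal.mem_pow_of_mul_mem hx (by
    rw [hc, pow_succ]; exact Ideal.mul_mem_mul (Ideal.pow_mem_pow hz.mem m) hcP))
  obtain ⟨u, hu⟩ := isUnit_algebraMap_coeff k R hz.fg hx
  refine ⟨m, ↑u⁻¹ * algebraMap B _ c,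
    (Units.isUnit _).mul (isUnit_algebraMap_coeff k R hz.fg hcP), ?_⟩
  rw [mul_left_comm, ← map_pow, ← map_mul, ← hc, map_mul, ← hu, Units.inv_mul_cancel_left]

attribute [local instance] Algebra.TensorProduct.rightAlgebra

/-- The residue ring of `B_P ⊗̂ R` has a section. -/
theorem exists_section_coeff [P.IsMaximal] [FiniteDimensional k (B ⧸ P)] :
    ∃ β : R ⊗[k] (B ⧸ P) →ₐ[R] IntegralCoeffRing k P R,
      ∀ e, ∃ b e', e = β b + algebraMap B (IntegralCoeffRing k P R) z * e' := by
  let _ := Ideal.Quotient.field P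
  -- The residue field is a finite extension of the finite field `k`, so it is formally étale and
  -- its map into the residue ring lifts to the completion. Extending this lift `R`-linearly gives
  -- the section.
  have := Algebra.FormallyEtale.of_isSeparable k (B ⧸ P)
  let I := P.map (algebraMap B (B ⊗[k] R))
  let f : B ⧸ P →ₐ[k] (B ⊗[k] R) ⧸ I := Ideal.quotientMapₐ I
    (Algebra.TensorProduct.includeLeft (R := k) (S := k) (A := B) (B := R)) Ideal.le_comap_map
  obtain ⟨g, hg⟩ := Algebra.FormallySmooth.exists_adicCompletionEvalOneₐ_comp_eq f
  have hg' : ∀ x, AdicCompletion.evalOneₐ I (g x) = f x := fun x => DFunLike.congr_fun hg x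
  let β : R ⊗[k] (B ⧸ P) →ₐ[R] IntegralCoeffRing k P R :=
    Algebra.TensorProduct.lift (Algebra.ofId R _) g fun _ _ => Commute.all _ _
  have hker : ∀ e : IntegralCoeffRing k P R, AdicCompletion.evalOneₐ I e = 0 →
      algebraMap B (IntegralCoeffRing k P R) z ∣ e := by
    intro e he
    have : e ∈ RingHom.ker (AdicCompletion.evalOneₐ I).toRingHom := he
    rw [AdicCompletion.ker_evalOneₐ_eq_map I (fg_map_tensor k R hz.fg), map_map_coeff,
      map_eq_span_coeff k R hz] at this
    exact Ideal.mem_span_singleton.1 this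
  have key : ∀ d : B ⊗[k] R, ∃ b, algebraMap B (IntegralCoeffRing k P R) z ∣
      algebraMap (B ⊗[k] R) (IntegralCoeffRing k P R) d - β b := by
    intro d
    induction d using TensorProduct.induction_on with
    | zero => exact ⟨0, by simp⟩
    | add x y hx hy =>
      obtain ⟨b, hb⟩ := hx
      obtain ⟨c, hc⟩ := hy
      exact ⟨b + c, by rw [map_add, map_add, add_sub_add_comm]; exact dvd_add hb hc⟩
    | tmul a ξ =>
      refine ⟨ξ ⊗ₜ Ideal.Quotient.mk P a, hker _ ?_⟩
      have h1 : β (ξ ⊗ₜ Ideal.Quotient.mk P a) =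
          algebraMap (B ⊗[k] R) (IntegralCoeffRing k P R) (1 ⊗ₜ ξ) * g (Ideal.Quotient.mk P a) :=
        Algebra.TensorProduct.lift_tmul _ _ _ _ _
      rw [map_sub, h1, map_mul, hg', AlgHom.commutes, AlgHom.commutes, sub_eq_zero]
      change Ideal.Quotient.mk I _ = Ideal.Quotient.mk I _ * Ideal.Quotient.mk I (a ⊗ₜ 1)
      rw [← map_mul, Algebra.TensorProduct.tmul_mul_tmul, one_mul, mul_one]
  refine ⟨β, fun e => ?_⟩
  obtain ⟨d, e', rfl⟩ := exists_eq_algebraMap_add k R hz 1 e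
  obtain ⟨b, c, hc⟩ := key d
  refine ⟨b, c + e', ?_⟩
  rw [mul_add, ← hc, pow_one]
  ring

/-- Completion does not change the quotient by `P ^ m`. In particular this quotient is free over `R`
with rank `dim_k (B / P ^ m)`. -/
theorem exists_coeffQuotientEquiv [P.IsMaximal] (m : ℕ) :
    Nonempty ((IntegralCoeffRing k P R ⧸
      Ideal.span {algebraMap B (IntegralCoeffRing k P R) z ^ m}) ≃ₐ[R] R ⊗[k] (B ⧸ P ^ m)) := by
  let I := P.map (algebraMap B (B ⊗[k] R))
  let f : IntegralCoeffRing k P R →ₐ[R] (B ⊗[k] R) ⧸ I ^ m :=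
    (AdicCompletion.evalₐ I m).restrictScalars R
  have hf : RingHom.ker f = Ideal.span {algebraMap B (IntegralCoeffRing k P R) z ^ m} := by
    ext e
    rw [Ideal.mem_span_singleton]
    exact evalₐ_eq_zero_iff k R hz m e
  have hs : Function.Surjective f := AdicCompletion.surjective_evalₐ I m
  let e1 := (Ideal.quotientEquivAlgOfEq R hf.symm).trans (Ideal.quotientKerAlgEquivOfSurjective hs)
  let e2 := (Ideal.quotientEquivAlgOfEq B (Ideal.map_pow (algebraMap B (B ⊗[k] R)) P m).symm).trans
    (Algebra.TensorProduct.quotientTensorEquiv (R := k) B R B (P ^ m)).symm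
  let e3 := Algebra.TensorProduct.comm k (B ⧸ P ^ m) R
  refine ⟨e1.trans (AlgEquiv.ofRingEquiv (f := e2.toRingEquiv.trans e3.toRingEquiv) fun ξ => ?_)⟩
  change e3 (e2 (Ideal.Quotient.mk _ (1 ⊗ₜ ξ))) = ξ ⊗ₜ 1
  rfl

theorem free_coeff_quotient [P.IsMaximal] (m : ℕ) : Module.Free R (IntegralCoeffRing k P R ⧸
    Ideal.span {algebraMap B (IntegralCoeffRing k P R) z ^ m}) :=
  let ⟨e⟩ := exists_coeffQuotientEquiv k R hz m
  Module.Free.of_equiv e.symm.toLinearEquiv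

theorem finite_coeff_quotient [P.IsMaximal] (m : ℕ) [FiniteDimensional k (B ⧸ P ^ m)] :
    Module.Finite R (IntegralCoeffRing k P R ⧸
      Ideal.span {algebraMap B (IntegralCoeffRing k P R) z ^ m}) :=
  let ⟨e⟩ := exists_coeffQuotientEquiv k R hz m
  Module.Finite.equiv e.symm.toLinearEquiv

theorem finrank_coeff_quotient [P.IsMaximal] [Nontrivial R] (m : ℕ) :
    Module.finrank R (IntegralCoeffRing k P R ⧸
      Ideal.span {algebraMap B (IntegralCoeffRing k P R) z ^ m}) =
      Module.finrank k (B ⧸ P ^ m) := by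
  obtain ⟨e⟩ := exists_coeffQuotientEquiv k R hz m
  rw [e.toLinearEquiv.finrank_eq, Module.finrank_baseChange]

/-- Translates ranks over `B_P ⊗̂ R` into ranks over `R`, where they can be read off from degrees of
twisted polynomials. -/
theorem finrank_quotient_eq_mul [P.IsMaximal] [IsDomain R] (m : ℕ)
    [FiniteDimensional k (B ⧸ P ^ m)] {V : Type*} [AddCommGroup V]
    [Module (IntegralCoeffRing k P R) V] [Module.Finite (IntegralCoeffRing k P R) V]
    [Module.Projective (IntegralCoeffRing k P R) V] [Module R V]
    [IsScalarTower R (IntegralCoeffRing k P R) V] (c : ℕ)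
    (hc : ∀ x, Module.rankAtStalk (R := IntegralCoeffRing k P R) V x = c) :
    Module.finrank R (V ⧸ (algebraMap B (IntegralCoeffRing k P R) z ^ m • ⊤ :
      Submodule (IntegralCoeffRing k P R) V)) = c * Module.finrank k (B ⧸ P ^ m) := by
  let E := IntegralCoeffRing k P R
  let J : Ideal E := Ideal.span {algebraMap B (IntegralCoeffRing k P R) z ^ m}
  have := free_coeff_quotient k R hz m
  have := finite_coeff_quotient k R hz m
  rw [← finrank_coeff_quotient k R hz m]
  have hJ : J • (⊤ : Submodule E V) = algebraMap B E z ^ m • ⊤ :=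
    Submodule.ideal_span_singleton_smul _ _
  rw [← hJ, ← finrank_eq_mul_finrank (V := (E ⧸ J) ⊗[E] V) c fun x => by
    rw [Module.rankAtStalk_baseChange, hc]]
  exact ((TensorProduct.quotTensorEquivQuotSMul V J).restrictScalars R).finrank_eq.symm

end CoefficientRing
end

open Finset.HasAntidiagonal (antidiagonal mem_antidiagonal)

/-! ### Extending the action on series to the completion -/

noncomputable section

theorem isPrecomplete_pi {E ι : Type*} [CommRing E] (z : E) [IsPrecomplete (Ideal.span {z}) E] :
    IsPrecomplete (Ideal.span {z}) (ι → E) where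
  prec' f hf := by
    have hmem : ∀ (n : ℕ) (g : ι → E), g ∈ (Ideal.span {z} ^ n • ⊤ : Submodule E (ι → E)) ↔
        ∀ i, z ^ n ∣ g i := by
      intro n g
      rw [Ideal.span_singleton_pow, Submodule.ideal_span_singleton_smul]
      constructor
      · intro h i
        obtain ⟨c, -, rfl⟩ := (Submodule.mem_smul_pointwise_iff_exists _ _ _).1 h
        exact dvd_mul_right _ _
      · intro h
        choose c hc using h
        exact (Submodule.mem_smul_pointwise_iff_exists _ _ _).2 ⟨c, trivial, (funext hc).symm⟩
    have hmem' : ∀ (n : ℕ) (g : E), g ∈ (Ideal.span {z} ^ n • ⊤ : Submodule E E) ↔ z ^ n ∣ g := by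
      intro n g
      rw [Ideal.span_singleton_pow, smul_eq_mul, Ideal.mul_top, Ideal.mem_span_singleton]
    have h : ∀ i, ∃ L : E, ∀ n, f n i ≡ L [SMOD (Ideal.span {z} ^ n • ⊤ : Submodule E E)] :=
      fun i => IsPrecomplete.prec' (fun n => f n i) fun hmn => by
        have := hf hmn
        rw [SModEq.sub_mem, hmem] at this
        rw [SModEq.sub_mem, hmem']
        exact this i
    choose L hL using h
    refine ⟨L, fun n => ?_⟩
    rw [SModEq.sub_mem, hmem]
    intro i
    have := hL i n
    rwa [SModEq.sub_mem, hmem'] at this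

theorem evalₐ_integralSigma (k : Type*) [Field k] [Fintype k] {B : Type*} [CommRing B] [Algebra k B]
    {P : Ideal B} (R : Type*) [CommRing R] [Algebra k R] (m : ℕ) (x : IntegralCoeffRing k P R)
    (d : B ⊗[k] R) (h : AdicCompletion.evalₐ (P.map (algebraMap B (B ⊗[k] R))) m x =
      Ideal.Quotient.mk _ d) :
    AdicCompletion.evalₐ (P.map (algebraMap B (B ⊗[k] R))) m (integralSigma k P R x) =
      Ideal.Quotient.mk _ (partialFrobenius k R B d) := by
  refine (AdicCompletion.evalₐ_liftRingHom (P.map (algebraMap B (B ⊗[k] R))) _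
    (fun hle => integralSigma_compat k P R hle) m _).trans ?_
  exact (congrArg (Ideal.quotientMap _ (partialFrobenius k R B : B ⊗[k] R →+* B ⊗[k] R)
    (partialFrobenius_le k P R m)) h).trans (Ideal.quotientMap_mk)

theorem evalₐ_eq_of_le {D : Type*} [CommRing D] {I : Ideal D} {m n : ℕ} (hmn : m ≤ n)
    {x : AdicCompletion I D} {d : D} (h : AdicCompletion.evalₐ I n x = Ideal.Quotient.mk _ d) :
    AdicCompletion.evalₐ I m x = Ideal.Quotient.mk _ d := by
  obtain ⟨x, rfl⟩ := AdicCompletion.mk_surjective _ _ x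
  rw [AdicCompletion.evalₐ_mk] at h ⊢
  rw [← AdicCompletion.Ideal.mk_eq_mk _ hmn, Ideal.Quotient.mk_eq_mk_iff_sub_mem]
  rw [Ideal.Quotient.mk_eq_mk_iff_sub_mem] at h
  exact Ideal.pow_le_pow_right hmn h

namespace DrinfeldModule

variable {k A R : Type*} [Field k] [Fintype k] [CommRing A] [Algebra k A]
    [CommRing R] [Algebra k R] {r : ℕ} {φ : DrinfeldModule k A R r}
    {R' : Type*} [CommRing R'] [Algebra k R'] [Algebra R R'] [IsScalarTower k R R']

local notation "𝓘" => φ.characteristicIdeal.map (algebraMap A (A ⊗[k] R'))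
local notation "𝓔" => IntegralCoeffRing k φ.characteristicIdeal R'

theorem eq_of_forall_sub_mem {s t : φ.Series R'} (h : ∀ m, s - t ∈ φ.vanishing R' m) : s = t :=
  Series.ext fun i => by
    have := h (i + 1) i (Nat.lt_succ_self i)
    rwa [map_sub, Pi.sub_apply, sub_eq_zero] at this

/-- An element of `A ⊗ R'` that approximates an element of the completion. -/
def approx (x : 𝓔) (m : ℕ) : A ⊗[k] R' :=
  (Ideal.Quotient.mk_surjective (AdicCompletion.evalₐ 𝓘 m x)).choose

theorem approx_spec (x : 𝓔) (m : ℕ) :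
    AdicCompletion.evalₐ 𝓘 m x = Ideal.Quotient.mk _ (approx x m) :=
  (Ideal.Quotient.mk_surjective (AdicCompletion.evalₐ 𝓘 m x)).choose_spec.symm

/-- The ideal `𝓘 ^ (i + 1)` kills all coefficients of index at most `i`. So coefficient `i` of `x •
s` depends only on `x` modulo this ideal, and the chosen approximation is immaterial. -/
instance : SMul 𝓔 (φ.Series R') where
  smul x s := Series.mk φ fun i => (approx x (i + 1) • s).coeff i

theorem coeff_smul (x : 𝓔) (s : φ.Series R') (i : ℕ) :
    (x • s).coeff i = (approx x (i + 1) • s).coeff i := rfl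

theorem smul_sub_smul_mem {x : 𝓔} {m : ℕ} {d : A ⊗[k] R'}
    (h : AdicCompletion.evalₐ 𝓘 m x = Ideal.Quotient.mk _ d) (s : φ.Series R') :
    x • s - d • s ∈ φ.vanishing R' m := by
  intro i hi
  have h1 := (approx_spec x (i + 1)).symm.trans (evalₐ_eq_of_le hi h)
  rw [Ideal.Quotient.mk_eq_mk_iff_sub_mem] at h1
  have h2 := pow_smul_mem_vanishing h1 s i (Nat.lt_succ_self i)
  rw [sub_smul, map_sub, Pi.sub_apply] at h2
  rw [map_sub, Pi.sub_apply, coeff_smul, h2]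

theorem eq_of_forall_exists {s t : φ.Series R'}
    (h : ∀ m, ∃ u, s - u ∈ φ.vanishing R' m ∧ t - u ∈ φ.vanishing R' m) : s = t :=
  eq_of_forall_sub_mem fun m => by
    obtain ⟨u, h1, h2⟩ := h m
    rw [← sub_sub_sub_cancel_right s t u]
    exact sub_mem h1 h2

theorem algebraMap_smul_series (d : A ⊗[k] R') (s : φ.Series R') :
    algebraMap (A ⊗[k] R') 𝓔 d • s = d • s :=
  eq_of_forall_sub_mem fun m =>
    smul_sub_smul_mem ((AdicCompletion.evalₐ 𝓘 m).commutes d) s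

theorem approx_smul_mem (x : 𝓔) (m : ℕ) (s : φ.Series R') :
    x • s - approx x m • s ∈ φ.vanishing R' m := smul_sub_smul_mem (approx_spec x m) s

/-- Additivity and associativity in the scalar hold for approximations up to every `vanishing m`,
and these submodules intersect in zero. -/
instance : Module 𝓔 (φ.Series R') where
  one_smul s := by rw [← map_one (algebraMap (A ⊗[k] R') 𝓔), algebraMap_smul_series, one_smul]
  smul_zero x := by
    refine Series.ext fun i => ?_
    rw [coeff_smul, smul_zero]
  zero_smul s := by rw [← map_zero (algebraMap (A ⊗[k] R') 𝓔), algebraMap_smul_series, zero_smul]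
  smul_add x s t := by
    refine Series.ext fun i => ?_
    rw [map_add, Pi.add_apply]
    simp only [coeff_smul, smul_add, map_add, Pi.add_apply]
  add_smul x y s := eq_of_forall_exists fun m => by
    refine ⟨(approx x m + approx y m) • s, smul_sub_smul_mem ?_ s, ?_⟩
    · rw [map_add, map_add, approx_spec, approx_spec]
    · rw [add_smul, add_sub_add_comm]
      exact add_mem (approx_smul_mem _ _ _) (approx_smul_mem _ _ _)
  mul_smul x y s := eq_of_forall_exists fun m => by
    refine ⟨(approx x m * approx y m) • s, smul_sub_smul_mem ?_ s, ?_⟩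
    · rw [map_mul, map_mul, approx_spec, approx_spec]
    · rw [mul_smul, ← sub_add_sub_cancel _ (approx x m • y • s), ← smul_sub]
      exact add_mem (approx_smul_mem _ _ _) (Submodule.smul_mem _ _ (approx_smul_mem _ _ _))

attribute [local instance] Algebra.TensorProduct.rightAlgebra

instance : IsScalarTower R' (A ⊗[k] R') (φ.Series R') where
  smul_assoc ξ d s := by
    rw [Algebra.smul_def, mul_smul]
    exact Series.one_tmul_smul ξ _

instance : IsScalarTower R' 𝓔 (φ.Series R') where
  smul_assoc ξ x s := by
    rw [Algebra.smul_def, mul_smul, IsScalarTower.algebraMap_apply R' (A ⊗[k] R') 𝓔,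
      algebraMap_smul_series]
    exact Series.one_tmul_smul ξ _

theorem Series.coeff_algebraMap_smul' (a : A) (s : φ.Series R') :
    (algebraMap A 𝓔 a • s).coeff = seriesMul s.coeff (φ.toAlgHom a) := by
  rw [IsScalarTower.algebraMap_apply A (A ⊗[k] R') 𝓔, algebraMap_smul_series,
    Series.coeff_algebraMap_smul]

theorem seriesTauMap_mem_vanishing {m : ℕ} {s : φ.Series R'} (hs : s ∈ φ.vanishing R' m) :
    φ.seriesTauMap R' s ∈ φ.vanishing R' (m + 1) := by
  intro i hi
  rw [Series.coeff_seriesTauMap]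
  cases i with
  | zero => rfl
  | succ i =>
    change s.coeff i ^ _ = 0
    rw [hs i (by omega), zero_pow Fintype.card_ne_zero]

variable (φ R') in
/-- `τ` acting on twisted power series, semilinear over the completion. -/
def seriesFrob : φ.Series R' →ₛₗ[integralSigma k φ.characteristicIdeal R'] φ.Series R' where
  toFun := φ.seriesTauMap R'
  map_add' := map_add _
  map_smul' x s := eq_of_forall_exists fun m => by
    refine ⟨partialFrobenius k R' A (approx x m) • φ.seriesTauMap R' s, ?_,
      smul_sub_smul_mem (evalₐ_integralSigma k R' m x _ (approx_spec x m)) _⟩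
    have h : partialFrobenius k R' A (approx x m) • φ.seriesTauMap R' s =
      φ.seriesTauMap R' (approx x m • s) := ((φ.seriesTauMap R').map_smulₛₗ _ _).symm
    rw [h, ← map_sub]
    exact fun i hi => seriesTauMap_mem_vanishing (approx_smul_mem x m s) i (by omega)

theorem Series.coeff_seriesFrob (s : φ.Series R') :
    (φ.seriesFrob R' s).coeff = seriesTau k s.coeff := rfl

end DrinfeldModule
end

/-! ### Twisted power series form a finite projective module -/

noncomputable section

attribute [local instance] Algebra.TensorProduct.rightAlgebra

/-- A variant of `projective_of_projective_quotient` for the coefficient ring `B_P ⊗̂ R`. -/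
theorem projective_of_projective_quotient_coeff (k : Type*) [Field k] [Fintype k] {B : Type*}
    [CommRing B] [Algebra k B] {P : Ideal B} (R : Type*) [CommRing R] [Algebra k R] {z : B}
    (hz : IsLocalGenerator P z) [P.IsMaximal] [FiniteDimensional k (B ⧸ P)]
    {W V : Type*} [AddCommGroup W] [Module (IntegralCoeffRing k P R) W]
    [Module.Finite (IntegralCoeffRing k P R) W] [Module R W]
    [IsScalarTower R (IntegralCoeffRing k P R) W] [AddCommGroup V]
    [Module (IntegralCoeffRing k P R) V]
    (hproj : Module.Projective R
      (W ⧸ (algebraMap B (IntegralCoeffRing k P R) z • ⊤ : Submodule (IntegralCoeffRing k P R) W)))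
    (u : W →ₗ[IntegralCoeffRing k P R] V)
    (hu : ∀ v : V, algebraMap B (IntegralCoeffRing k P R) z • v = 0 → v = 0)
    (huz : ∀ w v, u w = algebraMap B (IntegralCoeffRing k P R) z • v →
      ∃ w', w = algebraMap B (IntegralCoeffRing k P R) z • w') :
    Module.Projective (IntegralCoeffRing k P R) W ∧ Function.Injective u := by
  let _ := Ideal.Quotient.field P
  have := Algebra.FormallyEtale.of_isSeparable k (B ⧸ P)
  obtain ⟨β, hβ⟩ := exists_section_coeff k R hz
  let _ : Algebra (R ⊗[k] (B ⧸ P)) (IntegralCoeffRing k P R) := β.toRingHom.toAlgebra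
  have : IsScalarTower R (R ⊗[k] (B ⧸ P)) (IntegralCoeffRing k P R) :=
    ⟨fun ξ b e => by
      change β (ξ • b) * e = ξ • (β b * e)
      rw [map_smul, smul_mul_assoc]⟩
  let _ : Module (R ⊗[k] (B ⧸ P)) W := Module.compHom W β.toRingHom
  have : IsScalarTower (R ⊗[k] (B ⧸ P)) (IntegralCoeffRing k P R) W :=
    ⟨fun b e w => mul_smul (β b) e w⟩
  have : IsScalarTower R (R ⊗[k] (B ⧸ P)) W := ⟨fun ξ b w => by
    change β (ξ • b) • w = ξ • (β b • w)
    rw [map_smul, smul_assoc]⟩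
  refine projective_of_projective_quotient (B := R ⊗[k] (B ⧸ P)) _ (mem_jacobson_coeff k R hz)
    hβ (eq_zero_of_forall_pow_dvd k R hz) ?_ u hu huz
  -- Projectivity of `W / zW` is given over `R` only. It passes up to `R ⊗ (B / P)`, which is
  -- unramified over `R` because the residue extension is separable.
  exact Algebra.FormallyUnramified.projective_of_restrictScalars R _ _

namespace DrinfeldModule

variable {k A R : Type*} [Field k] [Fintype k] [CommRing A] [Algebra k A]
    [CommRing R] [Algebra k R] {r : ℕ} {φ : DrinfeldModule k A R r}
    {R' : Type*} [CommRing R'] [Algebra k R'] [Algebra R R'] [IsScalarTower k R R']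

local notation "𝓔" => IntegralCoeffRing k φ.characteristicIdeal R'

section LowestTerm

variable {b : A} {j : ℕ} (hj : ∀ i < j, (φ.toAlgHom b).coeff i = 0)
  (hu : IsUnit (algebraMap R R' ((φ.toAlgHom b).coeff j)))
include hj

theorem smul_mem_vanishing_of_lowest (t : φ.Series R') :
    algebraMap A 𝓔 b • t ∈ φ.vanishing R' j := by
  intro i hi
  rw [Series.coeff_algebraMap_smul']
  exact seriesMul_apply_eq_zero (m := 0) (j := j) _ (by simp)
    (fun i hi => by rw [hj i hi, map_zero]) (by omega)

include hu

theorem exists_eq_smul_iff {s : φ.Series R'} :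
    (∃ t, s = algebraMap A 𝓔 b • t) ↔ s ∈ φ.vanishing R' j := by
  constructor
  · rintro ⟨t, rfl⟩
    exact smul_mem_vanishing_of_lowest hj t
  · intro h
    obtain ⟨t, ht⟩ := exists_seriesMul_eq (f := φ.toAlgHom b)
      (fun i hi => by rw [hj i hi, map_zero]) hu s.coeff h
    exact ⟨Series.mk φ t, Series.coeff_injective (by rw [Series.coeff_algebraMap_smul', Series.coeff_mk, ht])⟩

theorem eq_zero_of_smul_eq_zero_series {s : φ.Series R'} (h : algebraMap A 𝓔 b • s = 0) : s = 0 := by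
  apply Series.coeff_injective
  refine seriesMul_injective (f := φ.toAlgHom b) s.coeff
    (fun i hi => by rw [hj i hi, map_zero]) hu ?_
  rw [← Series.coeff_algebraMap_smul', h, map_zero]

/-- Truncation below degree `j` kills exactly the multiples of `b`. For `b = z` and `b = a` this
relates lowest degrees to the rank of the module of series. -/
theorem exists_series_quotient_equiv :
    Nonempty ((φ.Series R' ⧸ (algebraMap A 𝓔 b • ⊤ : Submodule 𝓔 (φ.Series R'))) ≃ₗ[R']
      (Fin j → R')) := by
  let f : φ.Series R' →ₗ[R'] Fin j → R' :=
    (LinearMap.funLeft R' R' (Fin.val : Fin j → ℕ)).comp Series.coeff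
  have hf : Function.Surjective f := fun g => ⟨Series.mk φ fun i => if h : i < j then g ⟨i, h⟩ else 0,
    by ext i; simp [f, Series.coeff_mk]⟩
  have hker : (algebraMap A 𝓔 b • ⊤ : Submodule 𝓔 (φ.Series R')).restrictScalars R' = LinearMap.ker f := by
    ext s
    rw [Submodule.restrictScalars_mem, Submodule.mem_smul_pointwise_iff_exists, LinearMap.mem_ker]
    have := exists_eq_smul_iff hj hu (s := s)
    simp only [Submodule.mem_top, true_and, eq_comm (b := s)]
    rw [this, mem_vanishing, funext_iff]
    exact ⟨fun h i => h i i.2, fun h i hi => h ⟨i, hi⟩⟩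
  exact ⟨(Submodule.Quotient.restrictScalarsEquiv R' _).symm.trans
    ((Submodule.quotEquivOfEq _ _ hker).trans (f.quotKerEquivOfSurjective hf))⟩

end LowestTerm

section Finite

variable [φ.characteristicIdeal.IsMaximal]
  {z : A} (hz : IsLocalGenerator φ.characteristicIdeal z)
  {j : ℕ} (hj : ∀ i < j, (φ.toAlgHom z).coeff i = 0)
  (hu : IsUnit (algebraMap R R' ((φ.toAlgHom z).coeff j)))
include hz hj hu

/-- Complete version of Nakayama: multiplication by `z` raises the order, so the series are
`z`-adically separated, and `1, τ, …, τ ^ (j - 1)` generate them modulo `z` over a `z`-complete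
ring. -/
theorem finite_series : Module.Finite 𝓔 (φ.Series R') := by
  let ζ := algebraMap A 𝓔 z
  let J : Ideal 𝓔 := Ideal.span {ζ}
  have : IsAdicComplete J 𝓔 := isAdicComplete_span_coeff k R' hz
  have : IsPrecomplete J (Fin j → 𝓔) := isPrecomplete_pi ζ
  have : IsHausdorff J (φ.Series R') := ⟨fun s hs => eq_of_forall_sub_mem fun m => by
    have := hs m
    rw [SModEq.sub_mem, Ideal.span_singleton_pow, Submodule.ideal_span_singleton_smul] at this
    obtain ⟨t, -, ht⟩ := (Submodule.mem_smul_pointwise_iff_exists _ _ _).1 this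
    rw [← ht, ← map_pow, IsScalarTower.algebraMap_apply A (A ⊗[k] R') 𝓔, algebraMap_smul_series,
      map_pow]
    exact pow_smul_mem_vanishing (Ideal.pow_mem_pow (Ideal.mem_map_of_mem _ hz.mem) m) t⟩
  let f : (Fin j → 𝓔) →ₗ[𝓔] φ.Series R' :=
    Fintype.linearCombination 𝓔 fun i => Series.mk φ (Pi.single (i : ℕ) 1)
  have hf : Function.Surjective (Submodule.mkQ (J • ⊤) ∘ₗ f) := by
    intro s
    obtain ⟨s, rfl⟩ := Submodule.mkQ_surjective _ s
    refine ⟨fun i => algebraMap R' 𝓔 (s.coeff i), ?_⟩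
    rw [LinearMap.comp_apply, ← sub_eq_zero, ← map_sub, Submodule.mkQ_apply,
      Submodule.Quotient.mk_eq_zero, Submodule.ideal_span_singleton_smul,
      Submodule.mem_smul_pointwise_iff_exists]
    have hs : f (fun i => algebraMap R' 𝓔 (s.coeff i)) - s ∈ φ.vanishing R' j := by
      intro i hi
      rw [Fintype.linearCombination_apply]
      simp only [algebraMap_smul]
      rw [map_sub, map_sum, Pi.sub_apply, sub_eq_zero, Finset.sum_apply,
        Finset.sum_eq_single (⟨i, hi⟩ : Fin j)]
      · rw [map_smul, Series.coeff_mk]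
        simp
      · intro l _ hl
        rw [map_smul, Series.coeff_mk, Pi.smul_apply,
          Pi.single_eq_of_ne (fun h => hl (Fin.ext h.symm)), smul_zero]
      · simp
    obtain ⟨t, ht⟩ := (exists_eq_smul_iff hj hu).2 hs
    exact ⟨t, trivial, ht.symm⟩
  exact Module.Finite.of_surjective f (surjective_of_mkQ_comp_surjective (I := J) hf)

/-- The series are `z`-torsion free with free quotient modulo `z`, so the projectivity criterion
applies with the identity as `u`. -/
theorem projective_series [FiniteDimensional k (A ⧸ φ.characteristicIdeal)] :
    Module.Projective 𝓔 (φ.Series R') := by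
  have := finite_series hz hj hu
  obtain ⟨e⟩ := exists_series_quotient_equiv hj hu
  refine (projective_of_projective_quotient_coeff k R' hz (.of_equiv e.symm) LinearMap.id
    (fun v hv => eq_zero_of_smul_eq_zero_series hj hu hv) fun w v h => ⟨v, h⟩).1

/-- `τ ^ j` generates `z S`. -/
theorem span_range_iterate_seriesFrob :
    Submodule.span 𝓔 (Set.range (φ.seriesFrob R')^[j]) =
      (algebraMap A 𝓔 z • ⊤ : Submodule 𝓔 (φ.Series R')) := by
  let ζ := algebraMap A 𝓔 z
  have hfin := finite_series hz hj hu
  have hcoeff : ∀ (n : ℕ) (s : φ.Series R') (i : ℕ), ((φ.seriesFrob R')^[n] s).coeff (i + n) =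
      s.coeff i ^ Fintype.card k ^ n := by
    intro n
    induction n with
    | zero => intro s i; simp
    | succ n ih =>
      intro s i
      rw [Function.iterate_succ_apply', Series.coeff_seriesFrob]
      change (((φ.seriesFrob R')^[n] s).coeff (i + n)) ^ _ = _
      rw [ih, ← pow_mul, pow_succ]
  have hvan : ∀ (n : ℕ) (s : φ.Series R'), (φ.seriesFrob R')^[n] s ∈ φ.vanishing R' n := by
    intro n s
    induction n with
    | zero => exact fun i hi => absurd hi (Nat.not_lt_zero i)
    | succ n ih =>
      rw [Function.iterate_succ_apply']
      exact seriesTauMap_mem_vanishing ih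
  have hmem : ∀ s, s ∈ (ζ • ⊤ : Submodule 𝓔 (φ.Series R')) ↔ s ∈ φ.vanishing R' j := by
    intro s
    rw [← exists_eq_smul_iff hj hu, Submodule.mem_smul_pointwise_iff_exists]
    simp only [Submodule.mem_top, true_and, eq_comm (b := s)]
    rfl
  apply le_antisymm
  · rw [Submodule.span_le]
    rintro _ ⟨s, rfl⟩
    exact (hmem _).2 (hvan j s)
  · refine Submodule.le_of_le_smul_of_le_jacobson_bot (I := Ideal.span {ζ})
      (Module.Finite.fg_top.map (DistribSMul.toLinearMap 𝓔 (φ.Series R') ζ)) ?_ ?_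
    · rw [Ideal.span_singleton_le_iff_mem]
      exact mem_jacobson_coeff k R' hz
    · intro s hs
      -- `τ ^ j` applied to the monomials `τ ^ i`, `i < j`, reproduces the coefficients of `s` in
      -- degrees `j` to `2j - 1`; coefficient `1` avoids `q`-th roots. The rest has order at least
      -- `2j`, so it is `z w` with `w` of order at least `j`, that is `w ∈ zS`, and Nakayama applies
      -- to `zS`.
      let t : φ.Series R' := ∑ i ∈ Finset.range j, algebraMap R' 𝓔 (s.coeff (i + j)) •
        (φ.seriesFrob R')^[j] (Series.mk φ (Pi.single i 1))
      rw [← add_sub_cancel t s]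
      refine Submodule.add_mem_sup (Submodule.sum_mem _ fun i _ => Submodule.smul_mem _ _
        (Submodule.subset_span ⟨_, rfl⟩)) ?_
      have ht : ∀ i < j + j, (s - t).coeff i = 0 := by
        intro i hi
        rw [map_sub, map_sum, Pi.sub_apply, sub_eq_zero, Finset.sum_apply]
        simp only [algebraMap_smul, map_smul, Pi.smul_apply]
        by_cases hij : i < j
        · rw [(hmem s).1 hs i hij, Finset.sum_eq_zero]
          intro l _
          rw [hvan j _ i hij, smul_zero]
        · obtain ⟨i, rfl⟩ := Nat.exists_eq_add_of_le' (not_lt.1 hij)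
          rw [Finset.sum_eq_single i]
          · rw [hcoeff, Series.coeff_mk, Pi.single_eq_same, one_pow, smul_eq_mul, mul_one]
          · intro l _ hl
            rw [hcoeff, Series.coeff_mk, Pi.single_eq_of_ne hl.symm, zero_pow (pow_ne_zero _
              Fintype.card_ne_zero), smul_zero]
          · intro h
            exact absurd (Finset.mem_range.2 (by omega)) h
      obtain ⟨w, hw⟩ := (exists_eq_smul_iff hj hu (s := s - t)).2 fun i hi => ht i (by omega)
      have hw' : w ∈ φ.vanishing R' j := eq_zero_of_seriesMul (f := φ.toAlgHom z) w.coeff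
        (fun i hi => by rw [hj i hi, map_zero]) hu fun i hi => by
          rw [← Series.coeff_algebraMap_smul', ← hw, ht i hi]
      rw [hw]
      exact Submodule.smul_mem_smul (Ideal.mem_span_singleton_self _) ((hmem w).2 hw')

end Finite

end DrinfeldModule
end

open Finset.HasAntidiagonal (antidiagonal mem_antidiagonal)

/-! ### Twisted polynomials over `R'` and finiteness of the motive -/

noncomputable section

attribute [local instance] Algebra.TensorProduct.rightAlgebra

namespace DrinfeldModule

variable {k A R : Type*} [Field k] [Fintype k] [CommRing A] [Algebra k A]
    [CommRing R] [Algebra k R] {r : ℕ} {φ : DrinfeldModule k A R r}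
    {R' : Type*} [CommRing R'] [Algebra k R'] [Algebra R R'] [IsScalarTower k R R']

local notation "𝓔" => IntegralCoeffRing k φ.characteristicIdeal R'

section Elliptic

variable {b : A} {D : ℕ} (hb : (φ.toAlgHom b).IsElliptic D)
include hb

theorem algebraMap_coeff_eq_zero_of_elliptic (i : ℕ) (hi : D < i) :
    algebraMap R R' ((φ.toAlgHom b).coeff i) = 0 := by
  rw [hb.2 i hi, map_zero]

theorem coe_algebraMap_smul (s : φ.finiteSupport R') :
    ((algebraMap A (A ⊗[k] R') b • s : φ.finiteSupport R') : φ.Series R').coeff =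
      seriesMul (s : φ.Series R').coeff (φ.toAlgHom b) :=
  Series.coeff_algebraMap_smul b (s : φ.Series R')

theorem eq_zero_of_coeff_smul_eq_zero {s : φ.finiteSupport R'}
    (h : ∀ i, D ≤ i → ((algebraMap A (A ⊗[k] R') b • s : φ.finiteSupport R') :
      φ.Series R').coeff i = 0) : s = 0 := by
  obtain ⟨N, hN⟩ := s.2
  apply Subtype.ext
  apply Series.coeff_injective
  refine eq_zero_of_seriesMul_of_le (f := φ.toAlgHom b) (D := D) (N := N) _
    (algebraMap_coeff_eq_zero_of_elliptic hb) (hb.1.map _) hN ?_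
  rw [coe_algebraMap_smul hb] at h
  exact h

theorem eq_zero_of_smul_eq_zero_finiteSupport {s : φ.finiteSupport R'}
    (h : algebraMap A (A ⊗[k] R') b • s = 0) : s = 0 :=
  eq_zero_of_coeff_smul_eq_zero hb fun i _ => by rw [h]; rfl

/-- Division with remainder: the leading coefficient of `φ_b` is a unit, so each class has a unique
representative of degree less than `D`. With `D = r deg(a)` this yields the rank of the lattice. -/
theorem exists_finiteSupport_quotient_equiv :
    Nonempty ((Fin D → R') ≃ₗ[R'] (φ.finiteSupport R' ⧸ (algebraMap A (A ⊗[k] R') b • ⊤ :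
      Submodule (A ⊗[k] R') (φ.finiteSupport R')))) := by
  let g : (Fin D → R') →ₗ[R'] φ.finiteSupport R' :=
    { toFun := fun t => ⟨Series.mk φ fun i => if h : i < D then t ⟨i, h⟩ else 0,
        ⟨D, fun i hi => by rw [Series.coeff_mk, dif_neg (by omega)]⟩⟩
      map_add' := fun t t' => Subtype.ext (Series.ext fun i => by
        change (if h : i < D then t ⟨i, h⟩ + t' ⟨i, h⟩ else 0) =
          (if h : i < D then t ⟨i, h⟩ else 0) + (if h : i < D then t' ⟨i, h⟩ else 0)
        split_ifs <;> simp)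
      map_smul' := fun ξ t => Subtype.ext (Series.ext fun i => by
        change (if h : i < D then ξ * t ⟨i, h⟩ else 0) = ξ * (if h : i < D then t ⟨i, h⟩ else 0)
        split_ifs <;> simp) }
  have hg : ∀ (t : Fin D → R') (i : ℕ), ((g t : φ.finiteSupport R') : φ.Series R').coeff i =
      if h : i < D then t ⟨i, h⟩ else 0 := fun _ _ => rfl
  let p := (algebraMap A (A ⊗[k] R') b • ⊤ : Submodule (A ⊗[k] R') (φ.finiteSupport R')).mkQ
  have hp : ∀ s, p s = 0 ↔ ∃ t, algebraMap A (A ⊗[k] R') b • t = s := fun s => by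
    rw [Submodule.mkQ_apply, Submodule.Quotient.mk_eq_zero,
      Submodule.mem_smul_pointwise_iff_exists]
    simp
  refine ⟨LinearEquiv.ofBijective ((p.restrictScalars R').comp g) ⟨?_, ?_⟩⟩
  · rw [injective_iff_map_eq_zero]
    intro t ht
    obtain ⟨q, hq⟩ := (hp _).1 ht
    have hq0 : q = 0 := eq_zero_of_coeff_smul_eq_zero hb fun i hi => by
      rw [hq, hg, dif_neg (by omega)]
    ext i
    have := hg t i
    rw [← hq, hq0, smul_zero, dif_pos i.2] at this
    exact this.symm
  · intro s
    obtain ⟨s, rfl⟩ := Submodule.mkQ_surjective _ s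
    obtain ⟨N, hN⟩ := s.2
    obtain ⟨q, t, hq, ht, h⟩ := exists_eq_seriesMul_add (f := φ.toAlgHom b)
      (s : φ.Series R').coeff (algebraMap_coeff_eq_zero_of_elliptic hb) (hb.1.map _) hN
    refine ⟨fun i => t i, ?_⟩
    change p _ = p s
    rw [eq_comm, ← sub_eq_zero, ← map_sub, hp]
    refine ⟨⟨Series.mk φ q, ⟨N, hq⟩⟩, Subtype.ext (Series.coeff_injective ?_)⟩
    rw [coe_algebraMap_smul hb]
    change seriesMul q (φ.toAlgHom b) = (s : φ.Series R').coeff - (g fun i => t i : φ.Series R').coeff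
    rw [h]
    ext i
    rw [Pi.sub_apply, hg, Pi.add_apply]
    split_ifs with hi
    · simp
    · simp [ht i (by omega)]

end Elliptic

/-- The natural map `A ⊗ R → A ⊗ R'`. -/
def tensorMap (k A : Type*) {R : Type*} (R' : Type*) [Field k] [CommRing A] [Algebra k A]
    [CommRing R] [Algebra k R] [CommRing R'] [Algebra k R'] [Algebra R R'] [IsScalarTower k R R'] :
    A ⊗[k] R →+* A ⊗[k] R' :=
  (Algebra.TensorProduct.map (AlgHom.id k A) (IsScalarTower.toAlgHom k R R')).toRingHom

theorem tensorMap_tmul (a : A) (ξ : R) :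
    tensorMap k A R' (a ⊗ₜ[k] ξ) = a ⊗ₜ[k] algebraMap R R' ξ := rfl

variable (R') in
theorem toSeries_smul (e : A ⊗[k] R) (m : φ.Motive) :
    Series.mk φ (toSeries R' (show TwistedPolynomial _ from e • m)) =
      tensorMap k A R' e • Series.mk φ (toSeries R' (show TwistedPolynomial _ from m)) := by
  induction e using TensorProduct.induction_on with
  | zero =>
    rw [zero_smul, map_zero, zero_smul]
    exact Series.ext fun i => map_zero (algebraMap R R')
  | add x y hx hy =>
    rw [add_smul, map_add, add_smul, ← hx, ← hy, ← map_add, ← toSeries_add]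
    rfl
  | tmul a ξ =>
    have h1 : (show TwistedPolynomial (FiniteField.frobeniusAlgHom k R) from (a ⊗ₜ[k] ξ) • m) =
      TwistedPolynomial.C _ ξ * (show TwistedPolynomial _ from m) * φ.toAlgHom a :=
      φ.motiveAction_tmul a ξ m
    have h2 : ∀ f : TwistedPolynomial (FiniteField.frobeniusAlgHom k R),
        toSeries R' (TwistedPolynomial.C _ ξ * f) = algebraMap R R' ξ • toSeries R' f := by
      intro f
      ext i
      have hc : ∀ i, TwistedPolynomial.coeff (TwistedPolynomial.C
          (FiniteField.frobeniusAlgHom k R) ξ) i = if 0 = i then ξ else 0 :=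
        fun i => TwistedPolynomial.coeff_monomial 0 i ξ
      rw [toSeries, TwistedPolynomial.coeff_mul, Finset.sum_eq_single (0, i)]
      · simp [hc, toSeries]
      · rintro ⟨x, y⟩ hxy hne
        rw [mem_antidiagonal] at hxy
        have hx : 0 ≠ x := by
          rintro rfl
          exact hne (by rw [Prod.mk.injEq]; exact ⟨rfl, by simpa using hxy⟩)
        rw [hc, if_neg hx, zero_mul]
      · simp
    rw [h1, tensorMap_tmul]
    apply Series.coeff_injective
    rw [Series.coeff_tmul_smul, Series.coeff_mk, Series.coeff_mk, toSeries_mul, h2, smul_seriesMul]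

variable (φ R') in
/-- The motive of `φ` inside the twisted polynomials over `R'`. -/
def motiveEmbed : φ.Motive →ₛₗ[(tensorMap k A R' : A ⊗[k] R →+* A ⊗[k] R')] φ.finiteSupport R' where
  toFun m := ⟨Series.mk φ (toSeries R' (show TwistedPolynomial _ from m)), by
    obtain ⟨N, hN⟩ := TwistedPolynomial.exists_coeff_eq_zero (show TwistedPolynomial _ from m)
    exact ⟨N, fun i hi => by rw [Series.coeff_mk, toSeries, hN i hi, map_zero]⟩⟩
  map_add' m n := Subtype.ext (by
    rw [Submodule.coe_add, ← map_add, ← toSeries_add]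
    rfl)
  map_smul' e m := Subtype.ext (toSeries_smul R' e m)

theorem coeff_motiveEmbed (m : φ.Motive) (i : ℕ) :
    (φ.motiveEmbed R' m : φ.Series R').coeff i =
      algebraMap R R' ((show TwistedPolynomial _ from m).coeff i) := rfl

variable (φ) in
/-- The monomials of the motive. -/
def motiveMonomial (i : ℕ) (ξ : R) : φ.Motive := TwistedPolynomial.monomial _ i ξ

theorem one_tmul_smul_motiveMonomial (i : ℕ) (ξ : R) :
    ((1 : A) ⊗ₜ[k] ξ) • φ.motiveMonomial i 1 = φ.motiveMonomial i ξ := by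
  refine (φ.motiveAction_tmul 1 ξ _).trans ?_
  rw [map_one, mul_one]
  exact (TwistedPolynomial.monomial_mul_monomial 0 i ξ 1).trans (by simp; rfl)

theorem span_motiveMonomial : Submodule.span (A ⊗[k] R) (Set.range fun i => φ.motiveMonomial i 1) = ⊤ := by
  rw [eq_top_iff]
  intro m _
  have key : ∀ f : TwistedPolynomial (FiniteField.frobeniusAlgHom k R),
      (show φ.Motive from f) ∈
        Submodule.span (A ⊗[k] R) (Set.range fun i => φ.motiveMonomial i 1) := by
    intro f
    induction f using TwistedPolynomial.induction_on with
    | zero => exact zero_mem _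
    | add f g hf hg => exact add_mem hf hg
    | mono i ξ =>
      have := Submodule.smul_mem _ ((1 : A) ⊗ₜ[k] ξ)
        (Submodule.subset_span (R := A ⊗[k] R) (Set.mem_range_self
          (f := fun i => φ.motiveMonomial i 1) i))
      rw [one_tmul_smul_motiveMonomial] at this
      exact this
  exact key m

theorem algebraMap_smul_motiveMonomial {b : A} {D : ℕ} (hb : (φ.toAlgHom b).IsElliptic D) (n : ℕ) :
    algebraMap A (A ⊗[k] R) b • φ.motiveMonomial n 1 = ∑ l ∈ Finset.range (D + 1),
      φ.motiveMonomial (n + l) ((FiniteField.frobeniusAlgHom k R ^ n) ((φ.toAlgHom b).coeff l)) := by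
  have h1 : (show TwistedPolynomial (FiniteField.frobeniusAlgHom k R) from
      algebraMap A (A ⊗[k] R) b • φ.motiveMonomial n 1) =
      TwistedPolynomial.monomial _ n 1 * φ.toAlgHom b := by
    refine (φ.motiveAction_tmul b 1 _).trans ?_
    rw [map_one]
    exact congrArg (· * φ.toAlgHom b) (one_mul (TwistedPolynomial.monomial _ n (1 : R)))
  refine h1.trans ?_
  conv_lhs => rw [TwistedPolynomial.eq_sum_monomial (φ.toAlgHom b) (D + 1) fun i hi => hb.2 i hi]
  rw [Finset.mul_sum]
  refine Finset.sum_congr rfl fun l _ => ?_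
  rw [TwistedPolynomial.monomial_mul_monomial, one_mul]
  rfl

/-- The motive of a Drinfeld module is finitely generated. -/
theorem finite_motive {b : A} {D : ℕ} (hD : 0 < D) (hb : (φ.toAlgHom b).IsElliptic D) :
    Module.Finite (A ⊗[k] R) φ.Motive := by
  let X := Submodule.span (A ⊗[k] R) (Set.range fun i : Fin D => φ.motiveMonomial i 1)
  suffices h : X = ⊤ by
    exact ⟨h ▸ Submodule.fg_span (Set.finite_range _)⟩
  have hmem : ∀ i, φ.motiveMonomial i 1 ∈ X → ∀ ξ, φ.motiveMonomial i ξ ∈ X := by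
    intro i hi ξ
    rw [← one_tmul_smul_motiveMonomial]
    exact Submodule.smul_mem _ _ hi
  have hmono : ∀ i, φ.motiveMonomial i 1 ∈ X := by
    intro i
    induction i using Nat.strong_induction_on with
    | _ i ih =>
      by_cases hi : i < D
      · exact Submodule.subset_span ⟨⟨i, hi⟩, rfl⟩
      · obtain ⟨n, rfl⟩ := Nat.exists_eq_add_of_le' (not_lt.1 hi)
        -- The product `τ ^ n φ_b` has unit leading coefficient, so `τ ^ (n + D)` is a combination
        -- of `b τ ^ n` and monomials of lower degree.
        have h := algebraMap_smul_motiveMonomial hb n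
        rw [Finset.sum_range_succ, ← sub_eq_iff_eq_add'] at h
        obtain ⟨v, hv⟩ := (hb.1.map (FiniteField.frobeniusAlgHom k R ^ n)).exists_left_inv
        have h2 : φ.motiveMonomial (n + D) 1 = ((1 : A) ⊗ₜ[k] v) • φ.motiveMonomial (n + D)
            ((FiniteField.frobeniusAlgHom k R ^ n) ((φ.toAlgHom b).coeff D)) := by
          rw [← one_tmul_smul_motiveMonomial (ξ := (FiniteField.frobeniusAlgHom k R ^ n) _),
            smul_smul, Algebra.TensorProduct.tmul_mul_tmul, one_mul, hv,
            one_tmul_smul_motiveMonomial]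
        rw [h2, ← h]
        refine Submodule.smul_mem _ _ (sub_mem (Submodule.smul_mem _ _ (ih n (by omega)))
          (Submodule.sum_mem _ fun l hl => hmem _ (ih _ ?_) _))
        have := Finset.mem_range.1 hl
        omega
  rw [eq_top_iff, ← span_motiveMonomial, Submodule.span_le]
  rintro _ ⟨i, rfl⟩
  exact hmono i

end DrinfeldModule
end

/-! ### The integral lattice of the motive -/

noncomputable section

attribute [local instance] Algebra.TensorProduct.rightAlgebra

/-- The linear map out of a base change induced by a semilinear map. -/
def BaseChange.liftSemilinear {E E' M N : Type*} [CommRing E] [CommRing E'] {f : E →+* E'}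
    [AddCommGroup M] [Module E M] [AddCommGroup N] [Module E' N] (g : M →ₛₗ[f] N) :
    BaseChange f M →ₗ[E'] N :=
  { BaseChange.lift (f := f)
      (AddMonoidHom.mk' (fun e => (AddMonoidHom.mk' (fun m => e • g m) (by simp)))
        (by intro a b; ext m; simp [add_smul]))
      (by
        intro e e' m
        change (f e * e') • g m = e' • g (e • m)
        rw [map_smulₛₗ, mul_comm, mul_smul]) with
    map_smul' := by
      intro e x
      induction x using BaseChange.induction_on with
      | zero => simp
      | add x y hx hy => simp_all [smul_add]
      | tmul e' m => exact mul_smul e e' (g m) }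

theorem BaseChange.liftSemilinear_tmul {E E' M N : Type*} [CommRing E] [CommRing E'] {f : E →+* E'}
    [AddCommGroup M] [Module E M] [AddCommGroup N] [Module E' N] (g : M →ₛₗ[f] N) (e : E') (m : M) :
    BaseChange.liftSemilinear g (BaseChange.tmul f e m) = e • g m := rfl

namespace DrinfeldModule

variable {k A R : Type*} [Field k] [Fintype k] [CommRing A] [Algebra k A]
    [CommRing R] [Algebra k R] {r : ℕ} {φ : DrinfeldModule k A R r}
    {R' : Type*} [CommRing R'] [Algebra k R'] [Algebra R R'] [IsScalarTower k R R']

local notation "𝓘" => φ.characteristicIdeal.map (algebraMap A (A ⊗[k] R'))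
local notation "𝓔" => IntegralCoeffRing k φ.characteristicIdeal R'

/-- Up to a factor outside `℘`, the submodules `𝓘 ^ m M` and `z ^ m M` agree. This replaces
localization at `℘`, which would change the module. -/
theorem exists_smul_pow_smul_top [φ.characteristicIdeal.IsMaximal] {z : A}
    (hz : IsLocalGenerator φ.characteristicIdeal z) (m : ℕ) {M : Type*} [AddCommGroup M]
    [Module (A ⊗[k] R') M] : ∃ x ∉ φ.characteristicIdeal, ∀ s ∈ (𝓘 ^ m • ⊤ : Submodule (A ⊗[k] R') M),
      ∃ t, algebraMap A (A ⊗[k] R') x • s = algebraMap A (A ⊗[k] R') z ^ m • t := by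
  obtain ⟨x, hx, h⟩ := hz.exists_dvd_pow m
  refine ⟨x, hx, fun s hs => ?_⟩
  rw [← Ideal.map_pow] at hs
  induction hs using Submodule.smul_induction_on' with
  | smul c hc s _ =>
    induction hc using Submodule.span_induction generalizing s with
    | mem c hc =>
      obtain ⟨w, hw, rfl⟩ := hc
      obtain ⟨y, hy⟩ := h w hw
      exact ⟨algebraMap A _ y • s, by rw [smul_smul, smul_smul, ← map_mul, hy, map_mul, map_pow]⟩
    | zero => exact ⟨0, by simp⟩
    | add c d _ _ hc hd =>
      obtain ⟨t, ht⟩ := hc s trivial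
      obtain ⟨t', ht'⟩ := hd s trivial
      exact ⟨t + t', by rw [add_smul, smul_add, ht, ht', smul_add]⟩
    | smul c d _ hd =>
      obtain ⟨t, ht⟩ := hd s trivial
      exact ⟨c • t, by rw [smul_assoc, smul_comm, ht, smul_comm]⟩
  | add s _ s' _ hs hs' =>
    obtain ⟨t, ht⟩ := hs
    obtain ⟨t', ht'⟩ := hs'
    exact ⟨t + t', by rw [smul_add, ht, ht', smul_add]⟩

theorem mem_pow_smul_top_of_smul_mem [φ.characteristicIdeal.IsMaximal] {x : A}
    (hx : x ∉ φ.characteristicIdeal) {m : ℕ} {M : Type*} [AddCommGroup M]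
    [Module (A ⊗[k] R') M] {s : M}
    (hs : algebraMap A (A ⊗[k] R') x • s ∈ (𝓘 ^ m • ⊤ : Submodule (A ⊗[k] R') M)) :
    s ∈ (𝓘 ^ m • ⊤ : Submodule (A ⊗[k] R') M) := by
  obtain ⟨y, i, hi, hyi⟩ := Ideal.IsMaximal.exists_inv (I := φ.characteristicIdeal) inferInstance hx
  have h1 : (1 - y * x) ^ m ∈ φ.characteristicIdeal ^ m :=
    Ideal.pow_mem_pow (by rwa [← hyi, add_sub_cancel_left]) m
  obtain ⟨t, ht⟩ : y * x ∣ 1 - (1 - y * x) ^ m := by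
    have := sub_dvd_pow_sub_pow (1 : A) (1 - y * x) m
    rwa [one_pow, sub_sub_cancel] at this
  have h2 : (1 : A) = (1 - y * x) ^ m + y * t * x := by linear_combination ht
  have h3 : s = algebraMap A (A ⊗[k] R') ((1 - y * x) ^ m) • s +
      algebraMap A (A ⊗[k] R') (y * t) • algebraMap A (A ⊗[k] R') x • s := by
    rw [smul_smul, ← map_mul, ← add_smul, ← map_add, ← h2, map_one, one_smul]
  rw [h3]
  refine add_mem (Submodule.smul_mem_smul ?_ trivial) (Submodule.smul_mem _ _ hs)
  rw [← Ideal.map_pow]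
  exact Ideal.mem_map_of_mem _ h1

theorem eval_algebraMap_smul (m : ℕ) {M : Type*} [AddCommGroup M] [Module (A ⊗[k] R') M]
    (d : A ⊗[k] R') (v : AdicCompletion 𝓘 M) :
    AdicCompletion.eval 𝓘 M m (algebraMap (A ⊗[k] R') 𝓔 d • v) =
      d • AdicCompletion.eval 𝓘 M m v := by
  rw [algebraMap_smul, map_smul]

/-- If `z s ∈ 𝓘 ^ (n + 1) M`, then up to a factor outside `℘` it is `z ^ (n + 1) t`; cancelling one
`z` puts `s` in `𝓘 ^ n M`. One level is lost, so level `n` is controlled by the representative at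
level `n + 1`. -/
theorem eq_zero_of_smul_eq_zero_adicCompletion [φ.characteristicIdeal.IsMaximal] {z : A}
    (hz : IsLocalGenerator φ.characteristicIdeal z) {M : Type*} [AddCommGroup M]
    [Module (A ⊗[k] R') M] (hM : ∀ s : M, algebraMap A (A ⊗[k] R') z • s = 0 → s = 0)
    (v : AdicCompletion 𝓘 M) (hv : algebraMap A 𝓔 z • v = 0) : v = 0 := by
  obtain ⟨s, rfl⟩ := AdicCompletion.mk_surjective _ _ v
  refine AdicCompletion.ext fun n => ?_
  have h1 : AdicCompletion.eval 𝓘 M (n + 1) (algebraMap A 𝓔 z • AdicCompletion.mk 𝓘 M s) = 0 := by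
    rw [hv, map_zero]
  rw [IsScalarTower.algebraMap_apply A (A ⊗[k] R') 𝓔, eval_algebraMap_smul] at h1
  have h2 : algebraMap A (A ⊗[k] R') z • s (n + 1) ∈
      (𝓘 ^ (n + 1) • ⊤ : Submodule (A ⊗[k] R') M) := (Submodule.Quotient.mk_eq_zero _).1 h1
  obtain ⟨x, hx, h⟩ := exists_smul_pow_smul_top hz (R' := R') (n + 1) (M := M)
  obtain ⟨t, ht⟩ := h _ h2
  have h3 : algebraMap A (A ⊗[k] R') x • s (n + 1) = algebraMap A (A ⊗[k] R') z ^ n • t := by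
    refine sub_eq_zero.1 (hM _ ?_)
    rw [smul_sub, smul_smul _ _ t, ← pow_succ', ← ht, smul_comm, sub_self]
  have h4 : s (n + 1) ∈ (𝓘 ^ n • ⊤ : Submodule (A ⊗[k] R') M) := by
    refine mem_pow_smul_top_of_smul_mem hx ?_
    rw [h3]
    exact Submodule.smul_mem_smul (Ideal.pow_mem_pow (Ideal.mem_map_of_mem _ hz.mem) n) trivial
  refine (AdicCompletion.AdicCauchySequence.mk_eq_mk (Nat.le_succ n) s).symm.trans ?_
  exact (Submodule.Quotient.mk_eq_zero _).2 h4

section Lattice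

/-- The natural homomorphism `A ⊗ R → A_P ⊗̂ R'`. -/
def toIntegralCoeffRing (P : Ideal A) (R' : Type*) [CommRing R'] [Algebra k R'] [Algebra R R']
    [IsScalarTower k R R'] : A ⊗[k] R →+* IntegralCoeffRing k P R' :=
  (algebraMap (A ⊗[k] R') (IntegralCoeffRing k P R')).comp (tensorMap k A R')

theorem toIntegralCoeffRing_partialFrobenius (P : Ideal A) (x : A ⊗[k] R) :
    toIntegralCoeffRing P R' (partialFrobenius k R A x) =
      integralSigma k P R' (toIntegralCoeffRing P R' x) := by
  change algebraMap (A ⊗[k] R') (IntegralCoeffRing k P R') (tensorMap k A R' _) =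
    integralSigma k P R' (algebraMap (A ⊗[k] R') (IntegralCoeffRing k P R') _)
  rw [integralSigma_algebraMap]
  congr 1
  induction x using TensorProduct.induction_on with
  | zero => simp
  | add x y hx hy => simp only [map_add, hx, hy]
  | tmul a ξ => simp [partialFrobenius, tensorMap_tmul]

variable (φ R') in
/-- The natural lattice in the local isocrystal of `φ` at the characteristic. -/
abbrev LocalLattice : Type _ :=
  BaseChange (toIntegralCoeffRing φ.characteristicIdeal R' : A ⊗[k] R →+* 𝓔) φ.Motive

variable (φ R') in
/-- The action of `τ` on the lattice. -/
def latticeTau : φ.LocalLattice R' →ₛₗ[integralSigma k φ.characteristicIdeal R'] φ.LocalLattice R' :=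
  baseChangeTau (toIntegralCoeffRing φ.characteristicIdeal R')
    (toIntegralCoeffRing_partialFrobenius _) φ.motiveTau

instance : Module R' (φ.LocalLattice R') := Module.compHom _ (algebraMap R' 𝓔)

instance : IsScalarTower R' 𝓔 (φ.LocalLattice R') where
  smul_assoc ξ e w := by
    rw [Algebra.smul_def, mul_smul]
    rfl

variable (φ R') in
/-- The image of `m` in the lattice. -/
def toLattice : φ.Motive →ₛₗ[(toIntegralCoeffRing φ.characteristicIdeal R' : A ⊗[k] R →+* 𝓔)]
    φ.LocalLattice R' where
  toFun m := BaseChange.tmul _ 1 m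
  map_add' := BaseChange.tmul_add _ 1
  map_smul' e m := by rw [BaseChange.tmul_smul, BaseChange.smul_tmul']

theorem latticeTau_toLattice (m : φ.Motive) :
    φ.latticeTau R' (φ.toLattice R' m) = φ.toLattice R' (φ.motiveTau m) :=
  congrArg (fun e => BaseChange.tmul _ e (φ.motiveTau m)) (map_one (integralSigma k _ R'))

theorem lattice_induction {p : φ.LocalLattice R' → Prop} (w : φ.LocalLattice R') (zero : p 0)
    (smul : ∀ (e : 𝓔) m, p (e • φ.toLattice R' m)) (add : ∀ x y, p x → p y → p (x + y)) : p w := by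
  induction w using BaseChange.induction_on with
  | zero => exact zero
  | add x y hx hy => exact add x y hx hy
  | tmul e m =>
    rw [BaseChange.tmul_eq_smul]
    exact smul e m

/-- The coefficients of a twisted polynomial. -/
def finiteSupportEquiv : φ.finiteSupport R' ≃ₗ[R'] ℕ →₀ R' where
  toFun s := Finsupp.ofSupportFinite (s : φ.Series R').coeff (by
    obtain ⟨N, hN⟩ := s.2
    refine (Finset.range N).finite_toSet.subset fun i hi => ?_
    rw [Finset.mem_coe, Finset.mem_range]
    by_contra h
    exact hi (hN i (not_lt.1 h)))
  map_add' s t := by ext; rfl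
  map_smul' c s := by ext; rfl
  invFun f := ⟨Series.mk φ f, ⟨f.support.sup id + 1, fun i hi => by
    rw [Series.coeff_mk]
    by_contra h
    have : i ≤ f.support.sup id := Finset.le_sup (f := id) (Finsupp.mem_support_iff.2 h)
    omega⟩⟩
  left_inv s := rfl
  right_inv f := by ext; rfl

theorem motiveEmbed_motiveMonomial (i : ℕ) (ξ : R) :
    φ.motiveEmbed R' (φ.motiveMonomial i ξ) =
      finiteSupportEquiv.symm (Finsupp.single i (algebraMap R R' ξ)) := by
  refine Subtype.ext (Series.ext fun l => ?_)
  rw [coeff_motiveEmbed]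
  refine (congrArg _ (TwistedPolynomial.coeff_monomial i l ξ)).trans ?_
  change _ = Finsupp.single i (algebraMap R R' ξ) l
  rw [Finsupp.single_apply]
  split_ifs <;> simp

variable (φ R') in
/-- The map from twisted polynomials over `R'` to the lattice, `ξ τ ^ i ↦ ξ ⊗ τ ^ i`. -/
def polyToLattice : φ.finiteSupport R' →ₗ[R'] φ.LocalLattice R' :=
  (Finsupp.linearCombination R' fun i => φ.toLattice R' (φ.motiveMonomial i 1)).comp
    (finiteSupportEquiv (φ := φ) (R' := R')).toLinearMap

theorem polyToLattice_single (i : ℕ) (ξ : R') :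
    φ.polyToLattice R' (finiteSupportEquiv.symm (Finsupp.single i ξ)) =
      ξ • φ.toLattice R' (φ.motiveMonomial i 1) := by
  rw [polyToLattice, LinearMap.comp_apply, LinearEquiv.coe_coe, LinearEquiv.apply_symm_apply,
    Finsupp.linearCombination_single]

theorem finiteSupport_induction {p : φ.finiteSupport R' → Prop} (s : φ.finiteSupport R')
    (zero : p 0) (single : ∀ i ξ, p (finiteSupportEquiv.symm (Finsupp.single i ξ)))
    (add : ∀ x y, p x → p y → p (x + y)) : p s := by
  rw [← finiteSupportEquiv.symm_apply_apply s]
  induction finiteSupportEquiv s using Finsupp.induction_linear with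
  | zero => rwa [map_zero]
  | add x y hx hy => rw [map_add]; exact add _ _ hx hy
  | single i ξ => exact single i ξ

theorem motive_induction {p : φ.Motive → Prop} (m : φ.Motive) (zero : p 0)
    (mono : ∀ i ξ, p (φ.motiveMonomial i ξ)) (add : ∀ x y, p x → p y → p (x + y)) : p m :=
  TwistedPolynomial.induction_on (p := p) m zero mono add

theorem polyToLattice_motiveEmbed (m : φ.Motive) :
    φ.polyToLattice R' (φ.motiveEmbed R' m) = φ.toLattice R' m := by
  induction m using motive_induction with
  | zero => rw [map_zero, map_zero, map_zero]
  | add f g hf hg => rw [map_add, map_add, hf, hg, map_add]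
  | mono i ξ =>
    rw [motiveEmbed_motiveMonomial, polyToLattice_single]
    conv_rhs => rw [← one_tmul_smul_motiveMonomial, map_smulₛₗ]
    rfl

/-- The map is defined `R'`-linearly on monomials. Compatibility with `A` can be tested on `τ ^ i`,
which comes from the motive over `R`, where it is known. -/
theorem polyToLattice_smul (d : A ⊗[k] R') (s : φ.finiteSupport R') :
    φ.polyToLattice R' (d • s) = algebraMap (A ⊗[k] R') 𝓔 d • φ.polyToLattice R' s := by
  have hA : ∀ (a : A) (s : φ.finiteSupport R'), φ.polyToLattice R' (algebraMap A (A ⊗[k] R') a • s) =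
      algebraMap A 𝓔 a • φ.polyToLattice R' s := by
    intro a s
    induction s using finiteSupport_induction with
    | zero => simp
    | add x y hx hy => rw [smul_add, map_add, map_add, smul_add, hx, hy]
    | single i ξ =>
      have h1 : finiteSupportEquiv.symm (Finsupp.single i ξ) =
          ξ • φ.motiveEmbed R' (φ.motiveMonomial i 1) := by
        rw [motiveEmbed_motiveMonomial, map_one, ← map_smul, Finsupp.smul_single, smul_eq_mul, mul_one]
      have h2 : algebraMap A (A ⊗[k] R') a = tensorMap k A R' (algebraMap A (A ⊗[k] R) a) := by
        rw [Algebra.TensorProduct.algebraMap_apply, Algebra.TensorProduct.algebraMap_apply,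
          tensorMap_tmul, map_one]
      have h3 : algebraMap A (A ⊗[k] R') a • φ.motiveEmbed R' (φ.motiveMonomial i 1) =
          φ.motiveEmbed R' (algebraMap A (A ⊗[k] R) a • φ.motiveMonomial i 1) := by
        rw [(φ.motiveEmbed R').map_smulₛₗ, h2]
      rw [h1, smul_comm, h3, (φ.polyToLattice R').map_smul, (φ.polyToLattice R').map_smul,
        polyToLattice_motiveEmbed, polyToLattice_motiveEmbed, (φ.toLattice R').map_smulₛₗ,
        smul_comm (algebraMap A 𝓔 a)]
      congr 1
      rw [IsScalarTower.algebraMap_apply A (A ⊗[k] R') 𝓔, h2]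
      rfl
  induction d using TensorProduct.induction_on with
  | zero => simp
  | add x y hx hy => rw [add_smul, map_add, map_add, add_smul, hx, hy]
  | tmul a ξ =>
    have h : a ⊗ₜ[k] ξ = algebraMap R' (A ⊗[k] R') ξ * algebraMap A (A ⊗[k] R') a := by
      change _ = (1 ⊗ₜ ξ) * (a ⊗ₜ 1)
      rw [Algebra.TensorProduct.tmul_mul_tmul, one_mul, mul_one]
    have h' : algebraMap (A ⊗[k] R') 𝓔 (a ⊗ₜ[k] ξ) = algebraMap R' 𝓔 ξ * algebraMap A 𝓔 a := by
      rw [h, map_mul, ← IsScalarTower.algebraMap_apply, ← IsScalarTower.algebraMap_apply]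
    rw [h', h, mul_smul, algebraMap_smul, (φ.polyToLattice R').map_smul, hA, mul_smul]
    rfl

end Lattice

end DrinfeldModule
end

/-! ### The lattice modulo powers of `z`, and its projectivity -/

noncomputable section

attribute [local instance] Algebra.TensorProduct.rightAlgebra

theorem nonempty_quotient_equiv {S D M N : Type*} [CommRing S] [CommRing D] [Algebra S D]
    [AddCommGroup M] [Module D M] [Module S M] [IsScalarTower S D M] [AddCommGroup N] [Module S N]
    (p : Submodule D M) (f : M →ₗ[S] N) (hf : Function.Surjective f)
    (hker : ∀ s, s ∈ p ↔ f s = 0) : Nonempty ((M ⧸ p) ≃ₗ[S] N) :=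
  have h : p.restrictScalars S = LinearMap.ker f := by
    ext s
    exact hker s
  ⟨(Submodule.Quotient.restrictScalarsEquiv S p).symm.trans
    ((Submodule.quotEquivOfEq _ _ h).trans (f.quotKerEquivOfSurjective hf))⟩

theorem mkQ_smul_top_eq_zero_iff {E W : Type*} [CommRing E] [AddCommGroup W] [Module E W] (c : E)
    (w : W) : (c • ⊤ : Submodule E W).mkQ w = 0 ↔ ∃ v, w = c • v := by
  rw [Submodule.mkQ_apply, Submodule.Quotient.mk_eq_zero, Submodule.mem_smul_pointwise_iff_exists]
  simp [eq_comm]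

/-- Multiplication by `c` defines a map `M / J → M / Z` that is a section of the projection. It is
used with `Z = zM`, `J = 𝓘 M` and `c` congruent to `1` modulo `℘`. -/
theorem projective_quotient_of_retract {S D M : Type*} [CommRing S] [CommRing D] [Algebra S D]
    [AddCommGroup M] [Module D M] [Module S M] [IsScalarTower S D M] (Z J : Submodule D M)
    (hZJ : Z ≤ J) (c : D) (hc : ∀ s ∈ J, c • s ∈ Z) (hc' : ∀ s, c • s - s ∈ J)
    (hZ : Module.Projective S (M ⧸ Z)) : Module.Projective S (M ⧸ J) := by
  let p : (M ⧸ Z) →ₗ[D] (M ⧸ J) := Submodule.factor hZJ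
  let g : (M ⧸ J) →ₗ[D] (M ⧸ Z) := Submodule.mapQ J Z (c • LinearMap.id) fun s hs => by
    rw [Submodule.mem_comap]
    exact hc s hs
  refine Module.Projective.of_split (g.restrictScalars S) (p.restrictScalars S) ?_
  ext s
  obtain ⟨s, rfl⟩ := Submodule.mkQ_surjective _ s
  change J.mkQ (c • s) = J.mkQ s
  rw [← sub_eq_zero, ← map_sub, Submodule.mkQ_apply, Submodule.Quotient.mk_eq_zero]
  exact hc' s

namespace DrinfeldModule

variable {k A R : Type*} [Field k] [Fintype k] [CommRing A] [Algebra k A]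
    [CommRing R] [Algebra k R] {r : ℕ} {φ : DrinfeldModule k A R r}
    {R' : Type*} [CommRing R'] [Algebra k R'] [Algebra R R'] [IsScalarTower k R R']

local notation "𝓘" => φ.characteristicIdeal.map (algebraMap A (A ⊗[k] R'))
local notation "𝓔" => IntegralCoeffRing k φ.characteristicIdeal R'

variable (φ R') in
/-- The map from the lattice to the completion of the twisted polynomials over `R'`. -/
def latticeToCompletion : φ.LocalLattice R' →ₗ[𝓔] AdicCompletion 𝓘 (φ.finiteSupport R') :=
  BaseChange.liftSemilinear
    { toFun := fun m => AdicCompletion.of 𝓘 (φ.finiteSupport R') (φ.motiveEmbed R' m)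
      map_add' := fun m n => by rw [map_add, map_add]
      map_smul' := fun e m => by
        rw [map_smulₛₗ, map_smul, ← algebraMap_smul 𝓔]
        rfl }

theorem latticeToCompletion_toLattice (m : φ.Motive) :
    φ.latticeToCompletion R' (φ.toLattice R' m) =
      AdicCompletion.of 𝓘 (φ.finiteSupport R') (φ.motiveEmbed R' m) :=
  (BaseChange.liftSemilinear_tmul _ 1 m).trans (one_smul 𝓔 _)

theorem finiteSupportEquiv_symm_single (i : ℕ) (ξ : R') :
    (finiteSupportEquiv (φ := φ)).symm (Finsupp.single i ξ) =
      algebraMap R' (A ⊗[k] R') ξ • φ.motiveEmbed R' (φ.motiveMonomial i 1) := by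
  rw [algebraMap_smul, motiveEmbed_motiveMonomial, map_one, ← map_smul, Finsupp.smul_single,
    smul_eq_mul, mul_one]

theorem latticeToCompletion_polyToLattice (s : φ.finiteSupport R') :
    φ.latticeToCompletion R' (φ.polyToLattice R' s) =
      AdicCompletion.of 𝓘 (φ.finiteSupport R') s := by
  induction s using finiteSupport_induction with
  | zero => simp
  | add x y hx hy => rw [map_add, map_add, map_add, hx, hy]
  | single i ξ =>
    rw [finiteSupportEquiv_symm_single, polyToLattice_smul, polyToLattice_motiveEmbed, map_smul,
      map_smul, latticeToCompletion_toLattice, algebraMap_smul]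

section Uniformizer

variable [φ.characteristicIdeal.IsMaximal] {z : A}
  (hz : IsLocalGenerator φ.characteristicIdeal z)
include hz

/-- Density: modulo `z ^ m`, the coefficients in `E` may be replaced by elements of `A ⊗ R'`, which
act on polynomials. -/
theorem exists_eq_polyToLattice_add (m : ℕ) (w : φ.LocalLattice R') :
    ∃ s w', w = φ.polyToLattice R' s + algebraMap A 𝓔 z ^ m • w' := by
  induction w using lattice_induction with
  | zero => exact ⟨0, 0, by simp⟩
  | add x y hx hy =>
    obtain ⟨s, w, rfl⟩ := hx
    obtain ⟨t, v, rfl⟩ := hy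
    exact ⟨s + t, w + v, by rw [map_add, smul_add, add_add_add_comm]⟩
  | smul e n =>
    obtain ⟨d, e', rfl⟩ := exists_eq_algebraMap_add k R' hz m e
    exact ⟨d • φ.motiveEmbed R' n, e' • φ.toLattice R' n, by
      rw [polyToLattice_smul, polyToLattice_motiveEmbed, add_smul, mul_smul]⟩

theorem mem_of_eq_smul_adicCompletion (m : ℕ) {M : Type*} [AddCommGroup M]
    [Module (A ⊗[k] R') M] (s : M) (v : AdicCompletion 𝓘 M)
    (h : AdicCompletion.of 𝓘 M s = algebraMap A 𝓔 z ^ m • v) :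
    s ∈ (𝓘 ^ m • ⊤ : Submodule (A ⊗[k] R') M) := by
  rw [← map_pow, IsScalarTower.algebraMap_apply A (A ⊗[k] R') 𝓔] at h
  have h2 := congrArg (AdicCompletion.eval 𝓘 M m) h
  rw [eval_algebraMap_smul] at h2
  obtain ⟨t, ht⟩ := Submodule.mkQ_surjective _ (AdicCompletion.eval 𝓘 M m v)
  rw [← ht, ← map_smul] at h2
  rw [← Submodule.Quotient.mk_eq_zero]
  refine h2.trans ((Submodule.Quotient.mk_eq_zero _).2 (Submodule.smul_mem_smul ?_ trivial))
  rw [map_pow]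
  exact Ideal.pow_mem_pow (Ideal.mem_map_of_mem _ hz.mem) m

/-- Divisibility in the lattice is tested in the completion of the polynomials, whose level `m`
detects `𝓘 ^ m`. Injectivity of the map to the completion is not yet known and not needed. -/
theorem exists_polyToLattice_eq_smul_iff (m : ℕ) (s : φ.finiteSupport R') :
    (∃ w, φ.polyToLattice R' s = algebraMap A 𝓔 z ^ m • w) ↔
      s ∈ (𝓘 ^ m • ⊤ : Submodule (A ⊗[k] R') (φ.finiteSupport R')) := by
  constructor
  · rintro ⟨w, hw⟩
    have h := congrArg (φ.latticeToCompletion R') hw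
    rw [latticeToCompletion_polyToLattice, map_smul] at h
    exact mem_of_eq_smul_adicCompletion hz m s _ h
  · intro hs
    induction hs using Submodule.smul_induction_on' with
    | smul d hd s _ =>
      obtain ⟨c, hc⟩ := (pow_dvd_algebraMap_iff k R' hz m d).2 hd
      exact ⟨c • φ.polyToLattice R' s, by rw [polyToLattice_smul, hc, mul_smul]⟩
    | add s _ t _ hs ht =>
      obtain ⟨w, hw⟩ := hs
      obtain ⟨v, hv⟩ := ht
      exact ⟨w + v, by rw [map_add, hw, hv, smul_add]⟩

theorem exists_lattice_quotient_equiv (m : ℕ) :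
    Nonempty ((φ.finiteSupport R' ⧸ (𝓘 ^ m • ⊤ : Submodule (A ⊗[k] R') (φ.finiteSupport R'))) ≃ₗ[R']
      (φ.LocalLattice R' ⧸ (algebraMap A 𝓔 z ^ m • ⊤ : Submodule 𝓔 (φ.LocalLattice R')))) := by
  let p := (algebraMap A 𝓔 z ^ m • ⊤ : Submodule 𝓔 (φ.LocalLattice R')).mkQ
  let f := (p.restrictScalars R').comp (φ.polyToLattice R')
  have hfp : ∀ s, f s = p (φ.polyToLattice R' s) := fun _ => rfl
  have hf : Function.Surjective f := by
    intro w
    obtain ⟨w, rfl⟩ := Submodule.mkQ_surjective _ w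
    obtain ⟨s, w', rfl⟩ := exists_eq_polyToLattice_add hz m w
    refine ⟨s, ?_⟩
    rw [hfp, map_add, (mkQ_smul_top_eq_zero_iff _ _).2 ⟨w', rfl⟩, add_zero]
  refine nonempty_quotient_equiv _ f hf fun s => ?_
  rw [← exists_polyToLattice_eq_smul_iff hz, hfp, mkQ_smul_top_eq_zero_iff]

variable {D : ℕ} (hD : (φ.toAlgHom z).IsElliptic D)
include hD

theorem projective_finiteSupport_quotient : Module.Projective R'
    (φ.finiteSupport R' ⧸ (𝓘 ^ 1 • ⊤ : Submodule (A ⊗[k] R') (φ.finiteSupport R'))) := by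
  obtain ⟨e⟩ := exists_finiteSupport_quotient_equiv (R' := R') hD
  have : Module.Projective R' (φ.finiteSupport R' ⧸ (algebraMap A (A ⊗[k] R') z • ⊤ :
      Submodule (A ⊗[k] R') (φ.finiteSupport R'))) := .of_equiv e
  obtain ⟨x, hx, h⟩ := exists_smul_pow_smul_top hz (R' := R') 1 (M := φ.finiteSupport R')
  obtain ⟨y, i, hi, hyi⟩ := Ideal.IsMaximal.exists_inv (I := φ.characteristicIdeal) inferInstance hx
  refine projective_quotient_of_retract _ _ ?_ (algebraMap A (A ⊗[k] R') (y * x)) ?_ ?_ this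
  · intro s hs
    obtain ⟨t, -, rfl⟩ := (Submodule.mem_smul_pointwise_iff_exists _ _ _).1 hs
    exact Submodule.smul_mem_smul (by rw [pow_one]; exact Ideal.mem_map_of_mem _ hz.mem) trivial
  · intro s hs
    obtain ⟨t, ht⟩ := h s hs
    rw [map_mul, mul_smul, ht, pow_one]
    exact Submodule.smul_mem _ _ (Submodule.smul_mem_pointwise_smul _ _ _ trivial)
  · intro s
    have h1 : y * x = 1 + -i := by linear_combination hyi
    rw [h1, map_add, map_one, add_smul, one_smul, add_sub_cancel_left]
    refine Submodule.smul_mem_smul ?_ trivial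
    rw [pow_one]
    exact Ideal.mem_map_of_mem _ (neg_mem hi)

/-- The projectivity criterion is applied to the map from the lattice to the completed polynomials.
That target is visibly `z`-torsion free, whereas for the lattice itself this is only a consequence.
-/
theorem projective_and_injective_lattice [FiniteDimensional k (A ⧸ φ.characteristicIdeal)]
    [Module.Finite 𝓔 (φ.LocalLattice R')] :
    Module.Projective 𝓔 (φ.LocalLattice R') ∧ Function.Injective (φ.latticeToCompletion R') := by
  have h1 := projective_finiteSupport_quotient (R' := R') hz hD
  obtain ⟨e⟩ := exists_lattice_quotient_equiv (R' := R') hz 1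
  have h2 := Module.Projective.of_equiv e
  rw [pow_one] at h2
  refine projective_of_projective_quotient_coeff k R' hz h2 (φ.latticeToCompletion R')
    (eq_zero_of_smul_eq_zero_adicCompletion hz
      fun s => eq_zero_of_smul_eq_zero_finiteSupport hD) ?_
  intro w v hw
  obtain ⟨s, w', rfl⟩ := exists_eq_polyToLattice_add hz 1 w
  rw [map_add, latticeToCompletion_polyToLattice, map_smul, pow_one, ← eq_sub_iff_add_eq,
    ← smul_sub] at hw
  rw [← pow_one (algebraMap A 𝓔 z)] at hw
  obtain ⟨w, hw'⟩ := (exists_polyToLattice_eq_smul_iff hz 1 s).2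
    (mem_of_eq_smul_adicCompletion hz 1 s _ hw)
  exact ⟨w + w', by rw [hw', smul_add, pow_one]⟩

end Uniformizer

end DrinfeldModule
end

/-! ### The map to power series and its étale kernel -/

noncomputable section

attribute [local instance] Algebra.TensorProduct.rightAlgebra

/-- The projection onto the kernel of a split surjection. -/
theorem exists_projection_ker {E W S : Type*} [CommRing E] [AddCommGroup W] [Module E W]
    [AddCommGroup S] [Module E S] [Module.Projective E S] (π : W →ₗ[E] S)
    (hπ : Function.Surjective π) :
    ∃ p : W →ₗ[E] LinearMap.ker π, p ∘ₗ (LinearMap.ker π).subtype = LinearMap.id := by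
  obtain ⟨s, hs⟩ := Module.projective_lifting_property π LinearMap.id hπ
  have hs' : ∀ x, π (s x) = x := fun x => DFunLike.congr_fun hs x
  refine ⟨(LinearMap.id - s ∘ₗ π).codRestrict _ fun w => ?_, ?_⟩
  · ext w
    have : π (w : W) = 0 := w.2
    simp [this]
  · rw [LinearMap.mem_ker, LinearMap.sub_apply, map_sub, LinearMap.comp_apply, hs',
      LinearMap.id_apply, sub_self]

theorem finite_ker_of_projective {E W S : Type*} [CommRing E] [AddCommGroup W] [Module E W]
    [AddCommGroup S] [Module E S] [Module.Projective E S] [Module.Finite E W] (π : W →ₗ[E] S)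
    (hπ : Function.Surjective π) : Module.Finite E (LinearMap.ker π) := by
  obtain ⟨p, hp⟩ := exists_projection_ker π hπ
  exact Module.Finite.of_surjective p fun x => ⟨x, DFunLike.congr_fun hp x⟩

theorem projective_ker_of_projective {E W S : Type*} [CommRing E] [AddCommGroup W] [Module E W]
    [AddCommGroup S] [Module E S] [Module.Projective E S] [Module.Projective E W] (π : W →ₗ[E] S)
    (hπ : Function.Surjective π) : Module.Projective E (LinearMap.ker π) := by
  obtain ⟨p, hp⟩ := exists_projection_ker π hπ
  exact Module.Projective.of_split _ p hp

namespace DrinfeldModule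

variable {k A R : Type*} [Field k] [Fintype k] [CommRing A] [Algebra k A]
    [CommRing R] [Algebra k R] {r : ℕ} {φ : DrinfeldModule k A R r}
    {R' : Type*} [CommRing R'] [Algebra k R'] [Algebra R R'] [IsScalarTower k R R']

local notation "𝓘" => φ.characteristicIdeal.map (algebraMap A (A ⊗[k] R'))
local notation "𝓔" => IntegralCoeffRing k φ.characteristicIdeal R'

variable (φ R') in
/-- The map from the lattice to twisted power series. -/
def latticeToSeries : φ.LocalLattice R' →ₗ[𝓔] φ.Series R' :=
  BaseChange.liftSemilinear
    { toFun := fun m => (φ.motiveEmbed R' m : φ.Series R')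
      map_add' := fun m n => by rw [map_add, Submodule.coe_add]
      map_smul' := fun e m => by
        rw [map_smulₛₗ, Submodule.coe_smul, ← algebraMap_smul_series]
        rfl }

theorem latticeToSeries_toLattice (m : φ.Motive) :
    φ.latticeToSeries R' (φ.toLattice R' m) = (φ.motiveEmbed R' m : φ.Series R') :=
  (BaseChange.liftSemilinear_tmul _ 1 m).trans (one_smul 𝓔 _)

theorem latticeToSeries_polyToLattice (s : φ.finiteSupport R') :
    φ.latticeToSeries R' (φ.polyToLattice R' s) = s := by
  induction s using finiteSupport_induction with
  | zero => simp
  | add x y hx hy => rw [map_add, map_add, Submodule.coe_add, hx, hy]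
  | single i ξ =>
    rw [finiteSupportEquiv_symm_single, polyToLattice_smul, polyToLattice_motiveEmbed, map_smul,
      latticeToSeries_toLattice, algebraMap_smul_series, Submodule.coe_smul]

theorem motiveTau_motiveMonomial (i : ℕ) :
    φ.motiveTau (φ.motiveMonomial i 1) = φ.motiveMonomial (i + 1) 1 := by
  refine (TwistedPolynomial.monomial_mul_monomial 1 i 1 1).trans ?_
  rw [map_one, mul_one, add_comm]
  rfl

theorem seriesFrob_motiveEmbed (m : φ.Motive) :
    φ.seriesFrob R' (φ.motiveEmbed R' m) = φ.motiveEmbed R' (φ.motiveTau m) := by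
  apply Series.coeff_injective
  exact (toSeries_tau_mul (R' := R') (show TwistedPolynomial _ from m)).symm

theorem latticeToSeries_latticeTau (w : φ.LocalLattice R') :
    φ.latticeToSeries R' (φ.latticeTau R' w) = φ.seriesFrob R' (φ.latticeToSeries R' w) := by
  induction w using lattice_induction with
  | zero => simp only [map_zero]
  | add x y hx hy => simp only [map_add, hx, hy]
  | smul e m =>
    rw [(φ.latticeTau R').map_smulₛₗ, map_smul, map_smul, (φ.seriesFrob R').map_smulₛₗ,
      latticeTau_toLattice, latticeToSeries_toLattice, latticeToSeries_toLattice,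
      seriesFrob_motiveEmbed]

/-- Twisted polynomials without constant coefficient lie in the span of `τ`. -/
theorem toLattice_mem_span_range_latticeTau (m : φ.Motive)
    (hm : TwistedPolynomial.coeff (show TwistedPolynomial _ from m) 0 = 0) :
    φ.toLattice R' m ∈ Submodule.span 𝓔 (Set.range (φ.latticeTau R')) := by
  obtain ⟨N, hN⟩ := TwistedPolynomial.exists_coeff_eq_zero (show TwistedPolynomial _ from m)
  have h : m = ∑ i ∈ Finset.range N,
      φ.motiveMonomial i (TwistedPolynomial.coeff (show TwistedPolynomial _ from m) i) :=
    TwistedPolynomial.eq_sum_monomial _ N hN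
  rw [h, map_sum]
  refine Submodule.sum_mem _ fun i _ => ?_
  cases i with
  | zero =>
    rw [hm]
    have : φ.motiveMonomial 0 0 = 0 := by
      rw [← one_tmul_smul_motiveMonomial, TensorProduct.tmul_zero, zero_smul]
    rw [this, map_zero]
    exact zero_mem _
  | succ i =>
    rw [← one_tmul_smul_motiveMonomial, ← motiveTau_motiveMonomial, map_smulₛₗ,
      ← latticeTau_toLattice]
    exact Submodule.smul_mem _ _ (Submodule.subset_span ⟨_, rfl⟩)

theorem smul_toLattice (b : A) (m : φ.Motive) : algebraMap A 𝓔 b • φ.toLattice R' m =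
    φ.toLattice R' (algebraMap A (A ⊗[k] R) b • m) := by
  rw [map_smulₛₗ]
  congr 1
  rw [IsScalarTower.algebraMap_apply A (A ⊗[k] R') 𝓔, Algebra.TensorProduct.algebraMap_apply,
    Algebra.TensorProduct.algebraMap_apply, toIntegralCoeffRing, RingHom.comp_apply,
    tensorMap_tmul, map_one]

theorem toLattice_motiveMonomial (i : ℕ) (ξ : R) : φ.toLattice R' (φ.motiveMonomial i ξ) =
    algebraMap R R' ξ • φ.toLattice R' (φ.motiveMonomial i 1) := by
  rw [← one_tmul_smul_motiveMonomial, map_smulₛₗ]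
  rfl

/-- For `b ∈ ℘` the product `m φ_b` has no constant coefficient, so it is an `R`-combination of `τ ^
(i + 1) = τ (τ ^ i)`. Thus `℘` kills the cokernel of the linearized `τ`. -/
theorem smul_mem_span_range_latticeTau {b : A} (hb : b ∈ φ.characteristicIdeal)
    (w : φ.LocalLattice R') :
    algebraMap A 𝓔 b • w ∈ Submodule.span 𝓔 (Set.range (φ.latticeTau R')) := by
  induction w using lattice_induction with
  | zero => rw [smul_zero]; exact zero_mem _
  | add x y hx hy => rw [smul_add]; exact add_mem hx hy
  | smul e m =>
    rw [smul_comm]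
    refine Submodule.smul_mem _ _ ?_
    rw [smul_toLattice]
    refine toLattice_mem_span_range_latticeTau _ ?_
    have h1 : (show TwistedPolynomial (FiniteField.frobeniusAlgHom k R) from
        algebraMap A (A ⊗[k] R) b • m) = TwistedPolynomial.C _ 1 *
          (show TwistedPolynomial _ from m) * φ.toAlgHom b := φ.motiveAction_tmul b 1 m
    rw [h1]
    change TwistedPolynomial.constantCoeff _ _ = 0
    rw [map_mul]
    refine mul_eq_zero_of_right _ ?_
    exact hb

section Uniformizer

variable [φ.characteristicIdeal.IsMaximal] {z : A}
  (hz : IsLocalGenerator φ.characteristicIdeal z)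
  {j : ℕ} (hj : ∀ i < j, (φ.toAlgHom z).coeff i = 0)
  (hu : IsUnit (algebraMap R R' ((φ.toAlgHom z).coeff j)))
include hz hj hu

/-- Modulo `z` a series equals its truncation below degree `j`, which is a polynomial; Nakayama does
the rest. -/
theorem latticeToSeries_surjective : Function.Surjective (φ.latticeToSeries R') := by
  have hfin := finite_series (R' := R') hz hj hu
  rw [← LinearMap.range_eq_top, eq_top_iff]
  refine Submodule.le_of_le_smul_of_le_jacobson_bot (I := Ideal.span {algebraMap A 𝓔 z})
    Module.Finite.fg_top ?_ ?_
  · rw [Ideal.span_singleton_le_iff_mem]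
    exact mem_jacobson_coeff k R' hz
  · intro s _
    let t : φ.finiteSupport R' := ⟨Series.mk φ fun i => if i < j then s.coeff i else 0, j,
      fun i hi => by rw [Series.coeff_mk, if_neg (by omega)]⟩
    obtain ⟨u, hu⟩ := (exists_eq_smul_iff hj hu (s := s - t)).2 fun i hi => by
      rw [map_sub, Pi.sub_apply, sub_eq_zero]
      exact (if_pos hi).symm
    rw [← add_sub_cancel (t : φ.Series R') s, hu]
    exact Submodule.add_mem_sup ⟨_, latticeToSeries_polyToLattice t⟩
      (Submodule.smul_mem_smul (Ideal.mem_span_singleton_self _) trivial)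

/-- For `i ≥ j` the series `τ ^ i` is divisible by `z`. Lifting the quotient to the lattice and
subtracting corrects `τ ^ i` by a multiple of `z` to an element of the kernel. -/
theorem exists_mem_ker_sub_smul (i : ℕ) (hi : j ≤ i) : ∃ g ∈ LinearMap.ker (φ.latticeToSeries R'),
    ∃ w, φ.toLattice R' (φ.motiveMonomial i 1) = g + algebraMap A 𝓔 z • w := by
  have h1 : (φ.motiveEmbed R' (φ.motiveMonomial i 1) : φ.Series R') ∈ φ.vanishing R' j := by
    intro l hl
    rw [coeff_motiveEmbed]
    refine (congrArg _ (TwistedPolynomial.coeff_monomial i l 1)).trans ?_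
    rw [if_neg (by omega), map_zero]
  obtain ⟨s, hs⟩ := (exists_eq_smul_iff hj hu).2 h1
  obtain ⟨w, rfl⟩ := latticeToSeries_surjective hz hj hu s
  refine ⟨φ.toLattice R' (φ.motiveMonomial i 1) - algebraMap A 𝓔 z • w, ?_, w, by abel⟩
  rw [LinearMap.mem_ker, map_sub, map_smul, latticeToSeries_toLattice, hs, sub_self]

/-- For `i > j`, apply `τ` to a kernel element congruent to `τ ^ (i - 1)`. For `i = j` the exponent
`j - 1` is too small; instead the relation `z · 1 = φ_z`, whose coefficient at `τ ^ j` is a unit,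
expresses `τ ^ j` modulo `z` through higher powers. -/
theorem toLattice_motiveMonomial_mem (i : ℕ) (hi : j ≤ i) :
    φ.toLattice R' (φ.motiveMonomial i 1) ∈
      Submodule.span 𝓔 (φ.latticeTau R' '' LinearMap.ker (φ.latticeToSeries R')) ⊔
        (algebraMap A 𝓔 z • ⊤ : Submodule 𝓔 (φ.LocalLattice R')) := by
  have h1 : ∀ i, j < i → φ.toLattice R' (φ.motiveMonomial i 1) ∈
      Submodule.span 𝓔 (φ.latticeTau R' '' LinearMap.ker (φ.latticeToSeries R')) ⊔
        (algebraMap A 𝓔 z • ⊤ : Submodule 𝓔 (φ.LocalLattice R')) := by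
    intro i hi
    obtain ⟨i, rfl⟩ := Nat.exists_eq_add_of_lt hi
    obtain ⟨g, hg, w, h⟩ := exists_mem_ker_sub_smul (R' := R') hz hj hu (j + i) (by omega)
    rw [← motiveTau_motiveMonomial, ← latticeTau_toLattice, h, map_add,
      (φ.latticeTau R').map_smulₛₗ, integralSigma_algebraMap_base]
    exact Submodule.add_mem_sup (Submodule.subset_span ⟨g, hg, rfl⟩)
      (Submodule.smul_mem_pointwise_smul _ _ _ trivial)
  rcases hi.eq_or_lt with rfl | hi
  · obtain ⟨N, hN⟩ := (φ.toAlgHom z).exists_coeff_eq_zero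
    have h2 : algebraMap A 𝓔 z • φ.toLattice R' (φ.motiveMonomial 0 1) =
        ∑ l ∈ Finset.range (N + (j + 1)), algebraMap R R' ((φ.toAlgHom z).coeff l) •
          φ.toLattice R' (φ.motiveMonomial l 1) := by
      have h3 : algebraMap A (A ⊗[k] R) z • φ.motiveMonomial 0 1 =
          ∑ l ∈ Finset.range (N + (j + 1)), φ.motiveMonomial l ((φ.toAlgHom z).coeff l) := by
        refine (φ.motiveAction_tmul z 1 _).trans ?_
        rw [map_one]
        refine Eq.trans ?_ (TwistedPolynomial.eq_sum_monomial (φ.toAlgHom z) (N + (j + 1))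
          fun i hi => hN i (by omega))
        exact (congrArg (· * φ.toAlgHom z) (one_mul (1 : TwistedPolynomial _))).trans (one_mul _)
      rw [smul_toLattice, h3, map_sum]
      exact Finset.sum_congr rfl fun l _ => toLattice_motiveMonomial l _
    rw [← Finset.add_sum_erase _ _ (Finset.mem_range.2 (by omega : j < N + (j + 1))),
      ← sub_eq_iff_eq_add] at h2
    obtain ⟨v, hv⟩ := hu.exists_left_inv
    rw [← one_smul R' (φ.toLattice R' (φ.motiveMonomial j 1)), ← hv, mul_smul, ← h2]
    refine Submodule.smul_of_tower_mem _ _ (sub_mem (Submodule.mem_sup_right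
      (Submodule.smul_mem_pointwise_smul _ _ _ trivial)) (Submodule.sum_mem _ fun l hl => ?_))
    rcases lt_trichotomy l j with h | h | h
    · rw [hj l h, map_zero, zero_smul]
      exact zero_mem _
    · exact absurd h (Finset.ne_of_mem_erase hl)
    · exact Submodule.smul_of_tower_mem _ _ (h1 l h)
  · exact h1 i hi

/-- Modulo `z` an element of the kernel is a polynomial without terms below `τ ^ j`, and these were
just reached from `τ` of the kernel. Torsion-freeness of the series shows that the remaining
multiple of `z` is `z` times a kernel element, so Nakayama applies. This is the slope `0` part. -/
theorem span_latticeTau_ker [FiniteDimensional k (A ⧸ φ.characteristicIdeal)]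
    [Module.Finite 𝓔 (φ.LocalLattice R')] :
    Submodule.span 𝓔 (φ.latticeTau R' '' LinearMap.ker (φ.latticeToSeries R')) =
      LinearMap.ker (φ.latticeToSeries R') := by
  have hle : Submodule.span 𝓔 (φ.latticeTau R' '' LinearMap.ker (φ.latticeToSeries R')) ≤
      LinearMap.ker (φ.latticeToSeries R') := by
    rw [Submodule.span_le]
    rintro _ ⟨w, hw, rfl⟩
    have hw : φ.latticeToSeries R' w = 0 := hw
    rw [SetLike.mem_coe, LinearMap.mem_ker, latticeToSeries_latticeTau, hw, map_zero]
  have := projective_series (R' := R') hz hj hu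
  have hfin := finite_ker_of_projective _ (latticeToSeries_surjective (R' := R') hz hj hu)
  refine le_antisymm hle ?_
  refine Submodule.le_of_le_smul_of_le_jacobson_bot (I := Ideal.span {algebraMap A 𝓔 z})
    (Module.Finite.iff_fg.1 hfin) ?_ ?_
  · rw [Ideal.span_singleton_le_iff_mem]
    exact mem_jacobson_coeff k R' hz
  · intro n hn
    have hn' : φ.latticeToSeries R' n = 0 := hn
    obtain ⟨s, w, hsw⟩ := exists_eq_polyToLattice_add hz 1 n
    rw [pow_one] at hsw
    have hs : (s : φ.Series R') ∈ φ.vanishing R' j := by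
      rw [← exists_eq_smul_iff hj hu]
      refine ⟨-φ.latticeToSeries R' w, ?_⟩
      rw [hsw, map_add, latticeToSeries_polyToLattice, map_smul, ← eq_neg_iff_add_eq_zero] at hn'
      rw [hn', smul_neg]
    have h2 : φ.polyToLattice R' s ∈
      Submodule.span 𝓔 (φ.latticeTau R' '' LinearMap.ker (φ.latticeToSeries R')) ⊔
        (algebraMap A 𝓔 z • ⊤ : Submodule 𝓔 (φ.LocalLattice R')) := by
      rw [polyToLattice, LinearMap.comp_apply, Finsupp.linearCombination_apply]
      refine Submodule.sum_mem _ fun i hi => Submodule.smul_of_tower_mem _ _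
        (toLattice_motiveMonomial_mem hz hj hu i ?_)
      by_contra h
      exact Finsupp.mem_support_iff.1 hi (hs i (not_le.1 h))
    obtain ⟨x, hx, y, hy, hxy⟩ := Submodule.mem_sup.1 h2
    obtain ⟨v, -, rfl⟩ := (Submodule.mem_smul_pointwise_iff_exists _ _ _).1 hy
    rw [hsw, ← hxy, add_assoc, ← smul_add]
    refine Submodule.add_mem_sup hx (Submodule.smul_mem_smul (Ideal.mem_span_singleton_self _) ?_)
    have hx' : φ.latticeToSeries R' x = 0 := hle hx
    rw [hsw, ← hxy, add_assoc, ← smul_add, map_add, hx', zero_add, map_smul] at hn'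
    exact eq_zero_of_smul_eq_zero_series hj hu hn'

end Uniformizer

end DrinfeldModule
end

/-! ### Characters of the coefficient ring -/

noncomputable section

/-- The rank of a finite projective module is constant under specialization. -/
theorem rankAtStalk_eq_of_le {E V : Type*} [CommRing E] [AddCommGroup V] [Module E V]
    [Module.Finite E V] [Module.Projective E V] {x y : PrimeSpectrum E} (h : x ≤ y) :
    Module.rankAtStalk (R := E) V x = Module.rankAtStalk (R := E) V y := by
  have := Module.finitePresentation_of_projective E V
  have h1 := (PrimeSpectrum.le_iff_specializes x y).1 h
  exact (h1.map (Module.isLocallyConstant_rankAtStalk (R := E) (M := V)).continuous).eq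

/-- A finite extension of `k` is normal, so two embeddings differ by an automorphism, and every
automorphism is a power of Frobenius. -/
theorem exists_algHom_apply_eq_pow {k K L : Type*} [Field k] [Fintype k] [Field K] [Field L]
    [Algebra k K] [Algebra k L] [FiniteDimensional k K] (f g : K →ₐ[k] L) :
    ∃ i : ℕ, ∀ x, f x = g x ^ Fintype.card k ^ i := by
  have := Module.finite_of_finite k (M := K)
  let _ : Algebra K L := g.toRingHom.toAlgebra
  have : IsScalarTower k K L := IsScalarTower.of_algebraMap_eq fun x => (g.commutes x).symm
  obtain ⟨i, hi⟩ := (FiniteField.bijective_frobeniusAlgEquivOfAlgebraic_pow k K).2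
    (Normal.algHomEquivAut k L K f)
  refine ⟨i, fun x => ?_⟩
  have h1 : f x = g (Normal.algHomEquivAut k L K f x) :=
    (DFunLike.congr_fun ((Normal.algHomEquivAut k L K).symm_apply_apply f) x).symm
  rw [h1, ← hi, AlgEquiv.coe_pow, FiniteField.coe_frobeniusAlgEquivOfAlgebraic_iterate, map_pow]

theorem frobenius_pow_apply {k R : Type*} [Field k] [Fintype k] [CommRing R] [Algebra k R] (i : ℕ)
    (x : R) : (FiniteField.frobeniusAlgHom k R ^ i) x = x ^ Fintype.card k ^ i := by
  induction i with
  | zero => simp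
  | succ i ih =>
    rw [pow_succ', AlgHom.mul_apply, ih, FiniteField.frobeniusAlgHom_apply, ← pow_mul, pow_succ]

section Characters

variable {k : Type*} [Field k] [Fintype k] {B : Type*} [CommRing B] [Algebra k B]
  {P : Ideal B} {R : Type*} [CommRing R] [Algebra k R] (γ : B →ₐ[k] R) (hγ : ∀ b ∈ P, γ b = 0)

/-- The homomorphism `B ⊗ R → R`, `b ⊗ ξ ↦ γ(b) ^ (q ^ i) ξ`. -/
def tensorCharacter (i : ℕ) : B ⊗[k] R →ₐ[k] R :=
  Algebra.TensorProduct.lift ((FiniteField.frobeniusAlgHom k R ^ i).comp γ) (AlgHom.id k R)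
    fun _ _ => Commute.all _ _

theorem tensorCharacter_tmul (i : ℕ) (b : B) (ξ : R) :
    tensorCharacter γ i (b ⊗ₜ ξ) = (FiniteField.frobeniusAlgHom k R ^ i) (γ b) * ξ :=
  Algebra.TensorProduct.lift_tmul _ _ _ _ _

/-- The extension of `tensorCharacter` to the completion. -/
def coeffCharacter (i : ℕ) : IntegralCoeffRing k P R →+* R :=
  (Ideal.Quotient.lift (P.map (algebraMap B (B ⊗[k] R))) (tensorCharacter γ i : B ⊗[k] R →+* R)
    (by
      intro a ha
      have h : P.map (algebraMap B (B ⊗[k] R)) ≤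
          RingHom.ker (tensorCharacter γ i : B ⊗[k] R →+* R) := by
        rw [Ideal.map_le_iff_le_comap]
        intro b hb
        rw [Ideal.mem_comap, RingHom.mem_ker, Algebra.TensorProduct.algebraMap_apply]
        refine (tensorCharacter_tmul γ i _ _).trans ?_
        rw [Algebra.algebraMap_self, RingHom.id_apply, hγ b hb, map_zero, zero_mul]
      exact RingHom.mem_ker.1 (h ha))).comp
    (AdicCompletion.evalOneₐ (P.map (algebraMap B (B ⊗[k] R)))).toRingHom

theorem coeffCharacter_algebraMap (i : ℕ) (d : B ⊗[k] R) :
    coeffCharacter γ hγ i (algebraMap (B ⊗[k] R) (IntegralCoeffRing k P R) d) =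
      tensorCharacter γ i d := by
  rw [coeffCharacter, RingHom.comp_apply]
  have h : (AdicCompletion.evalOneₐ (P.map (algebraMap B (B ⊗[k] R)))).toRingHom
      (algebraMap (B ⊗[k] R) (IntegralCoeffRing k P R) d) = Ideal.Quotient.mk _ d :=
    (AdicCompletion.evalOneₐ (P.map (algebraMap B (B ⊗[k] R)))).commutes d
  rw [h, Ideal.Quotient.lift_mk]
  rfl

theorem coeffCharacter_base (i : ℕ) (b : B) :
    coeffCharacter γ hγ i (algebraMap B (IntegralCoeffRing k P R) b) =
      (FiniteField.frobeniusAlgHom k R ^ i) (γ b) := by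
  rw [IsScalarTower.algebraMap_apply B (B ⊗[k] R) (IntegralCoeffRing k P R),
    coeffCharacter_algebraMap, Algebra.TensorProduct.algebraMap_apply, tensorCharacter_tmul,
    mul_one]
  rfl

theorem tensorCharacter_partialFrobenius (i : ℕ) (d : B ⊗[k] R) :
    tensorCharacter γ (i + 1) (partialFrobenius k R B d) =
      FiniteField.frobeniusAlgHom k R (tensorCharacter γ i d) := by
  induction d using TensorProduct.induction_on with
  | zero => simp
  | add x y hx hy => simp only [map_add, hx, hy]
  | tmul b ξ =>
    rw [partialFrobenius, Algebra.TensorProduct.map_tmul, tensorCharacter_tmul,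
      tensorCharacter_tmul, map_mul, pow_succ']
    rfl

variable {z : B} (hz : IsLocalGenerator P z) [P.IsMaximal]
include hz

theorem coeffCharacter_integralSigma (i : ℕ) (e : IntegralCoeffRing k P R) :
    coeffCharacter γ hγ (i + 1) (integralSigma k P R e) =
      FiniteField.frobeniusAlgHom k R (coeffCharacter γ hγ i e) := by
  obtain ⟨d, e', rfl⟩ := exists_eq_algebraMap_add k R hz 1 e
  rw [map_add, map_add, map_mul, map_pow, integralSigma_algebraMap, integralSigma_algebraMap_base,
    map_add, map_mul, map_mul, map_pow, map_pow, coeffCharacter_base, coeffCharacter_base,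
    hγ z hz.mem, map_zero, map_zero, pow_one, zero_mul, zero_mul, coeffCharacter_algebraMap,
    coeffCharacter_algebraMap, tensorCharacter_partialFrobenius, add_zero, add_zero]

variable [IsDomain R]

/-- The kernels of the characters, as points of the spectrum. -/
def characterPoint (i : ℕ) : PrimeSpectrum (IntegralCoeffRing k P R) :=
  ⟨RingHom.ker (coeffCharacter γ hγ i), RingHom.ker_isPrime _⟩

theorem comap_characterPoint (i : ℕ) :
    (characterPoint γ hγ (i + 1)).comap (integralSigma k P R) = characterPoint γ hγ i := by
  apply PrimeSpectrum.ext
  ext e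
  change coeffCharacter γ hγ (i + 1) (integralSigma k P R e) = 0 ↔ coeffCharacter γ hγ i e = 0
  rw [coeffCharacter_integralSigma γ hγ hz, FiniteField.frobeniusAlgHom_apply,
    pow_eq_zero_iff Fintype.card_ne_zero]

variable [FiniteDimensional k (B ⧸ P)]

/-- The map `γ` factors through `B / P`, a field with `q ^ d` elements, so twisting by Frobenius `d`
times changes nothing. -/
theorem characterPoint_add_finrank (i : ℕ) :
    characterPoint (P := P) γ hγ (i + Module.finrank k (B ⧸ P)) = characterPoint γ hγ i := by
  have hF : ∀ b, γ b ^ Fintype.card k ^ Module.finrank k (B ⧸ P) = γ b := by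
    let _ := Ideal.Quotient.field P
    have : Finite (B ⧸ P) := Module.finite_of_finite k
    have := Fintype.ofFinite (B ⧸ P)
    intro b
    have h : Ideal.Quotient.mk P (b ^ Fintype.card k ^ Module.finrank k (B ⧸ P) - b) = 0 := by
      rw [map_sub, map_pow, ← Module.card_eq_pow_finrank, FiniteField.pow_card, sub_self]
    rw [Ideal.Quotient.eq_zero_iff_mem] at h
    have := hγ _ h
    rwa [map_sub, map_pow, sub_eq_zero] at this
  have h : ∀ d : B ⊗[k] R, tensorCharacter γ (i + Module.finrank k (B ⧸ P)) d =
      tensorCharacter γ i d := by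
    intro d
    induction d using TensorProduct.induction_on with
    | zero => simp
    | add x y hx hy => simp only [map_add, hx, hy]
    | tmul b ξ =>
      rw [tensorCharacter_tmul, tensorCharacter_tmul, frobenius_pow_apply, frobenius_pow_apply,
        pow_add, mul_comm (_ ^ i), pow_mul, hF]
  apply PrimeSpectrum.ext
  ext e
  change coeffCharacter γ hγ _ e = 0 ↔ coeffCharacter γ hγ i e = 0
  obtain ⟨d, e', rfl⟩ := exists_eq_algebraMap_add k R hz 1 e
  rw [map_add, map_mul, map_pow, map_add, map_mul, map_pow, coeffCharacter_base,
    coeffCharacter_base, hγ z hz.mem, map_zero, map_zero, coeffCharacter_algebraMap,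
    coeffCharacter_algebraMap, h, pow_one, zero_mul, zero_mul]

/-- As `z ∈ M`, the field `E / M` receives `B / P` both directly and through `γ`. The two embeddings
differ by a power of Frobenius, say the `i`-th, so `E → E / M` factors through the `i`-th character.
Ranks on the whole spectrum are therefore governed by the character points. -/
theorem exists_characterPoint_le (M : Ideal (IntegralCoeffRing k P R)) [M.IsMaximal] :
    ∃ i, (characterPoint γ hγ i).asIdeal ≤ M := by
  let _ := Ideal.Quotient.field P
  let _ := Ideal.Quotient.field M
  let E := IntegralCoeffRing k P R
  have hzM : Ideal.Quotient.mk M (algebraMap B E z) = 0 := by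
    rw [Ideal.Quotient.eq_zero_iff_mem]
    exact Ideal.mem_sInf.1 (mem_jacobson_coeff k R hz) ⟨bot_le, inferInstance⟩
  let p : B ⊗[k] R →ₐ[k] E ⧸ M := (Ideal.Quotient.mkₐ k M).comp
    (IsScalarTower.toAlgHom k (B ⊗[k] R) E)
  let δ : R →ₐ[k] E ⧸ M := p.comp Algebra.TensorProduct.includeRight
  let α : B →ₐ[k] E ⧸ M := p.comp Algebra.TensorProduct.includeLeft
  have hα : ∀ b ∈ P, α b = 0 := by
    intro b hb
    have h1 : algebraMap B E b ∈ P.map (algebraMap B E) := Ideal.mem_map_of_mem _ hb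
    rw [map_eq_span_coeff k R hz, Ideal.mem_span_singleton] at h1
    obtain ⟨c, hc⟩ := h1
    change Ideal.Quotient.mk M (algebraMap B E b) = 0
    rw [hc, map_mul, hzM, zero_mul]
  obtain ⟨i, hi⟩ := exists_algHom_apply_eq_pow (Ideal.Quotient.liftₐ P α hα)
    (Ideal.Quotient.liftₐ P (δ.comp γ) fun b hb => by
      rw [AlgHom.comp_apply, hγ b hb, map_zero])
  have hi' : ∀ b, α b = δ (γ b) ^ Fintype.card k ^ i := fun b => hi (Ideal.Quotient.mk P b)
  have key : ∀ d, p d = δ (tensorCharacter γ i d) := by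
    intro d
    induction d using TensorProduct.induction_on with
    | zero => simp
    | add x y hx hy => simp only [map_add, hx, hy]
    | tmul b ξ =>
      rw [tensorCharacter_tmul, frobenius_pow_apply, map_mul, map_pow, ← hi']
      change p (b ⊗ₜ ξ) = p (b ⊗ₜ 1) * p (1 ⊗ₜ ξ)
      rw [← map_mul, Algebra.TensorProduct.tmul_mul_tmul, one_mul, mul_one]
  refine ⟨i, fun e he => ?_⟩
  have he' : coeffCharacter γ hγ i e = 0 := he
  obtain ⟨d, e', rfl⟩ := exists_eq_algebraMap_add k R hz 1 e
  rw [map_add, map_mul, map_pow, coeffCharacter_base, hγ z hz.mem, map_zero,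
    coeffCharacter_algebraMap, pow_one, zero_mul, add_zero] at he'
  rw [← Ideal.Quotient.eq_zero_iff_mem, map_add, map_mul, map_pow, hzM, pow_one, zero_mul, add_zero]
  exact (key d).trans (by rw [he', map_zero])

end Characters
end

/-! ### Lattices in isocrystals and constancy of the rank -/

noncomputable section

theorem BaseChange.tmul_one_injective {E E' V : Type*} [CommRing E] [CommRing E'] (f : E →+* E')
    (hf : Function.Injective f) [AddCommGroup V] [Module E V] [Module.Projective E V] :
    Function.Injective (fun v : V => BaseChange.tmul f 1 v) := by
  intro v w hvw
  let g : E →ₗ[E] ScalarsVia f :=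
    { toFun := f
      map_add' := map_add f
      map_smul' := map_mul f }
  have h := Module.Flat.rTensor_preserves_injective_linearMap (M := V) g hf
  have hg : ∀ v : V, (g.rTensor V) (TensorProduct.tmul E (1 : E) v) = BaseChange.tmul f 1 v :=
    fun v => (LinearMap.rTensor_tmul V g v 1).trans
      (congrArg (fun e => BaseChange.tmul f e v) (map_one f))
  have h2 : TensorProduct.tmul E (1 : E) v = TensorProduct.tmul E (1 : E) w :=
    h ((hg v).trans (hvw.trans (hg w).symm))
  have h3 := congrArg (TensorProduct.lid E V) h2
  rwa [TensorProduct.lid_tmul, TensorProduct.lid_tmul, one_smul, one_smul] at h3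

/-- The canonical map between base changes along `f` and along `g.comp f`. -/
def BaseChange.compMap {E E' E'' : Type*} [CommRing E] [CommRing E'] [CommRing E''] (f : E →+* E')
    (g : E' →+* E'') (M : Type*) [AddCommGroup M] [Module E M] :
    BaseChange f M →ₛₗ[g] BaseChange (g.comp f) M :=
  { BaseChange.lift (f := f)
      (AddMonoidHom.mk' (fun e => AddMonoidHom.mk' (fun m => BaseChange.tmul (g.comp f) (g e) m)
          (BaseChange.tmul_add _ _))
        (by intro a b; ext m; simp only [map_add]; exact BaseChange.add_tmul _ _ _ _))
      (by
        intro e e' m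
        change BaseChange.tmul (g.comp f) (g (f e * e')) m = BaseChange.tmul (g.comp f) (g e') (e • m)
        rw [BaseChange.tmul_smul, map_mul]
        rfl) with
    map_smul' := by
      intro e x
      induction x using BaseChange.induction_on with
      | zero => simp
      | add x y hx hy => simp_all [smul_add]
      | tmul e' m => exact congrArg (fun c => BaseChange.tmul (g.comp f) c m) (map_mul g e e') }

theorem BaseChange.compMap_tmul {E E' E'' M : Type*} [CommRing E] [CommRing E'] [CommRing E'']
    (f : E →+* E') (g : E' →+* E'') [AddCommGroup M] [Module E M] (e : E') (m : M) :
    BaseChange.compMap f g M (BaseChange.tmul f e m) = BaseChange.tmul (g.comp f) (g e) m := rfl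

/-- Followed by the comparison with the iterated base change, the map becomes `v ↦ 1 ⊗ v`, which is
injective because `f^*M` is flat. -/
theorem BaseChange.compMap_injective {E E' E'' M : Type*} [CommRing E] [CommRing E']
    [CommRing E''] (f : E →+* E') (g : E' →+* E'') [AddCommGroup M] [Module E M]
    [Module.Projective E' (BaseChange f M)] (hg : Function.Injective g) :
    Function.Injective (BaseChange.compMap f g M) := by
  let l : BaseChange (g.comp f) M →ₗ[E''] BaseChange g (BaseChange f M) :=
    BaseChange.liftSemilinear
      { toFun := fun m => BaseChange.tmul g 1 (BaseChange.tmul f 1 m)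
        map_add' := fun m n => by rw [BaseChange.tmul_add, BaseChange.tmul_add]
        map_smul' := fun e m => by
          rw [BaseChange.tmul_smul, mul_one, BaseChange.smul_tmul', ← mul_one (f e),
            ← BaseChange.smul_tmul', BaseChange.tmul_smul]
          rfl }
  refine Function.Injective.of_comp (f := l) ?_
  convert BaseChange.tmul_one_injective (V := BaseChange f M) g hg using 1
  ext x
  induction x using BaseChange.induction_on with
  | zero => exact (map_zero l).trans (TensorProduct.tmul_zero _ _).symm
  | add x y hx hy =>
    rw [Function.comp_apply, map_add, map_add, BaseChange.tmul_add, ← hx, ← hy]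
    rfl
  | tmul e m =>
    change g e • BaseChange.tmul g 1 (BaseChange.tmul f 1 m) = BaseChange.tmul g 1 (BaseChange.tmul f e m)
    rw [BaseChange.smul_tmul', BaseChange.tmul_eq_smul f e, BaseChange.tmul_smul]

theorem BaseChange.span_range_compMap {E E' E'' M : Type*} [CommRing E] [CommRing E']
    [CommRing E''] (f : E →+* E') (g : E' →+* E'') [AddCommGroup M] [Module E M] :
    Submodule.span E'' (Set.range (BaseChange.compMap f g M)) = ⊤ := by
  rw [eq_top_iff]
  intro x _
  induction x using BaseChange.induction_on with
  | zero => exact zero_mem _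
  | add x y hx hy => exact add_mem (hx trivial) (hy trivial)
  | tmul e m =>
    rw [BaseChange.tmul_eq_smul]
    refine Submodule.smul_mem _ _ (Submodule.subset_span ⟨BaseChange.tmul f 1 m, ?_⟩)
    rw [BaseChange.compMap_tmul, map_one]

theorem span_range_iterate_eq_top {E M : Type*} [CommRing E] {σ : E →+* E} [AddCommGroup M]
    [Module E M] {τ : M →ₛₗ[σ] M} (h : Submodule.span E (Set.range τ) = ⊤) (n : ℕ) :
    Submodule.span E (Set.range τ^[n]) = ⊤ := by
  induction n with
  | zero => rw [Function.iterate_zero, Set.range_id, Submodule.span_univ]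
  | succ n ih =>
    rw [eq_top_iff, ← h, Submodule.span_le]
    rintro _ ⟨x, rfl⟩
    have hx : x ∈ Submodule.span E (Set.range τ^[n]) := ih ▸ trivial
    rw [SetLike.mem_coe]
    induction hx using Submodule.span_induction with
    | zero => rw [map_zero]; exact zero_mem _
    | add x y _ _ hx hy => rw [map_add]; exact add_mem hx hy
    | smul e x _ hx => rw [τ.map_smulₛₗ]; exact Submodule.smul_mem _ _ hx
    | mem x hx =>
      obtain ⟨y, rfl⟩ := hx
      exact Submodule.subset_span ⟨y, Function.iterate_succ_apply' τ n y⟩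

section LatticeMap

variable {k : Type*} [Field k] [Fintype k] {B : Type*} [CommRing B] [Algebra k B]
  {P : Ideal B} {R : Type*} [CommRing R] [Algebra k R]

local notation "𝓔" => IntegralCoeffRing k P R
local notation "𝓕" => CoeffRing k P R

theorem coeffSigma_algebraMap (e : 𝓔) :
    algebraMap 𝓔 𝓕 (integralSigma k P R e) = coeffSigma k P R (algebraMap 𝓔 𝓕 e) := by
  rw [coeffSigma, IsLocalization.map_eq]

/-- The properties of a local uniformizer that relate `B_P ⊗̂ R` and its localization. -/
structure IsUniformizer (k : Type*) [Field k] [Fintype k] {B : Type*} [CommRing B] [Algebra k B]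
    (P : Ideal B) (R : Type*) [CommRing R] [Algebra k R] (z : B) : Prop where
  generator : IsLocalGenerator P z
  isDomain : IsDomain B
  ne_zero : z ≠ 0
  separated : ∀ b : B, b ≠ 0 → ∃ m, b ∉ P ^ m
  regular : ∀ e : IntegralCoeffRing k P R, algebraMap B _ z * e = 0 → e = 0

variable {z : B} (hz : IsUniformizer k P R z)
include hz

theorem IsUniformizer.isUnit : IsUnit (algebraMap 𝓔 𝓕 (algebraMap B 𝓔 z)) :=
  have := hz.isDomain
  IsLocalization.map_units 𝓕 (⟨algebraMap B 𝓔 z, z, mem_nonZeroDivisors_of_ne_zero hz.ne_zero, rfl⟩ :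
    Algebra.algebraMapSubmonoid 𝓔 (nonZeroDivisors B))

variable [P.IsMaximal]

theorem IsUniformizer.pow_mem : ∀ m : ℕ, algebraMap B 𝓔 z ^ m ∈ nonZeroDivisors 𝓔 := fun m =>
  Submonoid.pow_mem _ (mem_nonZeroDivisors_iff_left.2 fun e he => hz.regular e he) m

/-- Each inverted element is a power of the regular element `z` times a unit, so nothing is killed
by the localization. -/
theorem IsUniformizer.submonoid_le :
    Algebra.algebraMapSubmonoid 𝓔 (nonZeroDivisors B) ≤ nonZeroDivisors 𝓔 := by
  have := hz.isDomain
  rintro _ ⟨b, hb, rfl⟩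
  obtain ⟨m, u, hu, h⟩ := exists_pow_mul_unit k R hz.generator
    (hz.separated b (nonZeroDivisors.ne_zero hb))
  rw [h]
  exact mul_mem (hz.pow_mem m) hu.mem_nonZeroDivisors

theorem IsUniformizer.algebraMap_injective : Function.Injective (algebraMap 𝓔 𝓕) :=
  IsLocalization.injective 𝓕 hz.submonoid_le

theorem IsUniformizer.exists_pow_mul (x : 𝓕) :
    ∃ (m : ℕ) (e : 𝓔), algebraMap 𝓔 𝓕 (algebraMap B 𝓔 z ^ m) * x = algebraMap 𝓔 𝓕 e := by
  have := hz.isDomain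
  obtain ⟨⟨e, ⟨_, b, hb, rfl⟩⟩, h⟩ := IsLocalization.surj
    (Algebra.algebraMapSubmonoid 𝓔 (nonZeroDivisors B)) x
  obtain ⟨m, u, hu, hm⟩ := exists_pow_mul_unit k R hz.generator
    (hz.separated b (nonZeroDivisors.ne_zero hb))
  obtain ⟨v, hv⟩ := hu.exists_right_inv
  refine ⟨m, e * v, ?_⟩
  have h' : x * algebraMap 𝓔 𝓕 (algebraMap B 𝓔 b) = algebraMap 𝓔 𝓕 e := h
  rw [map_mul, ← h', hm, map_mul]
  have hv' : algebraMap 𝓔 𝓕 u * algebraMap 𝓔 𝓕 v = 1 := by rw [← map_mul, hv, map_one]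
  linear_combination (-(algebraMap 𝓔 𝓕 (algebraMap B 𝓔 z ^ m) * x)) * hv'

omit hz [P.IsMaximal] in
/-- `ι` identifies `V` with a submodule of `X` that becomes `X` after inverting `z`. -/
structure IsLatticeMap {V X : Type*} [AddCommGroup V] [Module (IntegralCoeffRing k P R) V]
    [AddCommGroup X] [Module (CoeffRing k P R) X]
    (ι : V →ₛₗ[algebraMap (IntegralCoeffRing k P R) (CoeffRing k P R)] X) (z : B) : Prop where
  injective : Function.Injective ι
  exists_pow_smul : ∀ x, ∃ (m : ℕ) (v : V),
    algebraMap (IntegralCoeffRing k P R) (CoeffRing k P R)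
      (algebraMap B (IntegralCoeffRing k P R) z ^ m) • x = ι v

variable {V X : Type*} [AddCommGroup V] [Module (IntegralCoeffRing k P R) V]
  [AddCommGroup X] [Module (CoeffRing k P R) X]

theorem IsUniformizer.smul_mem_iff (N : Submodule 𝓕 X) (m : ℕ) (x : X) :
    algebraMap 𝓔 𝓕 (algebraMap B 𝓔 z ^ m) • x ∈ N ↔ x ∈ N := by
  rw [map_pow]
  exact N.smul_mem_iff_of_isUnit (hz.isUnit.pow m)

theorem IsUniformizer.smul_injective (m : ℕ) {x y : X}
    (h : algebraMap 𝓔 𝓕 (algebraMap B 𝓔 z ^ m) • x = algebraMap 𝓔 𝓕 (algebraMap B 𝓔 z ^ m) • y) :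
    x = y := by
  rw [map_pow] at h
  exact (hz.isUnit.pow m).smul_left_cancel.1 h

omit hz [P.IsMaximal] in
/-- The canonical map from a lattice to its localization. -/
def latticeEmbed (V : Type*) [AddCommGroup V] [Module (IntegralCoeffRing k P R) V] :
    V →ₛₗ[algebraMap (IntegralCoeffRing k P R) (CoeffRing k P R)]
      BaseChange (algebraMap (IntegralCoeffRing k P R) (CoeffRing k P R)) V where
  toFun v := BaseChange.tmul _ 1 v
  map_add' := BaseChange.tmul_add _ 1
  map_smul' e v := by rw [BaseChange.tmul_smul, BaseChange.smul_tmul']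

theorem IsUniformizer.exists_pow_smul_of_span {ι : V →ₛₗ[algebraMap 𝓔 𝓕] X}
    (h : Submodule.span 𝓕 (Set.range ι) = ⊤) (x : X) :
    ∃ (m : ℕ) (v : V), algebraMap 𝓔 𝓕 (algebraMap B 𝓔 z ^ m) • x = ι v := by
  have hx : x ∈ Submodule.span 𝓕 (Set.range ι) := h ▸ trivial
  induction hx using Submodule.span_induction with
  | zero => exact ⟨0, 0, by rw [smul_zero, map_zero]⟩
  | mem x hx =>
    obtain ⟨v, rfl⟩ := hx
    exact ⟨0, v, by rw [pow_zero, map_one, one_smul]⟩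
  | add x y _ _ hx hy =>
    obtain ⟨m, v, hv⟩ := hx
    obtain ⟨n, w, hw⟩ := hy
    refine ⟨m + n, algebraMap B 𝓔 z ^ n • v + algebraMap B 𝓔 z ^ m • w, ?_⟩
    rw [map_add, ι.map_smulₛₗ, ι.map_smulₛₗ, ← hv, ← hw, smul_add,
      smul_smul, smul_smul, ← map_mul, ← map_mul, ← pow_add, ← pow_add, add_comm n m]
  | smul e x _ hx =>
    obtain ⟨n, v, hv⟩ := hx
    obtain ⟨m, e', h⟩ := hz.exists_pow_mul e
    refine ⟨m + n, e' • v, ?_⟩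
    rw [ι.map_smulₛₗ, ← hv, ← h, smul_smul, smul_smul, pow_add, map_mul, mul_right_comm]

omit hz [P.IsMaximal] in
theorem span_range_latticeEmbed : Submodule.span 𝓕 
    (Set.range (latticeEmbed (k := k) (P := P) (R := R) V)) = ⊤ := by
  rw [eq_top_iff]
  intro x _
  induction x using BaseChange.induction_on with
  | zero => exact zero_mem _
  | add x y hx hy => exact add_mem (hx trivial) (hy trivial)
  | tmul e v =>
    rw [BaseChange.tmul_eq_smul]
    exact Submodule.smul_mem _ _ (Submodule.subset_span ⟨v, rfl⟩)

theorem exists_pow_smul_eq_latticeEmbed (x : BaseChange (algebraMap 𝓔 𝓕) V) :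
    ∃ (m : ℕ) (v : V), algebraMap 𝓔 𝓕 (algebraMap B 𝓔 z ^ m) • x = latticeEmbed V v :=
  hz.exists_pow_smul_of_span span_range_latticeEmbed x

theorem isLatticeMap_latticeEmbed [Module.Projective 𝓔 V] :
    IsLatticeMap (latticeEmbed (k := k) (P := P) (R := R) V) z where
  injective := BaseChange.tmul_one_injective _ hz.algebraMap_injective
  exists_pow_smul := exists_pow_smul_eq_latticeEmbed hz

theorem IsLatticeMap.span_range {ι : V →ₛₗ[algebraMap 𝓔 𝓕] X} (hι : IsLatticeMap ι z) :
    Submodule.span 𝓕 (Set.range ι) = ⊤ := by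
  rw [eq_top_iff]
  intro x _
  obtain ⟨m, v, h⟩ := hι.exists_pow_smul x
  rw [← hz.smul_mem_iff _ m, h]
  exact Submodule.subset_span ⟨v, rfl⟩

theorem IsLatticeMap.bijective {ι : V →ₛₗ[algebraMap 𝓔 𝓕] X} (hι : IsLatticeMap ι z) :
    Function.Bijective (BaseChange.liftSemilinear ι) := by
  have h1 : ∀ v, BaseChange.liftSemilinear ι (latticeEmbed V v) = ι v := fun v =>
    (BaseChange.liftSemilinear_tmul ι 1 v).trans (one_smul _ _)
  constructor
  · rw [injective_iff_map_eq_zero]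
    intro x hx
    obtain ⟨m, v, h⟩ := exists_pow_smul_eq_latticeEmbed hz x
    have h2 : ι v = ι 0 := by rw [← h1, ← h, map_smul, hx, smul_zero, map_zero]
    rw [hι.injective h2, map_zero] at h
    exact hz.smul_injective m (by rw [h, smul_zero])
  · rw [← LinearMap.range_eq_top, eq_top_iff]
    intro x _
    obtain ⟨m, v, h⟩ := hι.exists_pow_smul x
    rw [← hz.smul_mem_iff _ m, h, ← h1]
    exact ⟨_, rfl⟩

variable {τ : X →ₛₗ[coeffSigma k P R] X} {t : V →ₛₗ[integralSigma k P R] V}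

/-- A cokernel killed by `z` disappears once `z` is inverted. -/
theorem span_range_eq_top_of_lattice {ι : V →ₛₗ[algebraMap 𝓔 𝓕] X}
    (ht : ∀ v : V, algebraMap B 𝓔 z • v ∈ Submodule.span 𝓔 (Set.range t))
    (hι : ∀ x, ∃ (m : ℕ) (v : V), algebraMap 𝓔 𝓕 (algebraMap B 𝓔 z ^ m) • x = ι v)
    (hτ : ∀ v, ι (t v) = τ (ι v)) : Submodule.span 𝓕 (Set.range τ) = ⊤ := by
  rw [eq_top_iff]
  intro x _
  obtain ⟨m, v, h⟩ := hι x
  rw [← hz.smul_mem_iff _ m, h, ← hz.smul_mem_iff _ 1, pow_one, ← ι.map_smulₛₗ]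
  have h1 : ∀ w ∈ Submodule.span 𝓔 (Set.range t), ι w ∈ Submodule.span 𝓕 (Set.range τ) := by
    intro w hw
    induction hw using Submodule.span_induction with
    | zero => rw [map_zero]; exact zero_mem _
    | add x y _ _ hx hy => rw [map_add]; exact add_mem hx hy
    | smul e x _ hx => rw [ι.map_smulₛₗ]; exact Submodule.smul_mem _ _ hx
    | mem x hx =>
      obtain ⟨y, rfl⟩ := hx
      rw [hτ]
      exact Submodule.subset_span ⟨_, rfl⟩
  exact h1 _ (ht v)

theorem IsLatticeMap.isDualizableOfRank {ι : V →ₛₗ[algebraMap 𝓔 𝓕] X} (hι : IsLatticeMap ι z)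
    (ht : ∀ v : V, algebraMap B 𝓔 z • v ∈ Submodule.span 𝓔 (Set.range t))
    (hτ : ∀ v, ι (t v) = τ (ι v)) [Module.Finite 𝓔 V] [Module.Projective 𝓔 V] (c : ℕ)
    (hc : ∀ x, Module.rankAtStalk (R := 𝓔) V x = c) : IsDualizableOfRank τ c where
  finite := Module.Finite.equiv (LinearEquiv.ofBijective _ (hι.bijective hz))
  projective := Module.Projective.of_equiv (LinearEquiv.ofBijective _ (hι.bijective hz))
  rank x := by
    rw [← Module.rankAtStalk_eq_of_equiv (LinearEquiv.ofBijective _ (hι.bijective hz)),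
      BaseChange.rankAtStalk_eq, hc]
  span_range := span_range_eq_top_of_lattice hz ht hι.exists_pow_smul hτ

/-- The rank of a lattice with a semilinear map that generates it up to inverting `z` is
constant. -/
theorem exists_rankAtStalk_eq [IsDomain R] [FiniteDimensional k (B ⧸ P)] (γ : B →ₐ[k] R)
    (ht : ∀ v : V, algebraMap B 𝓔 z • v ∈ Submodule.span 𝓔 (Set.range t))
    (hγ : ∀ b ∈ P, γ b = 0) [Module.Finite 𝓔 V] [Module.Projective 𝓔 V] :
    ∃ c, ∀ x, Module.rankAtStalk (R := 𝓔) V x = c := by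
  let T := baseChangeTau (algebraMap 𝓔 𝓕) (coeffSigma_algebraMap (k := k) (P := P) (R := R)) t
  have hT : Submodule.span 𝓕 (Set.range T) = ⊤ :=
    span_range_eq_top_of_lattice hz ht (exists_pow_smul_eq_latticeEmbed hz) fun v => by
      refine Eq.trans ?_ (baseChangeTau_tmul _ _ _ _ _).symm
      rw [map_one]
      rfl
  have hstep : ∀ i, Module.rankAtStalk (R := 𝓔) V (characterPoint γ hγ (i + 1)) ≤
      Module.rankAtStalk (R := 𝓔) V (characterPoint γ hγ i) := by
    intro i
    -- Generation by `τ` holds only after inverting `z`, so ranks can be compared only at primes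
    -- that survive in the localization. A minimal prime contains no regular element, hence
    -- survives, and ranks do not change from it to the character point above it.
    obtain ⟨p, hp, hple⟩ := Ideal.exists_minimalPrimes_le
      (bot_le : ⊥ ≤ (characterPoint (P := P) γ hγ (i + 1)).asIdeal)
    have hprime : p.IsPrime := hp.1.1
    have hdisj := (Ideal.disjoint_nonZeroDivisors_of_mem_minimalPrimes hp).symm
    let p' : PrimeSpectrum 𝓔 := ⟨p, hprime⟩
    obtain ⟨y, hy⟩ : ∃ y : PrimeSpectrum 𝓕, y.comap (algebraMap 𝓔 𝓕) = p' := by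
      have h := PrimeSpectrum.localization_comap_range 𝓕
        (Algebra.algebraMapSubmonoid 𝓔 (nonZeroDivisors B))
      have h2 : p' ∈ Set.range (PrimeSpectrum.comap (algebraMap 𝓔 𝓕)) := by
        rw [h]
        exact hdisj.mono_left hz.submonoid_le
      exact h2
    have h1 := rankAtStalk_le_comap T hT y
    rw [BaseChange.rankAtStalk_eq, BaseChange.rankAtStalk_eq, hy, ← PrimeSpectrum.comap_comp_apply]
      at h1
    have h2 : (coeffSigma k P R).comp (algebraMap 𝓔 𝓕) =
        (algebraMap 𝓔 𝓕).comp (integralSigma k P R) :=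
      RingHom.ext fun e => (coeffSigma_algebraMap e).symm
    rw [h2, PrimeSpectrum.comap_comp_apply, hy] at h1
    have hle : p' ≤ characterPoint γ hγ (i + 1) := hple
    have hle2 : p'.comap (integralSigma k P R) ≤ characterPoint γ hγ i := by
      rw [← comap_characterPoint γ hγ hz.generator]
      exact Ideal.comap_mono hple
    rwa [rankAtStalk_eq_of_le hle, rankAtStalk_eq_of_le hle2] at h1
  -- A decreasing sequence that returns to its initial value after every `d` steps is constant.
  have hanti : Antitone fun i => Module.rankAtStalk (R := 𝓔) V (characterPoint γ hγ i) :=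
    antitone_nat_of_succ_le hstep
  have hd : 0 < Module.finrank k (B ⧸ P) := by
    have : Nontrivial (B ⧸ P) := Ideal.Quotient.nontrivial_iff.2 (Ideal.IsMaximal.ne_top inferInstance)
    exact Module.finrank_pos
  have hper : ∀ i, Module.rankAtStalk (R := 𝓔) V (characterPoint γ hγ
      (i * Module.finrank k (B ⧸ P))) = Module.rankAtStalk (R := 𝓔) V (characterPoint γ hγ 0) := by
    intro i
    induction i with
    | zero => rw [zero_mul]
    | succ i ih => rw [add_mul, one_mul, characterPoint_add_finrank γ hγ hz.generator, ih]
  have hconst : ∀ i, Module.rankAtStalk (R := 𝓔) V (characterPoint γ hγ i) =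
      Module.rankAtStalk (R := 𝓔) V (characterPoint γ hγ 0) := fun i =>
    le_antisymm (hanti (Nat.zero_le i))
      ((hper i).symm.trans_le (hanti (Nat.le_mul_of_pos_right i hd)))
  refine ⟨Module.rankAtStalk (R := 𝓔) V (characterPoint γ hγ 0), fun x => ?_⟩
  obtain ⟨M, hM, hxM⟩ := Ideal.exists_le_maximal x.asIdeal x.2.ne_top
  obtain ⟨i, hi⟩ := exists_characterPoint_le γ hγ hz.generator M
  let M' : PrimeSpectrum 𝓔 := ⟨M, hM.isPrime⟩
  rw [← hconst i, rankAtStalk_eq_of_le (show x ≤ M' from hxM),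
    rankAtStalk_eq_of_le (show characterPoint γ hγ i ≤ M' from hi)]

end LatticeMap
end

/-! ### The local isocrystal as an extension -/

noncomputable section

attribute [local instance] Algebra.TensorProduct.rightAlgebra

theorem rankAtStalk_ker_add {E W S : Type*} [CommRing E] [AddCommGroup W] [Module E W]
    [AddCommGroup S] [Module E S] [Module.Projective E S] [Module.Finite E S]
    [Module.Projective E W] [Module.Finite E W] (π : W →ₗ[E] S)
    (hπ : Function.Surjective π) (x : PrimeSpectrum E) :
    Module.rankAtStalk (R := E) (LinearMap.ker π) x + Module.rankAtStalk (R := E) S x =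
      Module.rankAtStalk (R := E) W x := by
  have := finite_ker_of_projective π hπ
  have := projective_ker_of_projective π hπ
  obtain ⟨p, hp⟩ := exists_projection_ker π hπ
  have hp' : ∀ y : LinearMap.ker π, p y = y := fun y => DFunLike.congr_fun hp y
  have hb : Function.Bijective (p.prod π) := by
    constructor
    · rw [injective_iff_map_eq_zero]
      intro w hw
      have h1 : p w = 0 := congrArg Prod.fst hw
      have h2 : π w = 0 := congrArg Prod.snd hw
      have h3 := hp' ⟨w, h2⟩
      exact congrArg Subtype.val (h3.symm.trans h1)
    · rintro ⟨n, s⟩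
      obtain ⟨w, rfl⟩ := hπ s
      refine ⟨n + (w - p w), Prod.ext ?_ ?_⟩
      · change p (n + (w - p w)) = n
        rw [map_add, map_sub, hp', hp', sub_self, add_zero]
      · change π (n + (w - p w)) = π w
        have h1 : π (n : W) = 0 := n.2
        have h2 : π (p w : W) = 0 := (p w).2
        rw [map_add, map_sub, h1, h2, sub_zero, zero_add]
  rw [Module.rankAtStalk_eq_of_equiv (LinearEquiv.ofBijective _ hb), Module.rankAtStalk_prod,
    Pi.add_apply]

namespace DrinfeldModule

variable {k A R : Type*} [Field k] [Fintype k] [CommRing A] [Algebra k A]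
    [CommRing R] [Algebra k R] {r : ℕ} {φ : DrinfeldModule k A R r}
    {R' : Type*} [CommRing R'] [Algebra k R'] [Algebra R R'] [IsScalarTower k R R']

local notation "𝓔" => IntegralCoeffRing k φ.characteristicIdeal R'
local notation "𝓕" => CoeffRing k φ.characteristicIdeal R'

variable (φ R') in
/-- The embedding of the lattice into the local isocrystal. -/
def latticeToLocal : φ.LocalLattice R' →ₛₗ[algebraMap 𝓔 𝓕]
    φ.LocalIsocrystal φ.characteristicIdeal R' :=
  BaseChange.compMap (toIntegralCoeffRing φ.characteristicIdeal R') (algebraMap 𝓔 𝓕) φ.Motive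

theorem latticeToLocal_latticeTau (w : φ.LocalLattice R') :
    φ.latticeToLocal R' (φ.latticeTau R' w) =
      φ.localTau φ.characteristicIdeal R' (φ.latticeToLocal R' w) := by
  induction w using BaseChange.induction_on with
  | zero => simp only [map_zero]
  | add x y hx hy => simp only [map_add, hx, hy]
  | tmul e m =>
    exact congrArg (fun c => BaseChange.tmul (toCoeffRing φ.characteristicIdeal R') c
      (φ.motiveTau m)) (coeffSigma_algebraMap e)

variable (φ R') in
/-- The localization of the module of twisted power series. -/
abbrev LocalSeries : Type _ := BaseChange (algebraMap 𝓔 𝓕) (φ.Series R')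

variable (φ R') in
/-- The canonical map from twisted power series to their localization. -/
def seriesEmbed : φ.Series R' →ₛₗ[algebraMap 𝓔 𝓕] φ.LocalSeries R' := latticeEmbed (φ.Series R')

theorem span_range_seriesEmbed : Submodule.span 𝓕 (Set.range (φ.seriesEmbed R')) = ⊤ :=
  span_range_latticeEmbed

variable (φ R') in
/-- The action of `τ` on the localized twisted power series. -/
def localSeriesTau : φ.LocalSeries R' →ₛₗ[coeffSigma k φ.characteristicIdeal R'] φ.LocalSeries R' :=
  baseChangeTau (algebraMap 𝓔 𝓕) coeffSigma_algebraMap (φ.seriesFrob R')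

theorem seriesEmbed_seriesFrob (s : φ.Series R') :
    φ.seriesEmbed R' (φ.seriesFrob R' s) =
      φ.localSeriesTau R' (φ.seriesEmbed R' s) := by
  refine Eq.trans ?_ (baseChangeTau_tmul _ _ _ _ _).symm
  rw [map_one]
  rfl

variable (φ R') in
/-- The map from the local isocrystal to the localized twisted power series. -/
def localToSeries : φ.LocalIsocrystal φ.characteristicIdeal R' →ₗ[𝓕] φ.LocalSeries R' :=
  BaseChange.liftSemilinear
    { toFun := fun m => φ.seriesEmbed R' (φ.latticeToSeries R' (φ.toLattice R' m))
      map_add' := fun m n => by simp only [map_add]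
      map_smul' := fun e m => by
        rw [(φ.toLattice R').map_smulₛₗ, map_smul, (φ.seriesEmbed R').map_smulₛₗ]
        rfl }

theorem localToSeries_tmul (e : 𝓕) (m : φ.Motive) :
    φ.localToSeries R' (BaseChange.tmul _ e m) =
      e • φ.seriesEmbed R' (φ.latticeToSeries R' (φ.toLattice R' m)) := rfl

theorem localToSeries_latticeToLocal (w : φ.LocalLattice R') :
    φ.localToSeries R' (φ.latticeToLocal R' w) = φ.seriesEmbed R' (φ.latticeToSeries R' w) := by
  induction w using lattice_induction with
  | zero => simp only [map_zero]
  | add x y hx hy => simp only [map_add, hx, hy]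
  | smul e m =>
    rw [(φ.latticeToLocal R').map_smulₛₗ, map_smul, map_smul, (φ.seriesEmbed R').map_smulₛₗ]
    congr 1
    refine (localToSeries_tmul _ m).trans ?_
    rw [map_one, one_smul]

theorem localToSeries_localTau (x : φ.LocalIsocrystal φ.characteristicIdeal R') :
    φ.localToSeries R' (φ.localTau φ.characteristicIdeal R' x) =
      φ.localSeriesTau R' (φ.localToSeries R' x) := by
  induction x using BaseChange.induction_on with
  | zero => simp only [map_zero]
  | add x y hx hy => simp only [map_add, hx, hy]
  | tmul e m =>
    rw [localToSeries_tmul, (φ.localSeriesTau R').map_smulₛₗ, ← seriesEmbed_seriesFrob,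
      ← latticeToSeries_latticeTau, latticeTau_toLattice]
    rfl

variable (φ R') in
theorem localTau_ker_le : LinearMap.ker (φ.localToSeries R') ≤
    (LinearMap.ker (φ.localToSeries R')).comap (φ.localTau φ.characteristicIdeal R') := by
  intro x hx
  rw [LinearMap.mem_ker] at hx
  rw [Submodule.mem_comap, LinearMap.mem_ker, localToSeries_localTau, hx, map_zero]

variable (φ R') in
theorem latticeTau_ker_le : LinearMap.ker (φ.latticeToSeries R') ≤
    (LinearMap.ker (φ.latticeToSeries R')).comap (φ.latticeTau R') := by
  intro x hx
  rw [LinearMap.mem_ker] at hx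
  rw [Submodule.mem_comap, LinearMap.mem_ker, latticeToSeries_latticeTau, hx, map_zero]

variable (φ R') in
/-- The restriction of the embedding of the lattice to the kernels of the maps to twisted power
series. -/
def kerToLocal : LinearMap.ker (φ.latticeToSeries R') →ₛₗ[algebraMap 𝓔 𝓕]
    LinearMap.ker (φ.localToSeries R') where
  toFun w := ⟨φ.latticeToLocal R' w, by
    rw [LinearMap.mem_ker, localToSeries_latticeToLocal, LinearMap.mem_ker.1 w.2, map_zero]⟩
  map_add' v w := Subtype.ext (map_add (φ.latticeToLocal R') _ _)
  map_smul' e w := Subtype.ext ((φ.latticeToLocal R').map_smulₛₗ e w)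

variable [φ.characteristicIdeal.IsMaximal] {z : A}

theorem smul_mem_span_range_seriesFrob (hz : IsLocalGenerator φ.characteristicIdeal z) {j : ℕ}
    (hj : ∀ i < j, (φ.toAlgHom z).coeff i = 0)
    (hu : IsUnit (algebraMap R R' ((φ.toAlgHom z).coeff j))) (hj0 : 0 < j) (s : φ.Series R') :
    algebraMap A 𝓔 z • s ∈ Submodule.span 𝓔 (Set.range (φ.seriesFrob R')) := by
  have h1 : algebraMap A 𝓔 z • s ∈ (algebraMap A 𝓔 z • ⊤ : Submodule 𝓔 (φ.Series R')) :=
    Submodule.smul_mem_pointwise_smul _ _ _ trivial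
  rw [← span_range_iterate_seriesFrob hz hj hu] at h1
  refine Submodule.span_mono ?_ h1
  rintro _ ⟨s, rfl⟩
  obtain ⟨j, rfl⟩ := Nat.exists_eq_succ_of_ne_zero hj0.ne'
  rw [Function.iterate_succ_apply']
  exact ⟨_, rfl⟩

variable (hz : IsUniformizer k φ.characteristicIdeal R' z)
include hz

theorem isLatticeMap_latticeToLocal [Module.Projective 𝓔 (φ.LocalLattice R')] :
    IsLatticeMap (φ.latticeToLocal R') z where
  injective := BaseChange.compMap_injective _ _ hz.algebraMap_injective
  exists_pow_smul := hz.exists_pow_smul_of_span (BaseChange.span_range_compMap _ _)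

theorem isLatticeMap_seriesEmbed [Module.Projective 𝓔 (φ.Series R')] :
    IsLatticeMap (φ.seriesEmbed R') z :=
  isLatticeMap_latticeEmbed hz

/-- Kernels commute with inverting `z` here: after clearing denominators an element of the localized
kernel comes from the lattice, and its image in the series vanishes because the series embed in
their localization. -/
theorem isLatticeMap_kerToLocal [Module.Projective 𝓔 (φ.LocalLattice R')]
    [Module.Projective 𝓔 (φ.Series R')] : IsLatticeMap (φ.kerToLocal R') z where
  injective v w h :=
    Subtype.ext ((isLatticeMap_latticeToLocal hz).injective (congrArg Subtype.val h))
  exists_pow_smul x := by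
    obtain ⟨m, w, h⟩ := (isLatticeMap_latticeToLocal hz).exists_pow_smul (x : φ.LocalIsocrystal _ R')
    refine ⟨m, ⟨w, ?_⟩, Subtype.ext h⟩
    have h1 := congrArg (φ.localToSeries R') h
    rw [map_smul, LinearMap.mem_ker.1 x.2, smul_zero, localToSeries_latticeToLocal] at h1
    exact (isLatticeMap_seriesEmbed hz).injective (h1.symm.trans (map_zero _).symm)

/-- On the kernel lattice `τ` generates everything, which is purity of slope `0` with `n = 1`. On
the series `τ ^ (h d)` generates `z` times the lattice, which is purity of slope `1 / h` with `n =
h` and numerator `1`. Localizing the lattice sequence gives the filtration. -/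
theorem exists_isSlopeFiltration_localTau [FiniteDimensional k (A ⧸ φ.characteristicIdeal)]
    {D : ℕ} (hD : (φ.toAlgHom z).IsElliptic D) [Module.Finite 𝓔 (φ.LocalLattice R')]
    {h : ℕ} (hh : 0 < h)
    (hj : ∀ i < h * Module.finrank k (A ⧸ φ.characteristicIdeal), (φ.toAlgHom z).coeff i = 0)
    (hu : IsUnit (algebraMap R R'
      ((φ.toAlgHom z).coeff (h * Module.finrank k (A ⧸ φ.characteristicIdeal)))))
    (hrW : ∀ x, Module.rankAtStalk (R := 𝓔) (φ.LocalLattice R') x = r)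
    (hrS : ∀ x, Module.rankAtStalk (R := 𝓔) (φ.Series R') x = h) :
    IsIsocrystal (φ.localTau φ.characteristicIdeal R') ∧
      ∃ fil : ℚ → Submodule 𝓕 (φ.LocalIsocrystal φ.characteristicIdeal R'),
        IsSlopeFiltration fil (φ.localTau φ.characteristicIdeal R') ∧
        HasMultiplicity fil 0 (r - h) ∧ HasMultiplicity fil (1 / h) h ∧
        ∀ α : ℚ, α ≠ 0 → α ≠ 1 / h → HasMultiplicity fil α 0 := by
  set d := Module.finrank k (A ⧸ φ.characteristicIdeal)
  have hd : 0 < d := by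
    have : Nontrivial (A ⧸ φ.characteristicIdeal) :=
      Ideal.Quotient.nontrivial_iff.2 (Ideal.IsMaximal.ne_top inferInstance)
    exact Module.finrank_pos
  have hzg := hz.generator
  have := finite_series hzg hj hu
  have := projective_series hzg hj hu
  have := (projective_and_injective_lattice (R' := R') hzg hD).1
  have hsurj := latticeToSeries_surjective hzg hj hu
  have := finite_ker_of_projective _ hsurj
  have := projective_ker_of_projective _ hsurj
  have hX : IsDualizableOfRank (φ.localTau φ.characteristicIdeal R') r :=
    (isLatticeMap_latticeToLocal hz).isDualizableOfRank hz
      (smul_mem_span_range_latticeTau hzg.mem) latticeToLocal_latticeTau r hrW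
  have hQ : IsDualizableOfRank (φ.localSeriesTau R') h :=
    (isLatticeMap_seriesEmbed hz).isDualizableOfRank hz
      (smul_mem_span_range_seriesFrob hzg hj hu (Nat.mul_pos hh hd)) seriesEmbed_seriesFrob h hrS
  let tN := subTau (φ.latticeTau R') _ (latticeTau_ker_le φ R')
  let τN := subTau (φ.localTau φ.characteristicIdeal R') _ (localTau_ker_le φ R')
  have htN : Submodule.span 𝓔 (Set.range tN) = ⊤ := by
    rw [eq_top_iff]
    rintro ⟨x, hx⟩ _
    have hx' := hx
    rw [← span_latticeTau_ker hzg hj hu] at hx'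
    have h1 : (Submodule.span 𝓔 (Set.range tN)).map (LinearMap.ker (φ.latticeToSeries R')).subtype =
        Submodule.span 𝓔 (φ.latticeTau R' '' LinearMap.ker (φ.latticeToSeries R')) := by
      rw [Submodule.map_span]
      congr 1
      ext w
      constructor
      · rintro ⟨_, ⟨v, rfl⟩, rfl⟩
        exact ⟨v, v.2, rfl⟩
      · rintro ⟨v, hv, rfl⟩
        exact ⟨_, ⟨⟨v, hv⟩, rfl⟩, rfl⟩
    rw [← h1] at hx'
    obtain ⟨y, hy, hyx⟩ := hx'
    rwa [show y = ⟨x, hx⟩ from Subtype.ext hyx] at hy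
  have hcN : ∀ w, φ.kerToLocal R' (tN w) = τN (φ.kerToLocal R' w) := fun w =>
    Subtype.ext (latticeToLocal_latticeTau (w : φ.LocalLattice R'))
  have hN : IsDualizableOfRank τN (r - h) := by
    refine (isLatticeMap_kerToLocal hz).isDualizableOfRank hz (fun v => htN ▸ trivial) hcN _
      fun x => ?_
    have := rankAtStalk_ker_add _ hsurj x
    rw [hrW, hrS] at this
    omega
  have hN' : IsPure τN 0 := by
    refine isPure_of_lattice τN (φ.kerToLocal R').toAddMonoidHom (φ.kerToLocal R').map_smulₛₗ
      (isLatticeMap_kerToLocal hz).injective ((isLatticeMap_kerToLocal hz).span_range hz) 1 one_pos 0 0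
      (by simp) tN^[1 * d] (fun v => ?_) ?_
    · exact Function.Semiconj.iterate_right hcN _ v
    · rw [span_range_iterate_eq_top htN, pow_zero, Ideal.one_eq_top, Submodule.top_smul]
  have hQ' : IsPure (φ.localSeriesTau R') (1 / h) := by
    refine isPure_of_lattice _ (φ.seriesEmbed R').toAddMonoidHom
      (φ.seriesEmbed R').map_smulₛₗ
      (isLatticeMap_seriesEmbed hz).injective span_range_seriesEmbed h hh 1 _ ?_
      (φ.seriesFrob R')^[h * d] (fun v => ?_) ?_
    · rw [Nat.cast_one, mul_one_div_cancel (Nat.cast_ne_zero.2 hh.ne')]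
    · exact Function.Semiconj.iterate_right seriesEmbed_seriesFrob _ v
    · rw [span_range_iterate_seriesFrob hzg hj hu, pow_one, map_eq_span_coeff k R' hzg,
        Submodule.ideal_span_singleton_smul]
  have hsurjF : Function.Surjective (φ.localToSeries R') := by
    rw [← LinearMap.range_eq_top, eq_top_iff, ← span_range_seriesEmbed, Submodule.span_le]
    rintro _ ⟨s, rfl⟩
    obtain ⟨w, rfl⟩ := hsurj s
    exact ⟨_, localToSeries_latticeToLocal w⟩
  exact ⟨hX.isDualizable, exists_isSlopeFiltration _ _ (φ.localToSeries R') hsurjF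
    localToSeries_localTau (localTau_ker_le φ R') (by positivity) hX hN hQ hN' hQ'⟩

end DrinfeldModule
end

/-! ### Ideals with a principal power, and lowest terms -/

noncomputable section

open Finset.HasAntidiagonal (antidiagonal mem_antidiagonal)

attribute [local instance] Algebra.TensorProduct.rightAlgebra

section PrincipalPower

variable {B : Type*} [CommRing B] [IsDomain B] {P : Ideal B} {a : B} {n : ℕ}

/-- An ideal with a non-zero principal power is finitely generated. -/
theorem Ideal.fg_of_pow_eq_span (ha : a ≠ 0) (hn : 1 ≤ n) (h : Ideal.span {a} = P ^ n) :
    P.FG := by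
  let K := FractionRing B
  refine Ideal.fg_of_isUnit (S := nonZeroDivisors B) (IsFractionRing.injective B K) P ?_
  -- The inverse of `P` as a fractional ideal is `P ^ (n - 1) a⁻¹`, and invertible ideals are
  -- finitely generated.
  refine IsUnit.of_mul_eq_one ((P ^ (n - 1) : Ideal B) *
    FractionalIdeal.spanSingleton (nonZeroDivisors B) (algebraMap B K a)⁻¹) ?_
  rw [← mul_assoc, ← FractionalIdeal.coeIdeal_mul, mul_pow_sub_one (by omega), ← h,
    FractionalIdeal.coeIdeal_span_singleton, FractionalIdeal.spanSingleton_mul_spanSingleton,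
    mul_inv_cancel₀ ((map_ne_zero_iff _ (IsFractionRing.injective B K)).2 ha),
    FractionalIdeal.spanSingleton_one]

/-- If some power of `P` is principal, then an element of `P` that is not in `P ^ 2` generates `P`
locally. -/
theorem isLocalGenerator_of_pow_eq_span (ha : a ≠ 0) (hn : 1 ≤ n) (h : Ideal.span {a} = P ^ n)
    {z : B} (hz : z ∈ P) (hz2 : z ∉ P ^ 2) : IsLocalGenerator P z where
  fg := Ideal.fg_of_pow_eq_span ha hn h
  mem := hz
  exists_dvd := by
    have hdvd : ∀ w ∈ P ^ n, a ∣ w := fun w hw => Ideal.mem_span_singleton.1 (h ▸ hw)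
    -- Otherwise `z P ^ (n - 1) ⊆ aP`; multiplying by `P` gives `z a ∈ a P ^ 2`, that is `z ∈ P ^
    -- 2`. Given such `x` and `y`, any `w ∈ P` satisfies `w y = a c`, and cancelling `a` in `a x w =
    -- z y w` leaves `x w = z c`.
    obtain ⟨y, hy, x, hx, hxy⟩ : ∃ y ∈ P ^ (n - 1), ∃ x ∉ P, z * y = a * x := by
      by_contra! hcon
      refine hz2 ?_
      have h1 : Ideal.span {z} * P ^ (n - 1) ≤ Ideal.span {a} * P := by
        rw [Ideal.span_singleton_mul_le_iff]
        intro y hy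
        have h2 : z * y ∈ P ^ n := by
          rw [← mul_pow_sub_one (by omega : n ≠ 0)]
          exact Ideal.mul_mem_mul hz hy
        obtain ⟨x, hx⟩ := hdvd _ h2
        rw [Ideal.mem_span_singleton_mul]
        by_contra! hc
        exact hcon y hy x (fun hxP => hc x hxP hx.symm) hx
      have h2 := Ideal.mul_mono_left (K := P) h1
      rw [mul_assoc, pow_sub_one_mul (by omega), mul_assoc, ← pow_two, ← h] at h2
      have h3 : z * a ∈ Ideal.span {a} * P ^ 2 :=
        h2 (Ideal.mul_mem_mul (Ideal.mem_span_singleton_self _) (Ideal.mem_span_singleton_self _))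
      obtain ⟨c, hc, hca⟩ := Ideal.mem_span_singleton_mul.1 h3
      rw [mul_comm z] at hca
      rwa [← mul_left_cancel₀ ha hca]
    refine ⟨x, hx, fun w hw => ?_⟩
    obtain ⟨c, hc⟩ := hdvd (w * y) (by
      rw [← mul_pow_sub_one (by omega : n ≠ 0)]
      exact Ideal.mul_mem_mul hw hy)
    refine ⟨c, mul_left_cancel₀ ha ?_⟩
    linear_combination (-w) * hxy + z * hc

/-- With `z ^ n = a v` and `x a = z ^ n c` for some `x ∉ P`, cancelling `a` gives `x = v c`, so `v ∉
P`. -/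
theorem IsLocalGenerator.exists_pow_eq_mul [P.IsMaximal] (ha : a ≠ 0)
    (h : Ideal.span {a} = P ^ n) {z : B} (hz : IsLocalGenerator P z) :
    ∃ v ∉ P, z ^ n = a * v := by
  have h1 : z ^ n ∈ Ideal.span {a} := h ▸ Ideal.pow_mem_pow hz.mem n
  obtain ⟨v, hv⟩ := Ideal.mem_span_singleton.1 h1
  obtain ⟨x, hx, hxa⟩ := hz.exists_dvd_pow n
  obtain ⟨c, hc⟩ := hxa a (h ▸ Ideal.mem_span_singleton_self a)
  refine ⟨v, fun hvP => hx ?_, hv⟩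
  have h2 : x = v * c := mul_left_cancel₀ ha (by linear_combination hc + c * hv)
  rw [h2]
  exact P.mul_mem_right c hvP

end PrincipalPower

namespace TwistedPolynomial

variable {k E : Type*} [CommRing k] [CommRing E] [Algebra k E] {σ : E →ₐ[k] E}
  {f g : TwistedPolynomial σ} {i j : ℕ} {e e' : E}

theorem coeff_mul_eq_zero (hf : ∀ l < i, f.coeff l = 0) (hg : ∀ l < j, g.coeff l = 0) (l : ℕ)
    (hl : l < i + j) : (f * g).coeff l = 0 := by
  rw [coeff_mul]
  refine Finset.sum_eq_zero fun x hx => ?_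
  rw [mem_antidiagonal] at hx
  by_cases h : x.1 < i
  · rw [hf _ h, zero_mul]
  · rw [hg _ (by omega), map_zero, mul_zero]

theorem HasLowestTerm.mul (hf : f.HasLowestTerm i e) (hg : g.HasLowestTerm j e') :
    (f * g).HasLowestTerm (i + j) (e * (σ ^ i) e') := by
  refine ⟨coeff_mul_eq_zero hf.1 hg.1, ?_⟩
  rw [coeff_mul, Finset.sum_eq_single (i, j)]
  · rw [hf.2, hg.2]
  · rintro ⟨x, y⟩ hxy hne
    rw [mem_antidiagonal] at hxy
    change x + y = i + j at hxy
    by_cases h : x < i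
    · rw [hf.1 _ h, zero_mul]
    · by_cases h' : y < j
      · rw [hg.1 _ h', map_zero, mul_zero]
      · exact absurd (Prod.ext (by change x = i; omega) (by change y = j; omega)) hne
  · intro h
    exact absurd (mem_antidiagonal.2 (rfl : (i, j).1 + (i, j).2 = i + j)) h

theorem exists_hasLowestTerm (hf : ∃ i, f.coeff i ≠ 0) : ∃ i, ∃ e ≠ 0, f.HasLowestTerm i e := by
  classical
  exact ⟨Nat.find hf, _, Nat.find_spec hf, fun i hi => not_not.1 (Nat.find_min hf hi), rfl⟩

theorem HasLowestTerm.unique (hf : f.HasLowestTerm i e) (hg : f.HasLowestTerm j e') (he : e ≠ 0)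
    (he' : e' ≠ 0) : i = j ∧ e = e' := by
  have h : i = j := by
    by_contra hne
    rcases Nat.lt_or_gt_of_ne hne with h | h
    · exact he (hf.2 ▸ hg.1 i h)
    · exact he' (hg.2 ▸ hf.1 j h)
  subst h
  exact ⟨rfl, hf.2.symm.trans hg.2⟩

end TwistedPolynomial

namespace DrinfeldModule

variable {k A R : Type*} [Field k] [Fintype k] [CommRing A] [Algebra k A]
    [CommRing R] [Algebra k R] {r : ℕ} {φ : DrinfeldModule k A R r}

theorem coeff_eq_zero_of_mem_pow {m : ℕ} {b : A} (hb : b ∈ φ.characteristicIdeal ^ m) (i : ℕ)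
    (hi : i < m) : (φ.toAlgHom b).coeff i = 0 := by
  induction m generalizing b i with
  | zero => omega
  | succ m ih =>
    rw [pow_succ] at hb
    induction hb using Submodule.mul_induction_on' with
    | mem_mul_mem b hb c hc =>
      rw [map_mul]
      refine TwistedPolynomial.coeff_mul_eq_zero (i := m) (j := 1) (fun l hl => ih hb l hl)
        (fun l hl => ?_) i hi
      rw [Nat.lt_one_iff.1 hl, coeff_zero_eq_zero hc]
    | add b _ c _ hb hc => rw [map_add, TwistedPolynomial.coeff_add, hb, hc, add_zero]

theorem coeff_degree_ne_zero [Nontrivial R] {b : A} (hb : b ≠ 0) :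
    (φ.toAlgHom b).coeff (r * degA k b) ≠ 0 :=
  (φ.elliptic b hb).1.ne_zero

/-- The Drinfeld module itself gives separatedness: elements of `℘ ^ m` have no coefficients below
degree `m`, but `φ_b` has a non-zero one in degree `r deg(b)`. -/
theorem exists_notMem_pow [Nontrivial R] {b : A} (hb : b ≠ 0) :
    ∃ m, b ∉ φ.characteristicIdeal ^ m :=
  ⟨r * degA k b + 1, fun h => coeff_degree_ne_zero hb (coeff_eq_zero_of_mem_pow h _ (by omega))⟩

theorem degree_pos [Nontrivial R] {b : A} (hb : b ≠ 0) (hbP : b ∈ φ.characteristicIdeal) :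
    0 < r * degA k b :=
  Nat.pos_of_ne_zero fun h => coeff_degree_ne_zero hb (h ▸ coeff_zero_eq_zero hbP)

/-- `Module.finrank` would be `0` for an infinite-dimensional quotient. Then `φ_b` would have degree
`0` with unit constant coefficient, contradicting `b ∈ ℘`. -/
theorem finiteDimensional_quotient_span [Nontrivial R] {b : A} (hb : b ≠ 0)
    (hbP : b ∈ φ.characteristicIdeal) : FiniteDimensional k (A ⧸ Ideal.span {b}) :=
  Module.finite_of_finrank_pos (Nat.pos_of_mul_pos_left (degree_pos hb hbP))

/-- If `℘ = ℘ ^ 2`, all powers of `℘` coincide and contain `a`, against separatedness. -/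
theorem exists_mem_notMem_sq [Nontrivial R] {a : A} {n : ℕ} (ha : a ≠ 0) (hn : 1 ≤ n)
    (h : Ideal.span {a} = φ.characteristicIdeal ^ n) :
    ∃ z ∈ φ.characteristicIdeal, z ∉ φ.characteristicIdeal ^ 2 := by
  by_contra! hcon
  have hidem : φ.characteristicIdeal ^ 2 = φ.characteristicIdeal :=
    le_antisymm (Ideal.pow_le_self two_ne_zero) hcon
  have hpow : ∀ m, φ.characteristicIdeal ≤ φ.characteristicIdeal ^ (m + 1) := by
    intro m
    induction m with
    | zero => rw [zero_add, pow_one]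
    | succ m ih =>
      calc φ.characteristicIdeal = φ.characteristicIdeal * φ.characteristicIdeal := by
            rw [← pow_two, hidem]
        _ ≤ φ.characteristicIdeal ^ (m + 1) * φ.characteristicIdeal := Ideal.mul_mono_left ih
        _ = _ := (pow_succ _ _).symm
  have haP : a ∈ φ.characteristicIdeal :=
    Ideal.pow_le_self (by omega) (h ▸ Ideal.mem_span_singleton_self a)
  obtain ⟨m, hm⟩ := exists_notMem_pow (φ := φ) ha
  exact hm (Ideal.pow_le_pow_right (Nat.le_succ m) (hpow m haP))

theorem isUnit_characteristic [φ.characteristicIdeal.IsMaximal] {v : A}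
    (hv : v ∉ φ.characteristicIdeal) : IsUnit (φ.characteristic v) := by
  obtain ⟨y, i, hi, hyi⟩ := Ideal.IsMaximal.exists_inv (I := φ.characteristicIdeal) inferInstance hv
  have hi' : φ.characteristic i = 0 := hi
  have h := congrArg φ.characteristic hyi
  rw [map_add, map_mul, hi', add_zero, map_one] at h
  exact IsUnit.of_mul_eq_one_right _ h

theorem hasLowestTerm_characteristic (v : A) :
    (φ.toAlgHom v).HasLowestTerm 0 (φ.characteristic v) :=
  ⟨fun _ h => absurd h (Nat.not_lt_zero _), rfl⟩

theorem hasLowestTerm_pow [IsDomain R] {z : A} {j : ℕ} {e : R}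
    (h : (φ.toAlgHom z).HasLowestTerm j e) (n : ℕ) :
    ∃ N, (1 ≤ n → 1 ≤ N) ∧ (φ.toAlgHom (z ^ n)).HasLowestTerm (n * j) (e ^ N) := by
  induction n with
  | zero =>
    refine ⟨0, fun h => h, ?_⟩
    rw [pow_zero, pow_zero, zero_mul, ← map_one φ.characteristic]
    exact hasLowestTerm_characteristic 1
  | succ n ih =>
    obtain ⟨N, -, hN⟩ := ih
    refine ⟨N + Fintype.card k ^ (n * j), fun _ => ?_, ?_⟩
    · have := pow_pos (Fintype.card_pos (α := k)) (n * j)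
      omega
    · rw [pow_succ, map_mul, pow_add, add_mul, one_mul, ← frobenius_pow_apply]
      exact hN.mul h

variable [IsDomain A] [IsDomain R] [φ.characteristicIdeal.IsMaximal]
  {a z : A} {n ja jz : ℕ} {ε e : R}

/-- The lowest coefficients of `φ_a` and `φ_z` divide powers of each other. -/
theorem isUnit_algebraMap_lowest (ha : a ≠ 0) (hn : 1 ≤ n)
    (h : Ideal.span {a} = φ.characteristicIdeal ^ n)
    (hz : IsLocalGenerator φ.characteristicIdeal z)
    (hε : ε ≠ 0) (hla : (φ.toAlgHom a).HasLowestTerm ja ε) (he : e ≠ 0)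
    (hlz : (φ.toAlgHom z).HasLowestTerm jz e) {R' : Type*} [CommRing R'] [Algebra R R']
    (hu : IsUnit (algebraMap R R' ε)) : IsUnit (algebraMap R R' e) := by
  obtain ⟨v, hv, hva⟩ := hz.exists_pow_eq_mul ha h
  obtain ⟨N, hN, hl⟩ := hasLowestTerm_pow hlz n
  have hN := hN hn
  have hl' := hla.mul (hasLowestTerm_characteristic (φ := φ) v)
  rw [← map_mul, ← hva] at hl'
  have hv' := (isUnit_characteristic (φ := φ) hv).map (FiniteField.frobeniusAlgHom k R ^ ja)
  -- Comparing lowest coefficients in `z ^ n = a v` shows that a positive power of `e` is `ε` times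
  -- a Frobenius power of the characteristic of `v`, which is a unit since `v ∉ ℘`.
  have heq := (hl.unique hl' (pow_ne_zero _ he) (mul_ne_zero hε hv'.ne_zero)).2
  rw [← isUnit_pow_iff (by omega : N ≠ 0), ← map_pow, heq, map_mul]
  exact hu.mul (hv'.map (algebraMap R R'))

/-- Regularity of `z` holds on `A ⊗ R'`, which is torsion free over `A`, and is inherited by the
completion. -/
theorem isUniformizer_of_isLocalGenerator (hz : IsLocalGenerator φ.characteristicIdeal z)
    (hz0 : z ≠ 0) (R' : Type*) [CommRing R'] [Algebra k R'] [Algebra R R'] [IsScalarTower k R R'] :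
    IsUniformizer k φ.characteristicIdeal R' z where
  generator := hz
  isDomain := inferInstance
  ne_zero := hz0
  separated _ hb := exists_notMem_pow hb
  regular := by
    have h1 : ∀ s : A ⊗[k] R', algebraMap A (A ⊗[k] R') z • s = 0 → s = 0 := by
      intro s hs
      rw [algebraMap_smul] at hs
      exact (smul_eq_zero.1 hs).resolve_left hz0
    exact fun e => eq_zero_of_smul_eq_zero_adicCompletion hz h1 e

end DrinfeldModule
end

/-! ### The height and the proposition -/

noncomputable section

attribute [local instance] Algebra.TensorProduct.rightAlgebra

theorem Submodule.smul_top_eq_of_isUnit_mul {E M : Type*} [CommRing E] [AddCommGroup M]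
    [Module E M] {a b u : E} (hu : IsUnit u) (h : b = a * u) :
    (b • ⊤ : Submodule E M) = a • ⊤ := by
  rw [← Submodule.ideal_span_singleton_smul, ← Submodule.ideal_span_singleton_smul, h,
    Ideal.span_singleton_mul_right_unit hu]

namespace DrinfeldModule

variable {k A R : Type*} [Field k] [Fintype k] [CommRing A] [Algebra k A]
    [CommRing R] [Algebra k R] {r : ℕ} {φ : DrinfeldModule k A R r}
    [IsDomain A] [IsDomain R] [φ.characteristicIdeal.IsMaximal]
    {a z : A} {n ja jz : ℕ} {ε e : R}

/-- The height is the rank `c` of the module of series. Counting over `R'` in the quotients by `z`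
and by `z ^ n`, where `z ^ n` and `a` differ by a unit, gives `jz = c d` and `ja = c deg(a)`; the
same count for the lattice gives rank `r`. Surjectivity onto the series gives `c ≤ r`. -/
theorem exists_height (ha : a ≠ 0) (hn : 1 ≤ n)
    (h : Ideal.span {a} = φ.characteristicIdeal ^ n)
    (hz : IsLocalGenerator φ.characteristicIdeal z) (hz0 : z ≠ 0)
    (hε : ε ≠ 0) (hla : (φ.toAlgHom a).HasLowestTerm ja ε) (he : e ≠ 0)
    (hlz : (φ.toAlgHom z).HasLowestTerm jz e) (R' : Type*) [CommRing R'] [IsDomain R']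
    [Algebra k R'] [Algebra R R'] [IsScalarTower k R R'] (hu : IsUnit (algebraMap R R' ε)) :
    ∃ h : ℕ, 1 ≤ h ∧ h ≤ r ∧ jz = h * Module.finrank k (A ⧸ φ.characteristicIdeal) ∧
      ja = h * degA k a ∧ IsIsocrystal (φ.localTau φ.characteristicIdeal R') ∧
      ∃ fil : ℚ → Submodule (CoeffRing k φ.characteristicIdeal R')
          (φ.LocalIsocrystal φ.characteristicIdeal R'),
        IsSlopeFiltration fil (φ.localTau φ.characteristicIdeal R') ∧
        HasMultiplicity fil 0 (r - h) ∧ HasMultiplicity fil (1 / h) h ∧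
        ∀ α : ℚ, α ≠ 0 → α ≠ 1 / h → HasMultiplicity fil α 0 := by
  let E := IntegralCoeffRing k φ.characteristicIdeal R'
  have haP : a ∈ φ.characteristicIdeal :=
    Ideal.pow_le_self (by omega) (h ▸ Ideal.mem_span_singleton_self a)
  have hfa : FiniteDimensional k (A ⧸ φ.characteristicIdeal ^ n) :=
    h ▸ finiteDimensional_quotient_span ha haP
  have hfP1 : FiniteDimensional k (A ⧸ φ.characteristicIdeal ^ 1) :=
    Module.Finite.of_surjective
      (Ideal.Quotient.factorₐ k (Ideal.pow_le_pow_right hn)).toLinearMap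
      (Ideal.Quotient.factor_surjective (Ideal.pow_le_pow_right hn))
  have hfP : FiniteDimensional k (A ⧸ φ.characteristicIdeal) := by
    rwa [pow_one] at hfP1
  have hdegA : Module.finrank k (A ⧸ φ.characteristicIdeal ^ n) = degA k a := by
    rw [degA, h]
  have hra := degree_pos (φ := φ) ha haP
  have huz : IsUnit (algebraMap R R' ((φ.toAlgHom z).coeff jz)) := by
    rw [hlz.2]
    exact isUnit_algebraMap_lowest ha hn h hz hε hla he hlz hu
  have hua : IsUnit (algebraMap R R' ((φ.toAlgHom a).coeff ja)) := by rwa [hla.2]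
  have hU := isUniformizer_of_isLocalGenerator hz hz0 R'
  have hell := φ.elliptic z hz0
  have hfinM := finite_motive (degree_pos hz0 hz.mem) hell
  have hfinW : Module.Finite E (φ.LocalLattice R') := inferInstance
  have hprojW := (projective_and_injective_lattice (R' := R') hz hell).1
  have hfinS := finite_series (R' := R') hz hlz.1 huz
  have hprojS := projective_series (R' := R') hz hlz.1 huz
  let γ : A →ₐ[k] R' := (IsScalarTower.toAlgHom k R R').comp φ.characteristic
  have hγ : ∀ b ∈ φ.characteristicIdeal, γ b = 0 := by
    intro b hb
    have hb' : φ.characteristic b = 0 := hb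
    rw [AlgHom.comp_apply, hb', map_zero]
  obtain ⟨cW, hcW⟩ := exists_rankAtStalk_eq hU (t := φ.latticeTau R') γ
    (smul_mem_span_range_latticeTau hz.mem) hγ
  have hjz : 0 < jz := Nat.pos_of_ne_zero fun h0 => he (hlz.2 ▸ h0 ▸ coeff_zero_eq_zero hz.mem)
  have htS : ∀ s : φ.Series R', algebraMap A E z • s ∈
      Submodule.span E (Set.range (φ.seriesFrob R')) :=
    smul_mem_span_range_seriesFrob hz hlz.1 huz hjz
  obtain ⟨c, hc⟩ := exists_rankAtStalk_eq hU (t := φ.seriesFrob R') γ htS hγ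
  obtain ⟨v, hv, hva⟩ := hz.exists_pow_eq_mul ha h
  have huv := isUnit_algebraMap_coeff k R' hz.fg hv
  have hzn : algebraMap A E z ^ n = algebraMap A E a * algebraMap A E v := by
    rw [← map_pow, hva, map_mul]
  have hS1 := finrank_quotient_eq_mul k R' hz 1 c hc
  have hSn := finrank_quotient_eq_mul k R' hz n c hc
  have hWn := finrank_quotient_eq_mul k R' hz n cW hcW
  obtain ⟨e1⟩ := exists_series_quotient_equiv (R' := R') hlz.1 huz
  obtain ⟨e2⟩ := exists_series_quotient_equiv (R' := R') hla.1 hua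
  obtain ⟨e3⟩ := exists_lattice_quotient_equiv (R' := R') hz n
  obtain ⟨e4⟩ := exists_finiteSupport_quotient_equiv (R' := R') (φ.elliptic a ha)
  rw [pow_one, e1.finrank_eq, Module.finrank_fin_fun, pow_one] at hS1
  rw [Submodule.smul_top_eq_of_isUnit_mul huv hzn, e2.finrank_eq, Module.finrank_fin_fun,
    hdegA] at hSn
  rw [hdegA, ← e3.finrank_eq, ← Ideal.map_pow, ← h, Ideal.map_span, Set.image_singleton,
    Submodule.ideal_span_singleton_smul, ← e4.finrank_eq, Module.finrank_fin_fun] at hWn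
  have hcWr : cW = r := (Nat.eq_of_mul_eq_mul_right (Nat.pos_of_mul_pos_left hra) hWn).symm
  subst hcWr
  have hc0 : 0 < c := Nat.pos_of_mul_pos_right (hS1 ▸ hjz)
  have hcr := rankAtStalk_ker_add _ (latticeToSeries_surjective hz hlz.1 huz)
    (characterPoint γ hγ 0)
  rw [hc, hcW] at hcr
  refine ⟨c, hc0, by omega, hS1, hSn, ?_⟩
  subst hS1
  exact exists_isSlopeFiltration_localTau hU hell hc0 hlz.1 huz hcW hc

end DrinfeldModule
end
theorem proposition15p5 {k F R : Type*} [Field k] [Fintype k]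
    [Field F] [Algebra k F] (hF : IsCurveFunctionField k F)
    (pt : ValuationSubring F) (hpt : pt ≠ ⊤)
    [CommRing R] [IsDomain R] [IsNoetherianRing R] [Algebra k R]
    (r : ℕ) (hr : 1 ≤ r) (φ : DrinfeldModule k (regularOutside k pt) R r)
    (hmax : φ.characteristicIdeal.IsMaximal) :
    ∃ h : ℕ, 1 ≤ h ∧ h ≤ r ∧
      ∀ (a : regularOutside k pt) (n : ℕ), a ≠ 0 → 1 ≤ n →
        Ideal.span {a} = φ.characteristicIdeal ^ n →
        ∃ ε : R, ε ≠ 0 ∧ (φ.toAlgHom a).HasLowestTerm (h * degA k a) ε ∧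
          IsIsocrystal (φ.localTau φ.characteristicIdeal (Localization.Away ε)) ∧
          ∃ fil : ℚ → Submodule (CoeffRing k φ.characteristicIdeal (Localization.Away ε))
              (φ.LocalIsocrystal φ.characteristicIdeal (Localization.Away ε)),
            IsSlopeFiltration fil (φ.localTau φ.characteristicIdeal (Localization.Away ε)) ∧
            HasMultiplicity fil 0 (r - h) ∧
            HasMultiplicity fil (1 / h) h ∧
            ∀ α : ℚ, α ≠ 0 → α ≠ 1 / h → HasMultiplicity fil α 0 := by
  have hlow : ∀ b : regularOutside k pt, b ≠ 0 →
      ∃ j, ∃ e ≠ 0, (φ.toAlgHom b).HasLowestTerm j e := fun b hb =>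
    TwistedPolynomial.exists_hasLowestTerm ⟨_, DrinfeldModule.coeff_degree_ne_zero hb⟩
  by_cases hex : ∃ (a : regularOutside k pt) (n : ℕ), a ≠ 0 ∧ 1 ≤ n ∧
      Ideal.span {a} = φ.characteristicIdeal ^ n
  · obtain ⟨a₀, n₀, ha₀, hn₀, h₀⟩ := hex
    obtain ⟨z, hzP, hzP2⟩ := DrinfeldModule.exists_mem_notMem_sq ha₀ hn₀ h₀
    have hz := isLocalGenerator_of_pow_eq_span ha₀ hn₀ h₀ hzP hzP2
    have hz0 : z ≠ 0 := fun hz0 => hzP2 (hz0 ▸ zero_mem _)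
    obtain ⟨jz, e, he, hlz⟩ := hlow z hz0
    have key : ∀ (a : regularOutside k pt) (n : ℕ), a ≠ 0 → 1 ≤ n →
        Ideal.span {a} = φ.characteristicIdeal ^ n → ∃ (ε : R) (ja : ℕ), ε ≠ 0 ∧
          (φ.toAlgHom a).HasLowestTerm ja ε ∧ ∃ h : ℕ, 1 ≤ h ∧ h ≤ r ∧
            jz = h * Module.finrank k (regularOutside k pt ⧸ φ.characteristicIdeal) ∧
            ja = h * degA k a ∧
            IsIsocrystal (φ.localTau φ.characteristicIdeal (Localization.Away ε)) ∧
            ∃ fil : ℚ → Submodule (CoeffRing k φ.characteristicIdeal (Localization.Away ε))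
                (φ.LocalIsocrystal φ.characteristicIdeal (Localization.Away ε)),
              IsSlopeFiltration fil (φ.localTau φ.characteristicIdeal (Localization.Away ε)) ∧
              HasMultiplicity fil 0 (r - h) ∧
              HasMultiplicity fil (1 / h) h ∧
              ∀ α : ℚ, α ≠ 0 → α ≠ 1 / h → HasMultiplicity fil α 0 := by
      intro a n ha hn h
      obtain ⟨ja, ε, hε, hla⟩ := hlow a ha
      have : IsDomain (Localization.Away ε) :=
        IsLocalization.isDomain_localization (powers_le_nonZeroDivisors_of_noZeroDivisors hε)
      exact ⟨ε, ja, hε, hla, DrinfeldModule.exists_height ha hn h hz hz0 hε hla he hlz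
        (Localization.Away ε) (IsLocalization.Away.algebraMap_isUnit ε)⟩
    obtain ⟨-, -, -, -, h, hh1, hhr, hh, -⟩ := key a₀ n₀ ha₀ hn₀ h₀
    refine ⟨h, hh1, hhr, fun a n ha hn hP => ?_⟩
    obtain ⟨ε, ja, hε, hla, h', -, -, hh', hja, hiso⟩ := key a n ha hn hP
    have hjz : 0 < jz := Nat.pos_of_ne_zero fun h0 =>
      he (hlz.2 ▸ h0 ▸ DrinfeldModule.coeff_zero_eq_zero hzP)
    -- Both heights satisfy `jz = h d` for the same `z`, chosen before `a`, and `d` is positive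
    -- because `jz` is.
    obtain rfl : h = h' := Nat.eq_of_mul_eq_mul_right (Nat.pos_of_mul_pos_left (hh ▸ hjz))
      (hh.symm.trans hh')
    exact ⟨ε, hε, hja ▸ hla, hiso⟩
  -- If no power of `℘` is principal, the assertion about `a` is empty and any value in the allowed
  -- range serves.
  · exact ⟨1, le_rfl, hr, fun a n ha hn h => absurd ⟨a, n, ha, hn, h⟩ hex⟩
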